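/- Let $n\ge 3$ and let $P\subset\mathbb R^n$ be a simple polytope, i.e. the convex hull of finitely many points, with nonempty interior, such that every vertex of $P$ lies in exactly $n$ facets of $P$. For $N\ge 1$ let $X_1,\dots,X_N$ be independent random points, each uniformly distributed on the boundary $\partial P$ (that is, according to the normalized $(n-1)$-dimensional Hausdorff measure on $\partial P$), and let $P_N=[X_1,\dots,X_N]$ be their convex hull. Denote by $V_n$ the $n$-dimensional volume. Then the random variable $V_n(P)-V_n(P_N)$ is integrable, and there is a constant $c_{n,P}>0$, depending only on $n$ and $P$, such that $$ \mathbb E\bigl(V_n(P)-V_n(P_N)\bigr)=c_{n,P}\,N^{-\frac{n}{n-1}}\Bigl(1+O\bigl(N^{-\frac{1}{(n-1)(n-2)}}\bigr)\Bigr)\qquad (N\to\infty), $$ where the implicit constant in $O(\cdot)$ may depend on $n$ and $P$. -/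

import Mathlib

open MeasureTheory Filter Asymptotics
open scoped MeasureTheory

noncomputable section

/-- A facet of a convex set `P ⊆ ℝⁿ`: a nonempty exposed face of affine dimension `n - 1`. -/
def IsFacet {n : ℕ} (P F : Set (EuclideanSpace ℝ (Fin n))) : Prop :=
  IsExposed ℝ P F ∧ F.Nonempty ∧ Module.finrank ℝ (vectorSpan ℝ F) + 1 = n

/-- A simple polytope in `ℝⁿ`: the convex hull of finitely many points, with nonempty interior,
such that every vertex (extreme point) lies in exactly `n` facets. -/
structure IsSimplePolytope {n : ℕ} (P : Set (EuclideanSpace ℝ (Fin n))) : Prop where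
  exists_finset : ∃ s : Finset (EuclideanSpace ℝ (Fin n)), P = convexHull ℝ (s : Set _)
  interior_nonempty : (interior P).Nonempty
  encard_facets : ∀ v ∈ P.extremePoints ℝ,
    {F : Set (EuclideanSpace ℝ (Fin n)) | IsFacet P F ∧ v ∈ F}.encard = (n : ℕ∞)

/-- The uniform distribution on the boundary of `P ⊆ ℝⁿ`: the `(n - 1)`-dimensional Hausdorff
measure restricted to the topological boundary, normalized to total mass one. -/
def uniformBoundary {n : ℕ} (P : Set (EuclideanSpace ℝ (Fin n))) :
    Measure (EuclideanSpace ℝ (Fin n)) :=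
  ProbabilityTheory.cond (Measure.hausdorffMeasure ((n : ℝ) - 1)) (frontier P)

/-- The joint law of `N` independent uniform random points on the boundary of `P`. -/
def boundarySample {n : ℕ} (P : Set (EuclideanSpace ℝ (Fin n))) (N : ℕ) :
    Measure (Fin N → EuclideanSpace ℝ (Fin n)) :=
  Measure.pi fun _ => uniformBoundary P

/-- The volume difference `V_n(P) - V_n([x_1, …, x_N])`. -/
def volumeDifference {n : ℕ} (P : Set (EuclideanSpace ℝ (Fin n))) {N : ℕ}
    (x : Fin N → EuclideanSpace ℝ (Fin n)) : ℝ :=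
  volume.real P - volume.real (convexHull ℝ (Set.range x))

end

/-! ### Random convex hulls -/

section RandomHull

set_option linter.unusedSectionVars false

variable {E : Type*} [NormedAddCommGroup E] [NormedSpace ℝ E]

/-! By Fubini the expectation is the integral over `P` of the probability `missProb` that a point
`y` is missed by the random hull. At a vertex, simplicity supplies a linear chart that turns `P`
locally into the orthant and the boundary law into one with constant densities on the coordinate
hyperplanes (`IsCornerMeasure`).

Suppose `y` is missed by the sample points in a small cube at the corner. The signs of a separating
functional then name one of finitely many boxes on the coordinate hyperplanes that contain no sample
point, and each of these boxes has mass at least a multiple of e(y), the elementary symmetric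
polynomial of degree n-1 (`cornerSum`). Hence the probability of missing `y` is at most C exp(-c N
e(y)) (`IsCornerMeasure.localMissProb_le`). By homogeneity the integral of this bound over the
orthant is of order N^(-n/(n-1)). The part where a coordinate exceeds a fixed size is only of order
N^(-(n-1)/(n-2)), since e(y) is at least y_i times the same polynomial of the other coordinates. The
quotient of the two orders is N^(-1/((n-1)(n-2))), the relative error of the theorem.

No formula for the constant is computed; the limit exists by self-similarity. Conditioned on their
number, the points in the cube of side s form an independent sample from one fixed law dilated by s.
That number is binomial, and the missed volume varies slowly with the sample size, because by
Carathéodory at most dim + 1 points are indispensable for covering `y`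
(`missProb_sub_missProb_succ_le`). So N points of a corner measure miss almost the same volume as
s^n times that of m points of the normalised corner, m being the expected number in the cube
(`IsCornerMeasure.exists_abs_setIntegral_sub_le`). Applied to the normalised corner itself, this
makes the rescaled missed volume a Cauchy sequence with a rate (`exists_limit_cornerMiss`).

Away from the vertices, `y` is a convex combination of its contractions towards the vertices, so one
of these is missed whenever `y` is, and the exponential bound applies to them. -/

theorem convexHull_range_eq_image_stdSimplex {ι : Type*} [Fintype ι] (x : ι → E) :
    convexHull ℝ (Set.range x) = (fun w : ι → ℝ => ∑ i, w i • x i) '' stdSimplex ℝ ι := by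
  classical
  have : (fun w : ι → ℝ => ∑ i, w i • x i) = Fintype.linearCombination ℝ x := by
    ext w; simp [Fintype.linearCombination_apply]
  rw [this, ← convexHull_rangle_single_eq_stdSimplex, LinearMap.image_convexHull,
    ← Set.range_comp]
  congr 2
  ext i
  simp [Fintype.linearCombination_apply_single]

/-- The set is the projection of a closed set along the simplex of weights, and projecting out a
compact factor is a closed map. This is the source of all measurability below. -/
theorem isClosed_mem_convexHull_range {ι : Type*} [Fintype ι] :
    IsClosed {p : (ι → E) × E | p.2 ∈ convexHull ℝ (Set.range p.1)} := by
  have hc : IsClosed {q : stdSimplex ℝ ι × ((ι → E) × E) |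
      ∑ i, (q.1 : ι → ℝ) i • q.2.1 i = q.2.2} :=
    isClosed_eq (continuous_finsetSum _ fun i _ => Continuous.smul
      ((continuous_apply i).comp (continuous_subtype_val.comp continuous_fst))
      ((continuous_apply i).comp (continuous_fst.comp continuous_snd)))
      (continuous_snd.comp continuous_snd)
  have : CompactSpace (stdSimplex ℝ ι) := isCompact_iff_compactSpace.1 (isCompact_stdSimplex ℝ ι)
  convert isClosedMap_snd_of_compactSpace _ hc using 1
  ext ⟨x, y⟩
  simp only [Set.mem_ofPred_eq, convexHull_range_eq_image_stdSimplex, Set.mem_image, Prod.exists,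
    Subtype.exists]
  constructor
  · rintro ⟨w, hw, h⟩
    exact ⟨w, hw, x, y, h, rfl⟩
  · rintro ⟨w, hw, x', y', h, h'⟩
    obtain ⟨rfl, rfl⟩ := Prod.mk.inj h'
    exact ⟨w, hw, h⟩

variable [MeasurableSpace E] [BorelSpace E]

/-- The probability that a point is missed by the convex hull of `N` independent points. -/
noncomputable def missProb (μ : Measure E) (N : ℕ) (y : E) : ℝ :=
  (Measure.pi fun _ : Fin N => μ).real {x | y ∉ convexHull ℝ (Set.range x)}

/-- The probability that a point is missed by the convex hull of those of `N` independent points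
that fall into `B`. -/
noncomputable def localMissProb (μ : Measure E) (B : Set E) (N : ℕ) (y : E) : ℝ :=
  (Measure.pi fun _ : Fin N => μ).real {x | y ∉ convexHull ℝ (Set.range x ∩ B)}

theorem measurePreserving_comp_injective {ι κ : Type*} [Fintype ι] [Fintype κ]
    (μ : Measure E) [IsProbabilityMeasure μ] {f : κ → ι} (hf : f.Injective) :
    MeasurePreserving (fun x : ι → E => x ∘ f) (Measure.pi fun _ => μ)
      (Measure.pi fun _ => μ) := by
  have h := ProbabilityTheory.iIndepFun_pi (μ := fun _ : ι => μ) (X := fun _ : ι => (id : E → E))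
    (fun _ => aemeasurable_id)
  have h2 := (h.precomp hf).map_fun_eq_pi_map (fun i => (measurable_pi_apply _).aemeasurable)
  refine ⟨by fun_prop, ?_⟩
  have h3 : (fun i : κ => Measure.map (fun x : ι → E => id (x (f i))) (Measure.pi fun _ => μ)) =
      fun _ => μ :=
    funext fun i => (measurePreserving_eval (fun _ : ι => μ) (f i)).map_eq
  exact h2.trans (congrArg Measure.pi h3)

variable [FiniteDimensional ℝ E]

theorem measurableSet_mem_convexHull_range {ι : Type*} [Fintype ι] :
    MeasurableSet {p : (ι → E) × E | p.2 ∈ convexHull ℝ (Set.range p.1)} :=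
  isClosed_mem_convexHull_range.measurableSet

theorem measurableSet_notMem_convexHull_range {ι : Type*} [Fintype ι] (y : E) :
    MeasurableSet {x : ι → E | y ∉ convexHull ℝ (Set.range x)} :=
  (measurableSet_mem_convexHull_range.preimage
    (measurable_id.prodMk (measurable_const (a := y)))).compl

theorem range_inter_eq_image {ι : Type*} (x : ι → E) {B : Set E} {T : Set ι}
    (h : ∀ i, x i ∈ B ↔ i ∈ T) : Set.range x ∩ B = x '' T := by
  ext z
  constructor
  · rintro ⟨⟨i, rfl⟩, hi⟩
    exact ⟨i, (h i).1 hi, rfl⟩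
  · rintro ⟨i, hi, rfl⟩
    exact ⟨⟨i, rfl⟩, (h i).2 hi⟩

theorem measurableSet_mem_convexHull_range_inter {ι : Type*} [Fintype ι] {B : Set E}
    (hB : MeasurableSet B) :
    MeasurableSet {p : (ι → E) × E | p.2 ∈ convexHull ℝ (Set.range p.1 ∩ B)} := by
  -- Split according to the set `T` of indices whose points fall into `B`; on each piece the hull is
  -- that of a fixed subfamily.
  have : {p : (ι → E) × E | p.2 ∈ convexHull ℝ (Set.range p.1 ∩ B)} =
      ⋃ T : Set ι, {p : (ι → E) × E | ∀ i, p.1 i ∈ B ↔ i ∈ T} ∩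
        {p | p.2 ∈ convexHull ℝ (Set.range fun i : T => p.1 i)} := by
    ext p
    simp only [Set.mem_ofPred_eq, Set.mem_iUnion, Set.mem_inter_iff]
    constructor
    · intro h
      refine ⟨{i | p.1 i ∈ B}, fun i => Iff.rfl, ?_⟩
      rwa [range_inter_eq_image p.1 (B := B) (T := {i | p.1 i ∈ B}) fun i => Iff.rfl,
        Set.image_eq_range] at h
    · rintro ⟨T, hT, h⟩
      rwa [range_inter_eq_image p.1 hT, Set.image_eq_range]
  rw [this]
  have : Finite (Set ι) := inferInstance
  refine MeasurableSet.iUnion fun T => ?_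
  classical
  refine MeasurableSet.inter ?_ ?_
  · have : {p : (ι → E) × E | ∀ i, p.1 i ∈ B ↔ i ∈ T} =
        ⋂ i, {p : (ι → E) × E | p.1 i ∈ B ↔ i ∈ T} := by ext; simp
    rw [this]
    refine MeasurableSet.iInter fun i => ?_
    have hi : MeasurableSet {p : (ι → E) × E | p.1 i ∈ B} :=
      hB.preimage ((measurable_pi_apply i).comp measurable_fst)
    by_cases h : i ∈ T
    · simpa only [h, iff_true] using hi
    · simp only [h, iff_false]
      exact hi.compl
  · have := measurableSet_mem_convexHull_range (E := E) (ι := T)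
    have hm : Measurable fun p : (ι → E) × E => ((fun i : T => p.1 i), p.2) := by fun_prop
    exact this.preimage hm

theorem measurable_missProb (μ : Measure E) [IsProbabilityMeasure μ] (N : ℕ) :
    Measurable (missProb μ N) :=
  (measurable_measure_prodMk_right
    (measurableSet_mem_convexHull_range (E := E) (ι := Fin N)).compl).ennreal_toReal

theorem measurable_localMissProb (μ : Measure E) [IsProbabilityMeasure μ] {B : Set E}
    (hB : MeasurableSet B) (N : ℕ) : Measurable (localMissProb μ B N) :=
  (measurable_measure_prodMk_right
    (measurableSet_mem_convexHull_range_inter (ι := Fin N) hB).compl).ennreal_toReal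

theorem missProb_nonneg (μ : Measure E) (N : ℕ) (y : E) : 0 ≤ missProb μ N y :=
  measureReal_nonneg

theorem missProb_le_one (μ : Measure E) [IsProbabilityMeasure μ] (N : ℕ) (y : E) :
    missProb μ N y ≤ 1 :=
  measureReal_le_one

theorem localMissProb_nonneg (μ : Measure E) (B : Set E) (N : ℕ) (y : E) :
    0 ≤ localMissProb μ B N y :=
  measureReal_nonneg

theorem localMissProb_le_one (μ : Measure E) [IsProbabilityMeasure μ] (B : Set E) (N : ℕ) (y : E) :
    localMissProb μ B N y ≤ 1 :=
  measureReal_le_one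

theorem missProb_le_localMissProb (μ : Measure E) [IsProbabilityMeasure μ] (B : Set E) (N : ℕ)
    (y : E) : missProb μ N y ≤ localMissProb μ B N y :=
  measureReal_mono fun _ hx h => hx (convexHull_mono Set.inter_subset_left h)

/-- A subfamily of an independent sample is an independent sample. -/
theorem pi_real_notMem_convexHull_image {ι κ : Type*} [Fintype ι] [Fintype κ]
    (μ : Measure E) [IsProbabilityMeasure μ] {f : κ → ι} (hf : f.Injective) (y : E) :
    (Measure.pi fun _ : ι => μ).real {x | y ∉ convexHull ℝ (x '' Set.range f)} =
      missProb μ (Fintype.card κ) y := by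
  let e := Fintype.equivFin κ
  have h := measurePreserving_comp_injective μ (hf.comp e.symm.injective)
  rw [missProb, ← h.measureReal_preimage (measurableSet_notMem_convexHull_range y).nullMeasurableSet]
  congr 1
  ext x
  simp only [Set.mem_ofPred_eq, Set.mem_preimage]
  rw [← Set.range_comp, ← Function.comp_assoc, e.symm.surjective.range_comp]

theorem pi_real_notMem_convexHull_range {ι : Type*} [Fintype ι]
    (μ : Measure E) [IsProbabilityMeasure μ] (y : E) :
    (Measure.pi fun _ : ι => μ).real {x | y ∉ convexHull ℝ (Set.range x)} =
      missProb μ (Fintype.card ι) y := by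
  simpa using pi_real_notMem_convexHull_image (ι := ι) μ Function.injective_id y

theorem missProb_antitone (μ : Measure E) [IsProbabilityMeasure μ] (y : E) :
    Antitone fun N => missProb μ N y := by
  intro m N h
  have := pi_real_notMem_convexHull_image μ (Fin.castLE_injective h) y
  rw [Fintype.card_fin] at this
  change missProb μ N y ≤ missProb μ m y
  rw [← this]
  exact measureReal_mono fun x hx hy =>
    hx (convexHull_mono (Set.image_subset_range x _) hy)

/-- Points whose removal excludes `y` from the hull: at most `dim + 1` by Carathéodory. -/
theorem card_critical_le {ι : Type*} [Fintype ι] [DecidableEq ι] (x : ι → E) (y : E)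
    (hy : y ∈ convexHull ℝ (Set.range x)) (C : Finset ι)
    (hC : ∀ i ∈ C, y ∉ convexHull ℝ (x '' {i}ᶜ)) : C.card ≤ Module.finrank ℝ E + 1 := by
  rw [convexHull_eq_union] at hy
  simp only [Set.mem_iUnion] at hy
  obtain ⟨t, ht, hind, hyt⟩ := hy
  -- If the value at a critical index were repeated elsewhere, the Carathéodory simplex `t` would
  -- survive the removal of that index. So `x` is injective on `C`, and likewise it maps `C` into
  -- `t`.
  have key : ∀ i ∈ C, ∀ j, j ≠ i → x j ≠ x i := by
    intro i hi j hj hji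
    refine hC i hi (convexHull_mono ?_ hyt)
    intro z hz
    obtain ⟨l, rfl⟩ := ht hz
    by_cases hl : l = i
    · exact ⟨j, hj, by rw [hl, hji]⟩
    · exact ⟨l, hl, rfl⟩
  have hmem : ∀ i ∈ C, x i ∈ t := by
    intro i hi
    by_contra hn
    refine hC i hi (convexHull_mono ?_ hyt)
    intro z hz
    obtain ⟨l, rfl⟩ := ht hz
    refine ⟨l, ?_, rfl⟩
    rintro rfl
    exact hn hz
  have h1 : C.card ≤ t.card :=
    Finset.card_le_card_of_injOn x hmem fun i hi j hj hij => by
      by_contra hne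
      exact key j hj i hne hij
  have h2 := hind.card_le_finrank_succ
  rw [Fintype.card_coe] at h2
  have h3 := (vectorSpan ℝ (Set.range ((↑) : t → E))).finrank_le
  omega

end RandomHull

/-! ### Sensitivity to the sample size, and the sample points in a region -/

section RandomHull

set_option linter.unusedSectionVars false

variable {E : Type*} [NormedAddCommGroup E] [NormedSpace ℝ E] [MeasurableSpace E] [BorelSpace E]
  [FiniteDimensional ℝ E]

/-- The left side is the expected number of indices whose removal uncovers `y`, and this number
never exceeds dim + 1. It vanishes unless one of two disjoint half samples misses `y`: a critical
index lies outside at least one of the halves, and that half is contained in the remaining points.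
-/
theorem sum_pi_real_critical_le (μ : Measure E) [IsProbabilityMeasure μ] (N : ℕ) (y : E) :
    ∑ i : Fin (N + 1), (Measure.pi fun _ : Fin (N + 1) => μ).real
      ({x | y ∉ convexHull ℝ (x '' {i}ᶜ)} \ {x | y ∉ convexHull ℝ (Set.range x)}) ≤
      (Module.finrank ℝ E + 1) * (2 * missProb μ ((N + 1) / 2) y) := by
  classical
  set π := Measure.pi fun _ : Fin (N + 1) => μ
  set h := (N + 1) / 2 with hh
  set f₁ : Fin h → Fin (N + 1) := Fin.castLE (by omega) with hf₁
  set f₂ : Fin h → Fin (N + 1) := fun j => ⟨j + h, by omega⟩ with hf₂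
  have hi₁ : f₁.Injective := Fin.castLE_injective _
  have hi₂ : f₂.Injective := fun a b hab => by
    simp only [hf₂, Fin.mk.injEq] at hab; ext; omega
  set V₁ := {x : Fin (N + 1) → E | y ∉ convexHull ℝ (x '' Set.range f₁)} with hV₁
  set V₂ := {x : Fin (N + 1) → E | y ∉ convexHull ℝ (x '' Set.range f₂)} with hV₂
  have m₁ : π.real V₁ = missProb μ h y := by
    simpa using pi_real_notMem_convexHull_image μ hi₁ y
  have m₂ : π.real V₂ = missProb μ h y := by
    simpa using pi_real_notMem_convexHull_image μ hi₂ y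
  have hU : MeasurableSet {x : Fin (N + 1) → E | y ∉ convexHull ℝ (Set.range x)} :=
    measurableSet_notMem_convexHull_range y
  have hm : ∀ T : Set (Fin (N + 1)),
      MeasurableSet {x : Fin (N + 1) → E | y ∉ convexHull ℝ (x '' T)} := by
    intro T
    have := measurableSet_notMem_convexHull_range (E := E) (ι := T) y
    have hr : Measurable fun (x : Fin (N + 1) → E) (i : T) => x i := by fun_prop
    simp only [Set.image_eq_range]
    exact this.preimage hr
  set A : Fin (N + 1) → Set (Fin (N + 1) → E) := fun i =>
    {x | y ∉ convexHull ℝ (x '' {i}ᶜ)} \ {x | y ∉ convexHull ℝ (Set.range x)} with hA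
  have hAm : ∀ i, MeasurableSet (A i) := fun i => (hm _).diff hU
  have key : ∑ i, π (A i) ≤ (Module.finrank ℝ E + 1 : ℕ) * π (V₁ ∪ V₂) := by
    calc ∑ i, π (A i) = ∫⁻ x, ∑ i, (A i).indicator 1 x ∂π := by
          rw [lintegral_finsetSum _ fun i _ => measurable_one.indicator (hAm i)]
          exact Finset.sum_congr rfl fun i _ => (lintegral_indicator_one (hAm i)).symm
      _ ≤ ∫⁻ x, (Module.finrank ℝ E + 1 : ℕ) * (V₁ ∪ V₂).indicator 1 x ∂π := by
          refine lintegral_mono fun x => ?_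
          have hs : ∑ i, (A i).indicator (1 : (Fin (N + 1) → E) → ENNReal) x =
              ((Finset.univ.filter fun i => x ∈ A i).card : ENNReal) := by
            simp only [Set.indicator_apply, Pi.one_apply]
            rw [Finset.sum_boole]
          rw [hs]
          set C := Finset.univ.filter fun i => x ∈ A i with hC
          rcases C.eq_empty_or_nonempty with h0 | ⟨i, hi⟩
          · simp [h0]
          have hiA : x ∈ A i := by simpa [hC] using hi
          have hy : y ∈ convexHull ℝ (Set.range x) := by
            by_contra hn
            exact hiA.2 hn
          have hcard := card_critical_le x y hy C fun j hj => by
            have : x ∈ A j := by simpa [hC] using hj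
            exact this.1
          have hxV : x ∈ V₁ ∪ V₂ := by
            by_cases hi1 : i ∈ Set.range f₁
            · right
              intro hmem
              refine hiA.1 (convexHull_mono (Set.image_mono ?_) hmem)
              rintro _ ⟨j, rfl⟩ hji
              obtain ⟨l, hl⟩ := hi1
              have hji : f₂ j = i := hji
              rw [← hl] at hji
              have := congrArg Fin.val hji
              simp only [hf₁, hf₂, Fin.val_castLE] at this
              omega
            · left
              intro hmem
              refine hiA.1 (convexHull_mono (Set.image_mono ?_) hmem)
              intro j hj hji
              exact hi1 ((show j = i from hji) ▸ hj)
          rw [Set.indicator_of_mem hxV]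
          simpa using (Nat.cast_le (α := ENNReal)).2 hcard
      _ = (Module.finrank ℝ E + 1 : ℕ) * π (V₁ ∪ V₂) := by
          rw [lintegral_const_mul _ (measurable_one.indicator ((hm _).union (hm _))),
            lintegral_indicator_one ((hm _).union (hm _))]
  have h2 : ∑ i, π.real (A i) ≤ (Module.finrank ℝ E + 1 : ℕ) * π.real (V₁ ∪ V₂) := by
    simp only [Measure.real]
    rw [← ENNReal.toReal_sum fun i _ => measure_ne_top _ _, ← ENNReal.toReal_natCast,
      ← ENNReal.toReal_mul]
    exact ENNReal.toReal_mono (ENNReal.mul_ne_top (by simp) (measure_ne_top _ _)) key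
  refine h2.trans ?_
  push_cast
  gcongr
  calc π.real (V₁ ∪ V₂) ≤ π.real V₁ + π.real V₂ := measureReal_union_le _ _
    _ = 2 * missProb μ h y := by rw [m₁, m₂]; ring

/-- Adding one more sample point changes the probability of missing `y` by a relative amount of
order `1 / N`. -/
theorem missProb_sub_missProb_succ_le (μ : Measure E) [IsProbabilityMeasure μ] (N : ℕ) (y : E) :
    missProb μ N y - missProb μ (N + 1) y ≤
      2 * (Module.finrank ℝ E + 1) / (N + 1) * missProb μ ((N + 1) / 2) y := by
  have h := sum_pi_real_critical_le μ N y
  -- By exchangeability all summands agree, so each is the average of the sum just bounded.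
  have hterm : ∀ i : Fin (N + 1), (Measure.pi fun _ : Fin (N + 1) => μ).real
      ({x | y ∉ convexHull ℝ (x '' {i}ᶜ)} \ {x | y ∉ convexHull ℝ (Set.range x)}) =
      missProb μ N y - missProb μ (N + 1) y := by
    intro i
    have h1 := pi_real_notMem_convexHull_image μ (Fin.succAbove_right_injective (p := i)) y
    rw [Fin.range_succAbove, Fintype.card_fin] at h1
    rw [measureReal_sdiff ?_ (measurableSet_notMem_convexHull_range y), h1]
    · rfl
    · intro x hx hn
      exact hx (convexHull_mono (Set.image_subset_range _ _) hn)
  simp only [hterm, Finset.sum_const, Finset.card_univ, Fintype.card_fin, nsmul_eq_mul] at h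
  rw [div_mul_eq_mul_div, le_div_iff₀ (by positivity)]
  push_cast at h
  linarith

theorem Measure.pi_const_smul {ι : Type*} [Fintype ι] (μ : Measure E) [IsProbabilityMeasure μ]
    {c : ENNReal} (hc : c ≠ ⊤) :
    Measure.pi (fun _ : ι => c • μ) = c ^ Fintype.card ι • Measure.pi fun _ : ι => μ := by
  have : IsFiniteMeasure (c • μ) := Measure.smul_finite μ hc
  refine Measure.pi_eq fun s hs => ?_
  simp [Measure.pi_pi, Finset.prod_mul_distrib]

/-- Once the indices of the points in `B` are prescribed, the coordinates split into two independent
blocks. Since `μ` restricted to `B` is `μ B` times the conditional law, the first block yields a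
power of `μ B` and a miss probability for that law. -/
theorem pi_real_inter_notMem_convexHull (μ : Measure E) [IsProbabilityMeasure μ] {B : Set E}
    (hB : MeasurableSet B) (hμB : μ B ≠ 0) (N : ℕ) (y : E) (p : Fin N → Prop) [DecidablePred p] :
    (Measure.pi fun _ : Fin N => μ).real
        ({x | ∀ i, x i ∈ B ↔ p i} ∩ {x | y ∉ convexHull ℝ (x '' {i | p i})}) =
      μ.real B ^ Fintype.card {i // p i} * (1 - μ.real B) ^ Fintype.card {i // ¬ p i} *
        missProb (ProbabilityTheory.cond μ B) (Fintype.card {i // p i}) y ∧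
    MeasurableSet ({x : Fin N → E | ∀ i, x i ∈ B ↔ p i} ∩
      {x | y ∉ convexHull ℝ (x '' {i | p i})}) := by
  have : IsProbabilityMeasure (ProbabilityTheory.cond μ B) :=
    ProbabilityTheory.cond_isProbabilityMeasure hμB
  set ν := ProbabilityTheory.cond μ B with hν
  have hres : μ.restrict B = μ B • ν := by
    rw [hν, ProbabilityTheory.cond, smul_smul, ENNReal.mul_inv_cancel hμB (measure_ne_top _ _),
      one_smul]
  set D : Set (Fin N → E) :=
    {x | ∀ i, x i ∈ B ↔ p i} ∩ {x | y ∉ convexHull ℝ (x '' {i | p i})} with hD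
  have mp := measurePreserving_piEquivPiSubtypeProd (fun _ : Fin N => μ) p
  set G : Set ((({i // p i} → E)) × ({i // ¬ p i} → E)) :=
    ((Set.univ.pi fun _ => B) ∩ {x | y ∉ convexHull ℝ (Set.range x)}) ×ˢ
      (Set.univ.pi fun _ => Bᶜ) with hG
  have hGm : MeasurableSet G :=
    ((MeasurableSet.univ_pi fun _ => hB).inter (measurableSet_notMem_convexHull_range y)).prod
      (MeasurableSet.univ_pi fun _ => hB.compl)
  have hDG : D = (MeasurableEquiv.piEquivPiSubtypeProd (fun _ => E) p) ⁻¹' G := by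
    ext x
    simp only [hD, hG, Set.mem_inter_iff, Set.mem_ofPred_eq, Set.mem_preimage, Set.mem_prod,
      MeasurableEquiv.piEquivPiSubtypeProd_apply, Set.mem_pi, Set.mem_univ, true_imp_iff,
      Subtype.forall, Set.mem_compl_iff, Set.image_eq_range]
    constructor
    · rintro ⟨h1, h2⟩
      exact ⟨⟨fun i hi => (h1 i).2 hi, h2⟩, fun i hi h => hi ((h1 i).1 h)⟩
    · rintro ⟨⟨h1, h2⟩, h3⟩
      exact ⟨fun i => ⟨fun h => by_contra fun hn => h3 i hn h, h1 i⟩, h2⟩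
  refine ⟨?_, hDG ▸ mp.measurable hGm⟩
  have e1 : (Measure.pi fun _ : Fin N => μ) D =
      (μ B ^ Fintype.card {i // p i} * (Measure.pi fun _ : {i // p i} => ν)
      {x | y ∉ convexHull ℝ (Set.range x)}) * (μ Bᶜ) ^ Fintype.card {i // ¬ p i} := by
    rw [hDG, mp.measure_preimage hGm.nullMeasurableSet, hG, Measure.prod_prod, Measure.pi_pi]
    congr 1
    · rw [Set.inter_comm, ← Measure.restrict_apply (measurableSet_notMem_convexHull_range y),
        Measure.restrict_pi_pi]
      simp only [hres]
      rw [Measure.pi_const_smul ν (measure_ne_top _ _)]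
      simp
    · rw [Finset.prod_const, Finset.card_univ]
  have e2 : (μ Bᶜ).toReal = 1 - μ.real B := by
    rw [← Measure.real, probReal_compl_eq_one_sub hB]
  rw [Measure.real, e1, ENNReal.toReal_mul, ENNReal.toReal_mul, ENNReal.toReal_pow,
    ENNReal.toReal_pow, e2, ← pi_real_notMem_convexHull_range (ι := {i // p i}) ν y]
  simp only [Measure.real]
  ring

/-- Conditionally on the number of sample points in `B`, these points are an independent sample
of the conditional distribution. -/
theorem localMissProb_eq_sum (μ : Measure E) [IsProbabilityMeasure μ] {B : Set E}
    (hB : MeasurableSet B) (hμB : μ B ≠ 0) (N : ℕ) (y : E) :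
    localMissProb μ B N y = ∑ j ∈ Finset.range (N + 1),
      (N.choose j) * μ.real B ^ j * (1 - μ.real B) ^ (N - j) *
        missProb (ProbabilityTheory.cond μ B) j y := by
  classical
  have : IsProbabilityMeasure (ProbabilityTheory.cond μ B) :=
    ProbabilityTheory.cond_isProbabilityMeasure hμB
  set ν := ProbabilityTheory.cond μ B with hν
  set π := Measure.pi fun _ : Fin N => μ
  set D : Finset (Fin N) → Set (Fin N → E) := fun S =>
    {x | ∀ i, x i ∈ B ↔ i ∈ S} ∩ {x | y ∉ convexHull ℝ (x '' (S : Set (Fin N)))} with hD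
  have hcover : {x : Fin N → E | y ∉ convexHull ℝ (Set.range x ∩ B)} =
      ⋃ S ∈ (Finset.univ : Finset (Finset (Fin N))), D S := by
    ext x
    simp only [Set.mem_ofPred_eq, Finset.mem_univ, Set.iUnion_true, Set.mem_iUnion, hD,
      Set.mem_inter_iff]
    constructor
    · intro h
      refine ⟨Finset.univ.filter fun i => x i ∈ B, fun i => by simp, ?_⟩
      rwa [← range_inter_eq_image x (B := B) fun i => by simp]
    · rintro ⟨S, hS, h⟩
      rwa [range_inter_eq_image x (B := B) hS]
  have hDm : ∀ S, π.real (D S) = μ.real B ^ S.card * (1 - μ.real B) ^ (N - S.card) *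
      missProb ν S.card y ∧ MeasurableSet (D S) := by
    intro S
    have h := pi_real_inter_notMem_convexHull μ hB hμB N y (fun i => i ∈ S)
    have c1 : @Fintype.card {i // i ∈ S} (Subtype.fintype _) = S.card := by
      rw [Fintype.card_subtype]; simp
    have c2 : Fintype.card {i // ¬ i ∈ S} = N - S.card := by
      rw [Fintype.card_subtype_compl, Fintype.card_fin]; simp
    rw [c2, c1] at h
    exact h
  rw [localMissProb, hcover, measureReal_biUnion_finset ?_ fun S _ => (hDm S).2]
  -- Each summand depends on `S` only through its cardinality, which produces the binomial
  -- coefficients.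
  · rw [Finset.sum_congr rfl fun S _ => (hDm S).1]
    have := Finset.sum_powerset_apply_card (fun j => μ.real B ^ j * (1 - μ.real B) ^ (N - j) *
      missProb ν j y) (x := (Finset.univ : Finset (Fin N)))
    rw [Finset.powerset_univ, Finset.card_univ, Fintype.card_fin] at this
    rw [this]
    exact Finset.sum_congr rfl fun j _ => by rw [nsmul_eq_mul]; ring
  · intro S _ T _ hST
    refine Set.disjoint_left.2 fun x hx hx' => hST ?_
    ext i
    exact (hx.1 i).symm.trans (hx'.1 i)

/-- If hitting every region of a finite family forces `y` into the hull, then the probability of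
missing `y` is at most the sum of the probabilities of missing a region. -/
theorem pi_real_le_sum_of_regions {κ : Type*} (I : Finset κ) (μ : Measure E)
    [IsProbabilityMeasure μ] (N : ℕ) (R : κ → Set E) (hR : ∀ a ∈ I, MeasurableSet (R a))
    (W : Set (Fin N → E))
    (hW : ∀ x ∈ W, ∃ a ∈ I, ∀ i, x i ∉ R a) :
    (Measure.pi fun _ : Fin N => μ).real W ≤ ∑ a ∈ I, (1 - μ.real (R a)) ^ N := by
  have hsub : W ⊆ ⋃ a ∈ I, Set.univ.pi fun _ => (R a)ᶜ := by
    intro x hx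
    obtain ⟨a, ha, h⟩ := hW x hx
    simp only [Set.mem_iUnion]
    exact ⟨a, ha, fun i _ => h i⟩
  refine (measureReal_mono hsub (measure_ne_top _ _)).trans ((measureReal_biUnion_finset_le _ _).trans ?_)
  refine Finset.sum_le_sum fun a ha => ?_
  rw [Measure.real, Measure.pi_pi, Finset.prod_const, Finset.card_univ, Fintype.card_fin,
    ENNReal.toReal_pow, ← Measure.real, probReal_compl_eq_one_sub (hR a ha)]

end RandomHull

/-! ### The elementary symmetric polynomial of degree `n - 1` and its exponential integral -/

section CornerSum

/-- The sum over `i` of the products of all coordinates except the `i`-th one. -/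
noncomputable def cornerSum {n : ℕ} (y : Fin n → ℝ) : ℝ :=
  ∑ i, ∏ j, Function.update y i 1 j

theorem prod_update_one {n : ℕ} (y : Fin (n + 1) → ℝ) (i : Fin (n + 1)) :
    ∏ j, Function.update y i 1 j = ∏ j, y (i.succAbove j) := by
  rw [Fin.prod_univ_succAbove _ i]
  simp [Fin.succAbove_ne]

theorem cornerSum_succ {n : ℕ} (y : Fin (n + 1) → ℝ) :
    cornerSum y = ∑ i : Fin (n + 1), ∏ j, y (i.succAbove j) := by
  simp only [cornerSum, prod_update_one]

theorem cornerSum_nonneg {n : ℕ} {y : Fin n → ℝ} (hy : 0 ≤ y) : 0 ≤ cornerSum y := by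
  refine Finset.sum_nonneg fun i _ => Finset.prod_nonneg fun j _ => ?_
  by_cases h : j = i
  · subst h; simp
  · simpa [h] using hy j

theorem continuous_cornerSum {n : ℕ} : Continuous (cornerSum : (Fin n → ℝ) → ℝ) := by
  unfold cornerSum
  fun_prop

theorem cornerSum_smul {n : ℕ} (c : ℝ) (y : Fin (n + 1) → ℝ) :
    cornerSum (c • y) = c ^ n * cornerSum y := by
  simp only [cornerSum_succ, Pi.smul_apply, smul_eq_mul, Finset.prod_mul_distrib,
    Finset.prod_const, Finset.card_univ, Fintype.card_fin, Finset.mul_sum]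

/-- Drop the one product that omits `y i`; all others contain the factor `y i`. This inequality
drives the induction on the dimension and all tail estimates. -/
theorem mul_cornerSum_succAbove_le {n : ℕ} {y : Fin (n + 1) → ℝ} (hy : 0 ≤ y)
    (i : Fin (n + 1)) : y i * cornerSum (fun j => y (i.succAbove j)) ≤ cornerSum y := by
  rw [cornerSum, cornerSum, Fin.sum_univ_succAbove _ i, Finset.mul_sum]
  have h0 : 0 ≤ ∏ j, Function.update y i 1 j := by
    rw [prod_update_one]; exact Finset.prod_nonneg fun j _ => hy _
  refine le_add_of_nonneg_of_le h0 (Finset.sum_le_sum fun l _ => le_of_eq ?_)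
  rw [Fin.prod_univ_succAbove _ i, Function.update_of_ne (Fin.succAbove_ne i l).symm]
  congr 1
  refine Finset.prod_congr rfl fun j _ => ?_
  by_cases h : j = l
  · subst h; simp
  · rw [Function.update_of_ne h, Function.update_of_ne]
    exact fun h' => h (Fin.succAbove_right_injective h')

theorem lintegral_insertNth {n : ℕ} (i : Fin (n + 1)) (F : (Fin (n + 1) → ℝ) → ENNReal)
    (hF : Measurable F) :
    ∫⁻ y, F y = ∫⁻ t : ℝ, ∫⁻ z : Fin n → ℝ, F (i.insertNth t z) := by
  have h := (volume_preserving_piFinSuccAbove (fun _ : Fin (n + 1) => ℝ) i).symm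
  rw [← h.lintegral_comp hF, Measure.volume_eq_prod, lintegral_prod _ (by
    exact (hF.comp (MeasurableEquiv.measurable _)).aemeasurable)]
  rfl

/-- The exponential integral of `cornerSum` over the orthant. -/
noncomputable def cornerIntegral (n : ℕ) : ENNReal :=
  ∫⁻ y : Fin (n + 1) → ℝ in Set.Ici 0, ENNReal.ofReal (Real.exp (-cornerSum y))

/-- The polynomial is homogeneous of degree n in n+1 variables, so the dilation by κ^(1/n) absorbs κ
and has Jacobian κ^((n+1)/n). -/
theorem lintegral_exp_neg_mul_cornerSum {n : ℕ} (hn : 1 ≤ n) {κ : ℝ} (hκ : 0 < κ) :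
    ∫⁻ y : Fin (n + 1) → ℝ in Set.Ici 0, ENNReal.ofReal (Real.exp (-(κ * cornerSum y))) =
      ENNReal.ofReal (κ ^ (-((n + 1 : ℝ) / n))) * cornerIntegral n := by
  have hn0 : (n : ℝ) ≠ 0 := by positivity
  set t : ℝ := κ ^ (1 / (n : ℝ)) with ht
  have ht0 : 0 < t := by positivity
  have htn : t ^ n = κ := by
    rw [ht, ← Real.rpow_natCast, ← Real.rpow_mul hκ.le]
    field_simp; simp
  have hmap := Measure.map_addHaar_smul (volume : Measure (Fin (n + 1) → ℝ)) ht0.ne'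
  have hF : Measurable fun y : Fin (n + 1) → ℝ =>
      (Set.Ici 0).indicator (fun y => ENNReal.ofReal (Real.exp (-cornerSum y))) y :=
    Measurable.indicator (by have := continuous_cornerSum (n := n + 1); fun_prop) measurableSet_Ici
  have h1 : ∫⁻ y, (Set.Ici 0).indicator (fun y => ENNReal.ofReal (Real.exp (-cornerSum y))) y
      ∂(Measure.map (t • ·) (volume : Measure (Fin (n + 1) → ℝ))) =
      ∫⁻ y : Fin (n + 1) → ℝ in Set.Ici 0, ENNReal.ofReal (Real.exp (-(κ * cornerSum y))) := by
    rw [lintegral_map hF (measurable_const_smul t), ← lintegral_indicator measurableSet_Ici]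
    refine lintegral_congr fun y => ?_
    have : t • y ∈ Set.Ici (0 : Fin (n + 1) → ℝ) ↔ y ∈ Set.Ici (0 : Fin (n + 1) → ℝ) := by
      simp only [Set.mem_Ici, Pi.le_def, Pi.zero_apply, Pi.smul_apply, smul_eq_mul]
      exact forall_congr' fun i => ⟨fun h => nonneg_of_mul_nonneg_right h ht0,
        fun h => mul_nonneg ht0.le h⟩
    by_cases hy : y ∈ Set.Ici (0 : Fin (n + 1) → ℝ)
    · rw [Set.indicator_of_mem hy, Set.indicator_of_mem (this.2 hy), cornerSum_smul, htn]
    · rw [Set.indicator_of_notMem hy, Set.indicator_of_notMem fun h => hy (this.1 h)]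
  rw [← h1, hmap, lintegral_smul_measure, lintegral_indicator measurableSet_Ici, cornerIntegral,
    smul_eq_mul]
  congr 2
  rw [abs_of_pos (by positivity), Module.finrank_fin_fun, ht, ← Real.rpow_natCast,
    ← Real.rpow_mul hκ.le, Real.rpow_neg hκ.le]
  congr 2
  push_cast
  field_simp

/-- Integrate over the slices y_i = t. There the polynomial is at least t times that of the other
coordinates, so the slice contributes at most (κ t)^(-(n+1)/n) times the integral in one dimension
less, and t^(-(n+1)/n) integrates over [s, ∞) to n s^(-1/n). The decay in κ is faster than the
(n+2)/(n+1) of the full orthant. -/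
theorem setLIntegral_tail_cornerSum_le {n : ℕ} (hn : 1 ≤ n) {κ s : ℝ} (hκ : 0 < κ) (hs : 0 < s)
    (i : Fin (n + 2)) :
    ∫⁻ y : Fin (n + 2) → ℝ in {y | 0 ≤ y ∧ s ≤ y i},
      ENNReal.ofReal (Real.exp (-(κ * cornerSum y))) ≤
      ENNReal.ofReal (n * κ ^ (-((n + 1 : ℝ) / n)) * s ^ (-(1 / (n : ℝ)))) *
        cornerIntegral n := by
  have hn0 : (0 : ℝ) < n := by positivity
  have hc := continuous_cornerSum (n := n + 2)
  have hc' := continuous_cornerSum (n := n + 1)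
  have hS : MeasurableSet {y : Fin (n + 2) → ℝ | 0 ≤ y ∧ s ≤ y i} :=
    (measurableSet_Ici (a := (0 : Fin (n + 2) → ℝ))).inter
      (measurableSet_le measurable_const (measurable_pi_apply i))
  have h0 : ∀ t ∈ Set.Ici s,
      ∫⁻ z : Fin (n + 1) → ℝ in Set.Ici 0, ENNReal.ofReal (Real.exp (-(κ * t * cornerSum z))) =
      ENNReal.ofReal (κ ^ (-((n + 1 : ℝ) / n))) * cornerIntegral n *
        ENNReal.ofReal (t ^ (-((n + 1 : ℝ) / n))) := by
    intro t ht
    have ht0 : 0 < t := hs.trans_le ht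
    rw [lintegral_exp_neg_mul_cornerSum hn (mul_pos hκ ht0), Real.mul_rpow hκ.le ht0.le,
      ENNReal.ofReal_mul (by positivity)]
    ring
  have hexp : -((n + 1 : ℝ) / n) < -1 := by
    rw [neg_lt_neg_iff, lt_div_iff₀ hn0]; linarith
  calc ∫⁻ y : Fin (n + 2) → ℝ in {y | 0 ≤ y ∧ s ≤ y i},
        ENNReal.ofReal (Real.exp (-(κ * cornerSum y)))
      ≤ ∫⁻ y : Fin (n + 2) → ℝ in {y | 0 ≤ y ∧ s ≤ y i},
        ENNReal.ofReal (Real.exp (-(κ * y i * cornerSum fun j => y (i.succAbove j)))) := by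
        refine setLIntegral_mono' hS fun y hy => ENNReal.ofReal_le_ofReal (Real.exp_le_exp.2 ?_)
        have := mul_cornerSum_succAbove_le hy.1 i
        nlinarith
    _ = ∫⁻ y : Fin (n + 2) → ℝ, ({y | 0 ≤ y ∧ s ≤ y i} : Set (Fin (n + 2) → ℝ)).indicator
        (fun y => ENNReal.ofReal
          (Real.exp (-(κ * y i * cornerSum fun j => y (i.succAbove j))))) y := by
        rw [lintegral_indicator hS]
    _ = ∫⁻ t in Set.Ici s, ∫⁻ z : Fin (n + 1) → ℝ in Set.Ici 0,
        ENNReal.ofReal (Real.exp (-(κ * t * cornerSum z))) := by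
        rw [lintegral_insertNth i _ (Measurable.indicator (by fun_prop) hS),
          ← lintegral_indicator measurableSet_Ici]
        refine lintegral_congr fun t => ?_
        by_cases ht : t ∈ Set.Ici s
        · rw [Set.indicator_of_mem ht, ← lintegral_indicator measurableSet_Ici]
          refine lintegral_congr fun z => ?_
          have hz : i.insertNth t z ∈ {y : Fin (n + 2) → ℝ | 0 ≤ y ∧ s ≤ y i} ↔
              z ∈ Set.Ici (0 : Fin (n + 1) → ℝ) := by
            simp only [Set.mem_ofPred_eq, Fin.insertNth_apply_same, Set.mem_Ici, Fin.le_insertNth_iff]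
            exact ⟨fun h => h.1.2, fun h => ⟨⟨hs.le.trans ht, h⟩, ht⟩⟩
          by_cases h : z ∈ Set.Ici (0 : Fin (n + 1) → ℝ)
          · rw [Set.indicator_of_mem h, Set.indicator_of_mem (hz.2 h)]
            simp
          · rw [Set.indicator_of_notMem h, Set.indicator_of_notMem fun h' => h (hz.1 h')]
        · rw [Set.indicator_of_notMem ht]
          refine (lintegral_congr fun z => ?_).trans lintegral_zero
          refine Set.indicator_of_notMem (fun h => ht ?_) _
          simpa using h.2
    _ = ∫⁻ t in Set.Ici s, ENNReal.ofReal (κ ^ (-((n + 1 : ℝ) / n))) * cornerIntegral n *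
        ENNReal.ofReal (t ^ (-((n + 1 : ℝ) / n))) := setLIntegral_congr_fun measurableSet_Ici h0
    _ = ENNReal.ofReal (κ ^ (-((n + 1 : ℝ) / n))) * cornerIntegral n *
        ENNReal.ofReal (n * s ^ (-(1 / (n : ℝ)))) := by
        rw [lintegral_const_mul _ (by fun_prop), setLIntegral_congr Ioi_ae_eq_Ici.symm,
          ← ofReal_integral_eq_lintegral_ofReal (integrableOn_Ioi_rpow_of_lt hexp hs)
            ((ae_restrict_iff' measurableSet_Ioi).2 (Eventually.of_forall fun t ht =>
              Real.rpow_nonneg (hs.trans ht).le _)), integral_Ioi_rpow_of_lt hexp hs]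
        congr 2
        have e : -((n + 1 : ℝ) / n) + 1 = -(1 / (n : ℝ)) := by field_simp; ring
        rw [e]
        field_simp
    _ = _ := by
        rw [mul_assoc, mul_comm (cornerIntegral n), ← mul_assoc,
          ← ENNReal.ofReal_mul (by positivity)]
        congr 2
        ring

/-- In two variables the polynomial is the sum of the coordinates and the integral is a product of
exponential integrals. In the induction step the orthant is covered by the unit cube and the tails
y_i ≥ 1, which the previous dimension controls. -/
theorem cornerIntegral_lt_top {n : ℕ} (hn : 1 ≤ n) : cornerIntegral n < ⊤ := by
  induction n, hn using Nat.le_induction with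
  | base =>
    have hint : Integrable (fun y : Fin 2 → ℝ =>
        ∏ i, (Set.Ici (0 : ℝ)).indicator (fun t => Real.exp (-t)) (y i)) :=
      Integrable.fintype_prod (f := fun _ : Fin 2 =>
        (Set.Ici (0 : ℝ)).indicator fun t => Real.exp (-t)) fun i => by
          rw [integrable_indicator_iff measurableSet_Ici, integrableOn_Ici_iff_integrableOn_Ioi]
          exact integrableOn_exp_neg_Ioi 0
    refine lt_of_le_of_lt ?_ hint.lintegral_lt_top
    rw [cornerIntegral, ← lintegral_indicator measurableSet_Ici]
    refine lintegral_mono fun y => ?_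
    by_cases hy : y ∈ Set.Ici (0 : Fin 2 → ℝ)
    · rw [Set.indicator_of_mem hy, Fin.prod_univ_two,
        Set.indicator_of_mem (show y 0 ∈ Set.Ici (0 : ℝ) from hy 0),
        Set.indicator_of_mem (show y 1 ∈ Set.Ici (0 : ℝ) from hy 1), ← Real.exp_add]
      refine ENNReal.ofReal_le_ofReal (Real.exp_le_exp.2 (le_of_eq ?_))
      simp [cornerSum, Fin.sum_univ_two, Fin.prod_univ_two]
    · rw [Set.indicator_of_notMem hy]; exact zero_le
  | succ n hn ih =>
    have hsub : Set.Ici (0 : Fin (n + 2) → ℝ) ⊆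
        Set.Icc 0 1 ∪ ⋃ i, {y | 0 ≤ y ∧ 1 ≤ y i} := by
      intro y hy
      by_cases h : y ≤ 1
      · exact Or.inl ⟨hy, h⟩
      · right
        simp only [Pi.le_def, not_forall, not_le, Pi.one_apply] at h
        obtain ⟨i, hi⟩ := h
        exact Set.mem_iUnion.2 ⟨i, hy, hi.le⟩
    have h1 : ∫⁻ y : Fin (n + 2) → ℝ in Set.Icc 0 1,
        ENNReal.ofReal (Real.exp (-cornerSum y)) < ⊤ := by
      refine lt_of_le_of_lt (setLIntegral_mono' (g := fun _ => 1) measurableSet_Icc fun y hy => ?_) ?_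
      · exact ENNReal.ofReal_le_one.2
          (Real.exp_le_one_iff.2 (neg_nonpos.2 (cornerSum_nonneg hy.1)))
      · rw [setLIntegral_one]
        exact isCompact_Icc.measure_lt_top
    have h2 : ∀ i, ∫⁻ y : Fin (n + 2) → ℝ in {y | 0 ≤ y ∧ 1 ≤ y i},
        ENNReal.ofReal (Real.exp (-cornerSum y)) < ⊤ := fun i => by
      have := setLIntegral_tail_cornerSum_le hn one_pos one_pos i
      simp only [one_mul] at this
      exact lt_of_le_of_lt this (ENNReal.mul_lt_top ENNReal.ofReal_lt_top ih)
    calc cornerIntegral (n + 1) ≤ ∫⁻ y in Set.Icc 0 1 ∪ ⋃ i, {y : Fin (n + 2) → ℝ | 0 ≤ y ∧ 1 ≤ y i},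
          ENNReal.ofReal (Real.exp (-cornerSum y)) := lintegral_mono_set hsub
      _ ≤ (∫⁻ y in Set.Icc 0 1, ENNReal.ofReal (Real.exp (-cornerSum y))) +
          ∫⁻ y in ⋃ i, {y : Fin (n + 2) → ℝ | 0 ≤ y ∧ 1 ≤ y i},
          ENNReal.ofReal (Real.exp (-cornerSum y)) := lintegral_union_le _ _ _
      _ ≤ (∫⁻ y in Set.Icc 0 1, ENNReal.ofReal (Real.exp (-cornerSum y))) +
          ∑' i, ∫⁻ y in {y : Fin (n + 2) → ℝ | 0 ≤ y ∧ 1 ≤ y i},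
          ENNReal.ofReal (Real.exp (-cornerSum y)) := by
          gcongr
          exact lintegral_iUnion_le _ _
      _ < ⊤ := by
          rw [tsum_fintype]
          exact ENNReal.add_lt_top.2 ⟨h1, ENNReal.sum_lt_top.2 fun i _ => h2 i⟩

/-- Real form of the exponential integral over bounded subsets of the orthant. -/
theorem exists_setIntegral_exp_cornerSum_le {n : ℕ} (hn : 1 ≤ n) :
    ∃ K : ℝ, 0 < K ∧ ∀ (D : Set (Fin (n + 1) → ℝ)) (κ : ℝ), D ⊆ Set.Ici 0 →
      MeasurableSet D → 0 < κ →
      IntegrableOn (fun y => Real.exp (-(κ * cornerSum y))) D ∧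
      ∫ y in D, Real.exp (-(κ * cornerSum y)) ≤ K * κ ^ (-((n + 1 : ℝ) / n)) := by
  refine ⟨(cornerIntegral n).toReal + 1, by positivity, fun D κ hD hDm hκ => ?_⟩
  have hc := continuous_cornerSum (n := n + 1)
  have hle : ∫⁻ y in D, ENNReal.ofReal (Real.exp (-(κ * cornerSum y))) ≤
      ENNReal.ofReal (κ ^ (-((n + 1 : ℝ) / n))) * cornerIntegral n :=
    (lintegral_mono_set hD).trans (lintegral_exp_neg_mul_cornerSum hn hκ).le
  have htop : ENNReal.ofReal (κ ^ (-((n + 1 : ℝ) / n))) * cornerIntegral n ≠ ⊤ :=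
    ENNReal.mul_ne_top ENNReal.ofReal_ne_top (cornerIntegral_lt_top hn).ne
  have hmeas : Measurable fun y : Fin (n + 1) → ℝ => Real.exp (-(κ * cornerSum y)) := by fun_prop
  refine ⟨⟨hmeas.aestronglyMeasurable, ?_⟩, ?_⟩
  · rw [hasFiniteIntegral_iff_ofReal (Eventually.of_forall fun y => (Real.exp_pos _).le)]
    exact hle.trans_lt htop.lt_top
  · rw [integral_eq_lintegral_of_nonneg_ae (Eventually.of_forall fun y => (Real.exp_pos _).le)
      hmeas.aestronglyMeasurable]
    refine (ENNReal.toReal_mono htop hle).trans ?_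
    rw [ENNReal.toReal_mul, ENNReal.toReal_ofReal (by positivity), mul_comm]
    gcongr
    linarith

theorem exists_setIntegral_exp_cornerSum_tail_le {n : ℕ} (hn : 1 ≤ n) :
    ∃ K : ℝ, 0 < K ∧ ∀ (i : Fin (n + 2)) (D : Set (Fin (n + 2) → ℝ)) (κ s : ℝ),
      D ⊆ {y | 0 ≤ y ∧ s ≤ y i} → MeasurableSet D → 0 < κ → 0 < s →
      ∫ y in D, Real.exp (-(κ * cornerSum y)) ≤
        K * κ ^ (-((n + 1 : ℝ) / n)) * s ^ (-(1 / (n : ℝ))) := by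
  refine ⟨n * (cornerIntegral n).toReal + 1, by positivity, fun i D κ s hD hDm hκ hs => ?_⟩
  have hc := continuous_cornerSum (n := n + 2)
  have hle : ∫⁻ y in D, ENNReal.ofReal (Real.exp (-(κ * cornerSum y))) ≤
      ENNReal.ofReal (n * κ ^ (-((n + 1 : ℝ) / n)) * s ^ (-(1 / (n : ℝ)))) * cornerIntegral n :=
    (lintegral_mono_set hD).trans (setLIntegral_tail_cornerSum_le hn hκ hs i)
  have htop : ENNReal.ofReal (n * κ ^ (-((n + 1 : ℝ) / n)) * s ^ (-(1 / (n : ℝ)))) *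
      cornerIntegral n ≠ ⊤ :=
    ENNReal.mul_ne_top ENNReal.ofReal_ne_top (cornerIntegral_lt_top hn).ne
  have hmeas : Measurable fun y : Fin (n + 2) → ℝ => Real.exp (-(κ * cornerSum y)) := by fun_prop
  rw [integral_eq_lintegral_of_nonneg_ae (Eventually.of_forall fun y => (Real.exp_pos _).le)
    hmeas.aestronglyMeasurable]
  refine (ENNReal.toReal_mono htop hle).trans ?_
  rw [ENNReal.toReal_mul, ENNReal.toReal_ofReal (by positivity)]
  have : 0 ≤ κ ^ (-((n + 1 : ℝ) / n)) * s ^ (-(1 / (n : ℝ))) := by positivity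
  nlinarith

/-- The integral over a cube of a function of all coordinates but one. -/
theorem exists_setIntegral_exp_cornerSum_succAbove_le {n : ℕ} (hn : 1 ≤ n) :
    ∃ K : ℝ, 0 < K ∧ ∀ (i : Fin (n + 2)) (D : Set (Fin (n + 2) → ℝ)) (κ b : ℝ),
      D ⊆ Set.Icc 0 (fun _ => b) → MeasurableSet D → 0 < κ → 0 < b →
      ∫ y in D, Real.exp (-(κ * cornerSum fun j => y (i.succAbove j))) ≤
        K * b * κ ^ (-((n + 1 : ℝ) / n)) := by
  refine ⟨(cornerIntegral n).toReal + 1, by positivity, fun i D κ b hD hDm hκ hb => ?_⟩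
  have hc := continuous_cornerSum (n := n + 1)
  have hmeas : Measurable fun y : Fin (n + 2) → ℝ =>
    Real.exp (-(κ * cornerSum fun j => y (i.succAbove j))) := by fun_prop
  have hmeas' : Measurable fun y : Fin (n + 1) → ℝ => Real.exp (-(κ * cornerSum y)) := by fun_prop
  have hle : ∫⁻ y in D, ENNReal.ofReal (Real.exp (-(κ * cornerSum fun j => y (i.succAbove j)))) ≤
      ENNReal.ofReal (b * κ ^ (-((n + 1 : ℝ) / n))) * cornerIntegral n := by
    refine (lintegral_mono_set hD).trans ?_
    rw [← lintegral_indicator measurableSet_Icc, lintegral_insertNth i _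
      (hmeas.ennreal_ofReal.indicator measurableSet_Icc)]
    calc _ ≤ ∫⁻ t : ℝ, (Set.Icc 0 b).indicator (fun _ => ENNReal.ofReal (κ ^ (-((n + 1 : ℝ) / n))) *
          cornerIntegral n) t := by
          refine lintegral_mono fun t => ?_
          by_cases ht : t ∈ Set.Icc 0 b
          · rw [Set.indicator_of_mem ht, ← lintegral_exp_neg_mul_cornerSum hn hκ,
              ← lintegral_indicator measurableSet_Ici]
            refine lintegral_mono fun z => ?_
            by_cases hz : i.insertNth t z ∈ Set.Icc (0 : Fin (n + 2) → ℝ) fun _ => b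
            · have hz0 : z ∈ Set.Ici (0 : Fin (n + 1) → ℝ) := fun j => by
                simpa using hz.1 (i.succAbove j)
              rw [Set.indicator_of_mem hz, Set.indicator_of_mem hz0]
              simp
            · rw [Set.indicator_of_notMem hz]; exact zero_le
          · rw [Set.indicator_of_notMem ht, nonpos_iff_eq_zero]
            refine (lintegral_congr fun z => ?_).trans lintegral_zero
            refine Set.indicator_of_notMem (fun h => ht ?_) _
            exact ⟨by simpa using h.1 i, by simpa using h.2 i⟩
      _ = _ := by
          rw [lintegral_indicator measurableSet_Icc, setLIntegral_const, Real.volume_Icc, sub_zero,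
            ENNReal.ofReal_mul hb.le]
          ring
  have htop : ENNReal.ofReal (b * κ ^ (-((n + 1 : ℝ) / n))) * cornerIntegral n ≠ ⊤ :=
    ENNReal.mul_ne_top ENNReal.ofReal_ne_top (cornerIntegral_lt_top hn).ne
  rw [integral_eq_lintegral_of_nonneg_ae (Eventually.of_forall fun y => (Real.exp_pos _).le)
    hmeas.aestronglyMeasurable]
  refine (ENNReal.toReal_mono htop hle).trans ?_
  rw [ENNReal.toReal_mul, ENNReal.toReal_ofReal (by positivity)]
  have : 0 ≤ b * κ ^ (-((n + 1 : ℝ) / n)) := by positivity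
  nlinarith

end CornerSum

/-! ### Hulls of points on the boundary of an orthant -/

section Corner

/-- The cube `[0, s]ⁿ`. -/
def cornerBox (n : ℕ) (s : ℝ) : Set (Fin n → ℝ) := Set.Icc 0 fun _ => s

theorem measurableSet_cornerBox (n : ℕ) (s : ℝ) : MeasurableSet (cornerBox n s) :=
  measurableSet_Icc

/-- The embedding of the coordinate hyperplane `x i = 0`. -/
def facetEmbedding {n : ℕ} (i : Fin (n + 1)) (z : Fin n → ℝ) : Fin (n + 1) → ℝ :=
  i.insertNth (α := fun _ => ℝ) 0 z

/-- Lebesgue measure on the coordinate hyperplane `x i = 0`. -/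
noncomputable def facetMeasure {n : ℕ} (i : Fin (n + 1)) : Measure (Fin (n + 1) → ℝ) :=
  Measure.map (facetEmbedding i) (volume : Measure (Fin n → ℝ))

/-- A probability measure on the orthant which, in the cube of side length `s` at the origin, is
distributed on the coordinate hyperplanes with constant densities `α`. -/
structure IsCornerMeasure {n : ℕ} (α : Fin (n + 1) → ℝ) (s : ℝ)
    (μ : Measure (Fin (n + 1) → ℝ)) : Prop where
  prob : IsProbabilityMeasure μ
  pos : ∀ i, 0 < α i
  side_pos : 0 < s
  ae_nonneg : ∀ᵐ x ∂μ, 0 ≤ x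
  restrict_eq : μ.restrict (cornerBox (n + 1) s) =
    ∑ i, ENNReal.ofReal (α i) • (facetMeasure i).restrict (cornerBox (n + 1) s)

theorem cornerBox_mono {n : ℕ} {s t : ℝ} (h : s ≤ t) : cornerBox n s ⊆ cornerBox n t :=
  Set.Icc_subset_Icc_right fun _ => h

theorem Measure.restrict_finsetSum {X ι : Type*} [MeasurableSpace X] [Fintype ι]
    (μ : ι → Measure X) (S : Set X) : (∑ i, μ i).restrict S = ∑ i, (μ i).restrict S := by
  simp only [← Measure.restrictₗ_apply, map_sum]

theorem IsCornerMeasure.mono {n : ℕ} {α : Fin (n + 1) → ℝ} {s t : ℝ}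
    {μ : Measure (Fin (n + 1) → ℝ)} (h : IsCornerMeasure α s μ) (ht : 0 < t) (hts : t ≤ s) :
    IsCornerMeasure α t μ := by
  refine ⟨h.prob, h.pos, ht, h.ae_nonneg, ?_⟩
  have := congrArg (fun ν => Measure.restrict ν (cornerBox (n + 1) t)) h.restrict_eq
  rw [Measure.restrict_restrict_of_subset (cornerBox_mono hts), Measure.restrict_finsetSum] at this
  rw [this]
  refine Finset.sum_congr rfl fun i _ => ?_
  rw [Measure.restrict_smul, Measure.restrict_restrict_of_subset (cornerBox_mono hts)]

theorem facetEmbedding_self {n : ℕ} (i : Fin (n + 1)) (z : Fin n → ℝ) :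
    facetEmbedding i z i = 0 := by
  simp [facetEmbedding]

theorem facetEmbedding_succAbove {n : ℕ} (i : Fin (n + 1)) (z : Fin n → ℝ) (j : Fin n) :
    facetEmbedding i z (i.succAbove j) = z j := by
  simp [facetEmbedding]

theorem measurable_facetEmbedding {n : ℕ} (i : Fin (n + 1)) :
    Measurable (facetEmbedding i) := by
  refine measurable_pi_lambda _ fun j => ?_
  rcases Fin.eq_self_or_eq_succAbove i j with rfl | ⟨l, rfl⟩
  · simp only [facetEmbedding_self, measurable_const]
  · simpa only [facetEmbedding_succAbove] using measurable_pi_apply l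

theorem facetMeasure_pi {n : ℕ} (i : Fin (n + 1)) (I : Fin (n + 1) → Set ℝ)
    (hI : ∀ j, MeasurableSet (I j)) (h0 : (0 : ℝ) ∈ I i) :
    facetMeasure i (Set.univ.pi I) = ∏ j, volume (I (i.succAbove j)) := by
  rw [facetMeasure, Measure.map_apply (measurable_facetEmbedding i) (MeasurableSet.univ_pi hI),
    ← volume_pi_pi]
  congr 1
  ext z
  simp only [Set.mem_preimage, Set.mem_pi, Set.mem_univ, true_imp_iff]
  rw [Fin.forall_iff_succAbove i]
  simp [h0, facetEmbedding_self, facetEmbedding_succAbove]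

/-- The intervals defining a region on the hyperplane `x m = 0`, with coordinates close to `s` in
the directions of `T` and bounded by those of `w` in the other directions. -/
noncomputable def cornerInterval {n : ℕ} (w : Fin n → ℝ) (s : ℝ) (T : Finset (Fin n))
    (m j : Fin n) : Set ℝ :=
  if j = m then {0} else if j ∈ T then Set.Icc (3 * s / 4) s else Set.Icc 0 (w j)

noncomputable def cornerRegion {n : ℕ} (w : Fin n → ℝ) (s : ℝ) (p : Finset (Fin n) × Fin n) :
    Set (Fin n → ℝ) :=
  Set.univ.pi (cornerInterval w s p.1 p.2)

theorem measurableSet_cornerInterval {n : ℕ} (w : Fin n → ℝ) (s : ℝ) (T : Finset (Fin n))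
    (m j : Fin n) : MeasurableSet (cornerInterval w s T m j) := by
  unfold cornerInterval
  split_ifs <;> measurability

theorem measurableSet_cornerRegion {n : ℕ} (w : Fin n → ℝ) (s : ℝ)
    (p : Finset (Fin n) × Fin n) : MeasurableSet (cornerRegion w s p) :=
  MeasurableSet.univ_pi fun _ => measurableSet_cornerInterval _ _ _ _ _

open Classical in
-- In a pair (T, m), `T` plays the role of the set of negative coefficients of a separating
-- functional, and x_m = 0 is the hyperplane carrying the region. Outside `T` the coordinate `m` has
-- to be one where `w` is least, which makes the region as large as possible; if `T` is everything,
-- `m` is free.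
noncomputable def cornerIndex {n : ℕ} (w : Fin n → ℝ) : Finset (Finset (Fin n) × Fin n) :=
  Finset.univ.filter fun p => p.1 = Finset.univ ∨ (p.2 ∉ p.1 ∧ ∀ j ∉ p.1, w p.2 ≤ w j)

theorem cornerRegion_subset {n : ℕ} {w : Fin n → ℝ} {s : ℝ} (hs : 0 < s)
    (hw : ∀ j, w j ≤ s / 2) (p : Finset (Fin n) × Fin n) : cornerRegion w s p ⊆ cornerBox n s := by
  intro x hx
  have h : ∀ j, x j ∈ Set.Icc 0 s := by
    intro j
    have := hx j trivial
    unfold cornerInterval at this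
    split_ifs at this with h1 h2
    · rw [Set.mem_singleton_iff.1 this]; exact ⟨le_rfl, hs.le⟩
    · exact ⟨by linarith [this.1], this.2⟩
    · exact ⟨this.1, by linarith [this.2, hw j]⟩
  exact ⟨fun j => (h j).1, fun j => (h j).2⟩

/-- Strict separation of a point from the hull of finitely many points, in coordinates. -/
theorem exists_coeff_lt_of_notMem_convexHull {n : ℕ} {X : Set (Fin n → ℝ)} (hX : X.Finite)
    {w : Fin n → ℝ} (hw : w ∉ convexHull ℝ X) :
    ∃ f : Fin n → ℝ, ∀ x ∈ X, ∑ j, f j * w j < ∑ j, f j * x j := by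
  obtain ⟨g, u, h1, h2⟩ := geometric_hahn_banach_point_closed (convex_convexHull ℝ X)
    (hX.isCompact_convexHull ℝ).isClosed hw
  have hg : ∀ x : Fin n → ℝ, g x = ∑ j, g (Pi.single j 1) * x j := by
    intro x
    conv_lhs => rw [pi_eq_sum_univ' x]
    rw [map_sum]
    refine Finset.sum_congr rfl fun j _ => ?_
    rw [map_smul, smul_eq_mul, mul_comm]
  refine ⟨fun j => g (Pi.single j 1), fun x hx => ?_⟩
  rw [← hg, ← hg]
  exact h1.trans (h2 x (subset_convexHull ℝ X hx))

/-- Let `f` separate `w` strictly from the points in the cube and let `T` be its set of negative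
coefficients. A point of the region for `T` exceeds `w` in the coordinates of `T` and is below `w`
in the others, so `f` is not larger there than at `w`; hence no point of `X` lies in it. The region
depends only on the lower bound `w₀`, so finitely many regions serve all `w` above `w₀` at once. -/
theorem exists_cornerRegion_disjoint {n : ℕ} (hn : 3 ≤ n) {X : Set (Fin n → ℝ)} (hX : X.Finite)
    {s : ℝ} (hs : 0 < s) {w₀ w : Fin n → ℝ} (h0 : 0 ≤ w₀) (hw₀ : w₀ ≤ w) (hw : ∀ j, w j ≤ s / 2)
    (hout : w ∉ convexHull ℝ (X ∩ cornerBox n s)) :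
    ∃ p ∈ cornerIndex w₀, ∀ x ∈ X, x ∉ cornerRegion w₀ s p := by
  classical
  obtain ⟨f, hf⟩ := exists_coeff_lt_of_notMem_convexHull (hX.subset Set.inter_subset_left) hout
  have hne : Nonempty (Fin n) := ⟨⟨0, by omega⟩⟩
  have hsub := cornerRegion_subset hs fun j => (hw₀ j).trans (hw j)
  set T : Finset (Fin n) := Finset.univ.filter fun j => f j < 0 with hT
  by_cases hTu : T = Finset.univ
  · have hneg : ∀ j, f j < 0 := fun j => by
      have : j ∈ T := hTu ▸ Finset.mem_univ j
      simpa [hT] using this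
    -- With all coefficients negative, the vanishing coordinate works in the wrong direction. Taking
    -- `m` with |f m| least, this costs at most |f m| s/2, while each of the n-1 ≥ 2 other
    -- coordinates gains at least |f m| s/4. Here n ≥ 3 is needed.
    obtain ⟨m, -, hm⟩ := Finset.exists_max_image Finset.univ f Finset.univ_nonempty
    refine ⟨(T, m), by simp [cornerIndex, hTu], fun x hx hxr => ?_⟩
    refine absurd (hf x ⟨hx, hsub _ hxr⟩) (not_lt.2 ?_)
    rw [← Finset.add_sum_erase _ _ (Finset.mem_univ m),
      ← Finset.add_sum_erase (a := m) _ (fun j => f j * w j) (Finset.mem_univ m)]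
    have hxm : x m = 0 := by simpa [cornerInterval] using hxr m trivial
    have hx' : ∀ j ∈ Finset.univ.erase m, f j * x j ≤ f j * w j + f m * (s / 4) := by
      intro j hj
      have hjm := (Finset.mem_erase.1 hj).1
      have := hxr j trivial
      simp only [cornerInterval, hjm, if_false, hTu, Finset.mem_univ, if_true] at this
      have h1 : f j * (x j - w j) ≤ f j * (s / 4) :=
        mul_le_mul_of_nonpos_left (by linarith [this.1, hw j]) (hneg j).le
      have h2 : f j * (s / 4) ≤ f m * (s / 4) :=
        mul_le_mul_of_nonneg_right (hm j (Finset.mem_univ j)) (by positivity)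
      linarith
    have hsum := Finset.sum_le_sum hx'
    rw [Finset.sum_add_distrib, Finset.sum_const, Finset.card_erase_of_mem (Finset.mem_univ m),
      Finset.card_univ, Fintype.card_fin, nsmul_eq_mul] at hsum
    have hcast : (2 : ℝ) ≤ ((n - 1 : ℕ) : ℝ) := by
      exact_mod_cast (by omega : 2 ≤ n - 1)
    have h3 : ((n - 1 : ℕ) : ℝ) * (f m * (s / 4)) ≤ 2 * (f m * (s / 4)) :=
      mul_le_mul_of_nonpos_right hcast (mul_nonpos_of_nonpos_of_nonneg (hneg m).le (by positivity))
    have h4 : f m * (s / 2) ≤ f m * w m := mul_le_mul_of_nonpos_left (hw m) (hneg m).le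
    rw [hxm]
    linarith
  · have hTne : (Tᶜ).Nonempty := by
      rw [Finset.nonempty_iff_ne_empty]
      simpa using hTu
    obtain ⟨m, hm, hmin⟩ := Finset.exists_min_image Tᶜ w₀ hTne
    refine ⟨(T, m), ?_, fun x hx hxr => ?_⟩
    · simp only [cornerIndex, Finset.mem_filter, Finset.mem_univ, true_and]
      exact Or.inr ⟨Finset.mem_compl.1 hm, fun j hj => hmin j (Finset.mem_compl.2 hj)⟩
    refine absurd (hf x ⟨hx, hsub _ hxr⟩) (not_lt.2 (Finset.sum_le_sum fun j _ => ?_))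
    have := hxr j trivial
    unfold cornerInterval at this
    have hsign : j ∉ T → 0 ≤ f j := fun h => by simpa [hT] using h
    simp only at this
    split_ifs at this with h1 h2
    · rw [Set.mem_singleton_iff.1 this, mul_zero]
      exact mul_nonneg (hsign (h1 ▸ Finset.mem_compl.1 hm)) ((h0 j).trans (hw₀ j))
    · have hj : f j < 0 := by simpa [hT] using h2
      exact mul_le_mul_of_nonpos_left (by linarith [this.1, hw j]) hj.le
    · exact mul_le_mul_of_nonneg_left (this.2.trans (hw₀ j)) (hsign h2)

/-- Reindex by the transposition of `l` and `m`: the product omitting `l` is compared factor by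
factor with the one omitting `m`, and its factor `w m` is paired with `u l`. -/
theorem prod_update_le_of_exchange {n : ℕ} {w u : Fin n → ℝ} (h0 : 0 ≤ w) (hwu : w ≤ u)
    {m : Fin n} (hm : ∀ l, w m ≤ u l) (l : Fin n) :
    ∏ j, Function.update w l 1 j ≤ ∏ j, Function.update u m 1 j := by
  rw [← Equiv.prod_comp (Equiv.swap l m)]
  refine Finset.prod_le_prod (fun j _ => ?_) fun j _ => ?_
  · by_cases h : Equiv.swap l m j = l
    · rw [h]; simp
    · rw [Function.update_of_ne h]; exact h0 _
  · by_cases hjm : j = m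
    · subst hjm; simp
    · rw [Function.update_of_ne hjm]
      by_cases hjl : j = l
      · subst hjl
        rw [Equiv.swap_apply_left, Function.update_of_ne (Ne.symm hjm)]
        exact hm j
      · rw [Equiv.swap_apply_of_ne_of_ne hjl hjm, Function.update_of_ne hjl]
        exact hwu j

/-- The product on the right is the volume of the region inside its hyperplane. Replacing `w` by s/4
on `T` and doubling dominates `w`, and each entry also dominates `w m`; by exchange, each of the n+1
products in `cornerSum` is at most 2^n times that volume. -/
theorem cornerSum_le_prod {n : ℕ} {w : Fin (n + 1) → ℝ} {s : ℝ} (h0 : 0 ≤ w)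
    (hw : ∀ j, w j ≤ s / 2) {p : Finset (Fin (n + 1)) × Fin (n + 1)} (hp : p ∈ cornerIndex w) :
    cornerSum w ≤ (n + 1) * 2 ^ n *
      ∏ j, if p.2.succAbove j ∈ p.1 then s / 4 else w (p.2.succAbove j) := by
  classical
  obtain ⟨T, m⟩ := p
  simp only [cornerIndex, Finset.mem_filter, Finset.mem_univ, true_and] at hp
  set v : Fin (n + 1) → ℝ := fun j => if j ∈ T then s / 4 else w j with hv
  have h1 : w ≤ (2 : ℝ) • v := by
    intro j
    simp only [hv, Pi.smul_apply, smul_eq_mul]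
    split_ifs
    · linarith [hw j]
    · have : 0 ≤ w j := h0 j
      linarith
  have h2 : ∀ l, w m ≤ ((2 : ℝ) • v) l := by
    intro l
    simp only [hv, Pi.smul_apply, smul_eq_mul]
    split_ifs with hl
    · linarith [hw m]
    · rcases hp with hp | hp
      · exact absurd (hp ▸ Finset.mem_univ l) hl
      · have := hp.2 l hl
        have h3 : 0 ≤ w l := h0 l
        linarith
  have h3 := prod_update_le_of_exchange h0 h1 h2
  rw [cornerSum]
  refine (Finset.sum_le_sum fun l _ => h3 l).trans ?_
  rw [Finset.sum_const, Finset.card_univ, Fintype.card_fin, nsmul_eq_mul, prod_update_one]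
  simp only [Pi.smul_apply, smul_eq_mul, Finset.prod_mul_distrib, Finset.prod_const,
    Finset.card_univ, Fintype.card_fin, hv]
  push_cast
  rw [mul_assoc]

theorem IsCornerMeasure.le_real {n : ℕ} {α : Fin (n + 1) → ℝ} {s : ℝ}
    {μ : Measure (Fin (n + 1) → ℝ)} (h : IsCornerMeasure α s μ) {R : Set (Fin (n + 1) → ℝ)}
    (hR : R ⊆ cornerBox (n + 1) s) (hRm : MeasurableSet R) (i : Fin (n + 1)) :
    ENNReal.ofReal (α i) * facetMeasure i R ≤ μ R := by
  have h1 := congrArg (fun ν : Measure (Fin (n + 1) → ℝ) => ν R) h.restrict_eq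
  simp only [Measure.restrict_apply hRm, Set.inter_eq_left.2 hR, Measure.finsetSum_apply,
    Measure.smul_apply, smul_eq_mul] at h1
  rw [h1]
  exact Finset.single_le_sum (f := fun i => ENNReal.ofReal (α i) * facetMeasure i R)
    (fun _ _ => zero_le) (Finset.mem_univ i)

theorem IsCornerMeasure.cornerSum_le_real {n : ℕ} {α : Fin (n + 1) → ℝ} {s a : ℝ}
    {μ : Measure (Fin (n + 1) → ℝ)} (h : IsCornerMeasure α s μ) (ha : ∀ i, a ≤ α i) (ha0 : 0 < a)
    {w : Fin (n + 1) → ℝ} (h0 : 0 ≤ w) (hw : ∀ j, w j ≤ s / 2)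
    {p : Finset (Fin (n + 1)) × Fin (n + 1)} (hp : p ∈ cornerIndex w) :
    a / ((n + 1) * 2 ^ n) * cornerSum w ≤ μ.real (cornerRegion w s p) := by
  have := h.prob
  have hs := h.side_pos
  have h1 := cornerSum_le_prod h0 hw hp
  have h2 := h.le_real (cornerRegion_subset hs hw p) (measurableSet_cornerRegion w s p) p.2
  rw [cornerRegion, facetMeasure_pi _ _ (measurableSet_cornerInterval w s p.1 p.2)
    (by simp [cornerInterval]), ← cornerRegion] at h2
  have h3 : ∀ j, volume (cornerInterval w s p.1 p.2 (p.2.succAbove j)) =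
      ENNReal.ofReal (if p.2.succAbove j ∈ p.1 then s / 4 else w (p.2.succAbove j)) := by
    intro j
    simp only [cornerInterval, Fin.succAbove_ne, if_false]
    split_ifs
    · rw [Real.volume_Icc]; congr 1; ring
    · rw [Real.volume_Icc, sub_zero]
  have hnn : ∀ j, 0 ≤ if p.2.succAbove j ∈ p.1 then s / 4 else w (p.2.succAbove j) := by
    intro j
    split_ifs
    · positivity
    · exact h0 _
  simp only [h3] at h2
  rw [← ENNReal.ofReal_prod_of_nonneg fun j _ => hnn j, ← ENNReal.ofReal_mul (h.pos _).le,
    ENNReal.ofReal_le_iff_le_toReal (measure_ne_top _ _)] at h2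
  have hprod : 0 ≤ ∏ j, if p.2.succAbove j ∈ p.1 then s / 4 else w (p.2.succAbove j) :=
    Finset.prod_nonneg fun j _ => hnn j
  refine le_trans ?_ (h2.trans le_rfl)
  rw [div_mul_eq_mul_div, div_le_iff₀ (by positivity)]
  calc a * cornerSum w ≤ a * ((n + 1) * 2 ^ n * _) := by gcongr
    _ = a * (∏ j, if p.2.succAbove j ∈ p.1 then s / 4 else w (p.2.succAbove j)) *
        ((n + 1) * 2 ^ n) := by ring
    _ ≤ _ := by
      gcongr
      exact ha _

/-- The probability that some point between `w` and the far corner is missed by the local hull. -/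
theorem IsCornerMeasure.real_exists_notMem_le {n : ℕ} (hn : 2 ≤ n) {α : Fin (n + 1) → ℝ} {s a : ℝ}
    {μ : Measure (Fin (n + 1) → ℝ)} (h : IsCornerMeasure α s μ) (ha : ∀ i, a ≤ α i) (ha0 : 0 < a)
    {w₀ : Fin (n + 1) → ℝ} (h0 : 0 ≤ w₀) (hw : ∀ j, w₀ j ≤ s / 2) (N : ℕ) :
    (Measure.pi fun _ : Fin N => μ).real {x | ∃ w, w₀ ≤ w ∧ (∀ j, w j ≤ s / 2) ∧
      w ∉ convexHull ℝ (Set.range x ∩ cornerBox (n + 1) s)} ≤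
      2 ^ (n + 1) * (n + 1) * Real.exp (-(a / ((n + 1) * 2 ^ n) * N * cornerSum w₀)) := by
  have := h.prob
  refine (pi_real_le_sum_of_regions (cornerIndex w₀) μ N (cornerRegion w₀ s)
    (fun p _ => measurableSet_cornerRegion _ _ _) _ ?_).trans ?_
  · rintro x ⟨w, h1, h2, h3⟩
    obtain ⟨p, hp, hx⟩ := exists_cornerRegion_disjoint (by omega) (Set.finite_range x)
      h.side_pos h0 h1 h2 h3
    exact ⟨p, hp, fun i => hx _ ⟨i, rfl⟩⟩
  · have hterm : ∀ p ∈ cornerIndex w₀, (1 - μ.real (cornerRegion w₀ s p)) ^ N ≤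
        Real.exp (-(a / ((n + 1) * 2 ^ n) * N * cornerSum w₀)) := by
      intro p hp
      have h1 := h.cornerSum_le_real ha ha0 h0 hw hp
      have h2 : μ.real (cornerRegion w₀ s p) ≤ 1 := measureReal_le_one
      calc (1 - μ.real (cornerRegion w₀ s p)) ^ N
          ≤ (Real.exp (-μ.real (cornerRegion w₀ s p))) ^ N :=
            pow_le_pow_left₀ (by linarith) (Real.one_sub_le_exp_neg _) N
        _ = Real.exp (-(N * μ.real (cornerRegion w₀ s p))) := by
            rw [← Real.exp_nat_mul]; congr 1; ring
        _ ≤ _ := by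
            refine Real.exp_le_exp.2 (neg_le_neg ?_)
            calc _ = N * (a / ((n + 1) * 2 ^ n) * cornerSum w₀) := by ring
              _ ≤ _ := by gcongr
    refine (Finset.sum_le_sum hterm).trans ?_
    rw [Finset.sum_const, nsmul_eq_mul]
    gcongr
    have : (cornerIndex w₀).card ≤ 2 ^ (n + 1) * (n + 1) := by
      refine (Finset.card_le_univ _).trans ?_
      simp
    exact_mod_cast this

theorem IsCornerMeasure.localMissProb_le {n : ℕ} (hn : 2 ≤ n) {α : Fin (n + 1) → ℝ} {s a : ℝ}
    {μ : Measure (Fin (n + 1) → ℝ)} (h : IsCornerMeasure α s μ) (ha : ∀ i, a ≤ α i) (ha0 : 0 < a)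
    {y : Fin (n + 1) → ℝ} (hy : y ∈ cornerBox (n + 1) (s / 2)) (N : ℕ) :
    localMissProb μ (cornerBox (n + 1) s) N y ≤
      2 ^ (n + 1) * (n + 1) * Real.exp (-(a / ((n + 1) * 2 ^ n) * N * cornerSum y)) := by
  have := h.prob
  refine le_trans (measureReal_mono ?_) (h.real_exists_notMem_le hn ha ha0 hy.1 hy.2 N)
  exact fun x hx => ⟨y, le_rfl, hy.2, hx⟩

/-- If `y` lies in the hull of nonnegative points but not in the hull of those in the cube, then
the latter misses a point that is far from the origin and not much smaller than `y`. -/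
theorem exists_notMem_of_mem_convexHull {n : ℕ} {X : Set (Fin n → ℝ)} (hX : X.Finite)
    (hX0 : ∀ x ∈ X, 0 ≤ x) {s : ℝ} (hs : 0 < s) {y : Fin n → ℝ} (hy : y ∈ cornerBox n (s / 2))
    (h1 : y ∈ convexHull ℝ X) (h2 : y ∉ convexHull ℝ (X ∩ cornerBox n s)) :
    ∃ i, ∃ w, Function.update ((2 : ℝ)⁻¹ • y) i (s / 2) ≤ w ∧ (∀ j, w j ≤ s / 2) ∧
      w ∉ convexHull ℝ (X ∩ cornerBox n s) := by
  obtain ⟨f, hf⟩ := exists_coeff_lt_of_notMem_convexHull (hX.subset Set.inter_subset_left) h2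
  set g : (Fin n → ℝ) →ₗ[ℝ] ℝ := ∑ j, f j • LinearMap.proj j with hg
  have hgx : ∀ x, g x = ∑ j, f j * x j := fun x => by simp [hg]
  -- Since `y` is in the full hull, some point of `X` is on its side of the functional; that point
  -- must lie outside the cube.
  have hz : ∃ z ∈ X, g z ≤ g y := by
    by_contra! hcon
    have hsub : convexHull ℝ X ⊆ {x | g y < g x} :=
      convexHull_min hcon (convex_halfSpace_gt g.isLinear _)
    exact lt_irrefl (g y) (hsub h1)
  obtain ⟨z, hzX, hgz⟩ := hz
  have hz0 := hX0 z hzX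
  have hzs : ∃ j, s < z j := by
    by_contra! hcon
    have := hf z ⟨hzX, hz0, hcon⟩
    rw [← hgx, ← hgx] at this
    exact absurd this (not_lt.2 hgz)
  obtain ⟨l, hl⟩ := hzs
  -- Follow the segment from `y` to `z` until the sup norm equals s/2. The point `w` reached there
  -- has a coordinate s/2, and it is still separated from the hull because `g` does not increase
  -- from `y` to `z`.
  set φ : ℝ → ℝ := fun t => ‖(1 - t) • y + t • z‖ with hφ
  have hcont : ContinuousOn φ (Set.Icc 0 1) := by
    have : Continuous φ := by fun_prop
    exact this.continuousOn
  have hφ0 : φ 0 ≤ s / 2 := by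
    simp only [hφ, sub_zero, one_smul, zero_smul, add_zero]
    refine (pi_norm_le_iff_of_nonneg (by positivity)).2 fun j => ?_
    rw [Real.norm_of_nonneg (hy.1 j)]
    exact hy.2 j
  have hφ1 : s / 2 ≤ φ 1 := by
    simp only [hφ, sub_self, one_smul, zero_smul, zero_add]
    have := norm_le_pi_norm z l
    rw [Real.norm_of_nonneg (hz0 l)] at this
    linarith
  obtain ⟨t, ht, hφt⟩ := intermediate_value_Icc zero_le_one hcont ⟨hφ0, hφ1⟩
  set w := (1 - t) • y + t • z with hw
  have hw0 : ∀ j, 0 ≤ w j := fun j =>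
    add_nonneg (mul_nonneg (by linarith [ht.2]) (hy.1 j)) (mul_nonneg ht.1 (hz0 j))
  have hws : ∀ j, w j ≤ s / 2 := fun j => by
    have := norm_le_pi_norm w j
    rw [Real.norm_of_nonneg (hw0 j)] at this
    exact this.trans hφt.le
  -- A coordinate of `z` exceeds s while that of `w` is at most s/2, so less than half of the
  -- segment is used up and `w` is at least y/2.
  have htl : t ≤ 1 / 2 := by
    have h3 := hws l
    have h4 : w l = (1 - t) * y l + t * z l := rfl
    have h5 : 0 ≤ (1 - t) * y l := mul_nonneg (by linarith [ht.2]) (hy.1 l)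
    have h6 : t * s ≤ t * z l := mul_le_mul_of_nonneg_left hl.le ht.1
    nlinarith
  have hi : ∃ i, w i = s / 2 := by
    by_contra! hcon
    have : ‖w‖ < s / 2 := (pi_norm_lt_iff (by positivity)).2 fun j => by
      rw [Real.norm_of_nonneg (hw0 j)]
      exact lt_of_le_of_ne (hws j) (hcon j)
    exact absurd hφt this.ne
  obtain ⟨i, hi⟩ := hi
  refine ⟨i, w, fun j => ?_, hws, fun hmem => ?_⟩
  · by_cases hj : j = i
    · subst hj; simp [hi]
    · rw [Function.update_of_ne hj]
      have h4 : w j = (1 - t) * y j + t * z j := rfl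
      have h5 : 0 ≤ t * z j := mul_nonneg ht.1 (hz0 j)
      have h6 : 0 ≤ y j := hy.1 j
      rw [h4, Pi.smul_apply, smul_eq_mul]
      nlinarith
  · have hsub : convexHull ℝ (X ∩ cornerBox n s) ⊆ {x | g y < g x} := by
      refine convexHull_min (fun x hx => ?_) (convex_halfSpace_gt g.isLinear _)
      have := hf x hx
      rwa [← hgx, ← hgx] at this
    have h3 : g y < g w := hsub hmem
    have h4 : g w = (1 - t) * g y + t * g z := by
      rw [hw, map_add, map_smul, map_smul, smul_eq_mul, smul_eq_mul]
    have h5 : t * g z ≤ t * g y := mul_le_mul_of_nonneg_left hgz ht.1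
    linarith

theorem mul_cornerSum_le_update {n : ℕ} {y : Fin (n + 1) → ℝ} {s : ℝ} (hs : 0 < s)
    (i : Fin (n + 2)) (z : Fin (n + 2) → ℝ) (hz : 0 ≤ z)
    (hzy : ∀ j, y j = z (i.succAbove j)) :
    s / 2 * ((2 : ℝ)⁻¹ ^ n * cornerSum y) ≤
      cornerSum (Function.update ((2 : ℝ)⁻¹ • z) i (s / 2)) := by
  have h0 : 0 ≤ Function.update ((2 : ℝ)⁻¹ • z) i (s / 2) := by
    intro j
    by_cases hj : j = i
    · subst hj; simp only [Function.update_self, Pi.zero_apply]; positivity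
    · rw [Function.update_of_ne hj]
      exact mul_nonneg (by norm_num) (hz j)
  have h := mul_cornerSum_succAbove_le h0 i
  rw [Function.update_self] at h
  have e : (fun j => Function.update ((2 : ℝ)⁻¹ • z) i (s / 2) (i.succAbove j)) =
      (2 : ℝ)⁻¹ • y := by
    funext j
    rw [Function.update_of_ne (Fin.succAbove_ne i j)]
    simp [hzy]
  rwa [e, cornerSum_smul] at h

/-- Locality: within the cube of half side length, the hull of all points and the hull of the points
in the cube differ little. -/
theorem IsCornerMeasure.localMissProb_sub_missProb_le {n : ℕ} (hn : 1 ≤ n)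
    {α : Fin (n + 2) → ℝ} {s a : ℝ} {μ : Measure (Fin (n + 2) → ℝ)} (h : IsCornerMeasure α s μ)
    (ha : ∀ i, a ≤ α i) (ha0 : 0 < a) {y : Fin (n + 2) → ℝ}
    (hy : y ∈ cornerBox (n + 2) (s / 2)) (N : ℕ) :
    localMissProb μ (cornerBox (n + 2) s) N y - missProb μ N y ≤
      2 ^ (n + 2) * (n + 2) * ∑ i : Fin (n + 2),
        Real.exp (-(a / ((n + 2) * 2 ^ (2 * n + 2)) * N * s * cornerSum fun j => y (i.succAbove j))) := by
  have := h.prob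
  set π := Measure.pi fun _ : Fin N => μ
  set B := cornerBox (n + 2) s
  set W : Fin (n + 2) → Set (Fin N → Fin (n + 2) → ℝ) := fun i =>
    {x | ∃ w, Function.update ((2 : ℝ)⁻¹ • y) i (s / 2) ≤ w ∧ (∀ j, w j ≤ s / 2) ∧
      w ∉ convexHull ℝ (Set.range x ∩ B)} with hW
  have hnn : ∀ᵐ x ∂π, ∀ i, 0 ≤ x i := by
    rw [eventually_all]
    exact fun i => (Measure.quasiMeasurePreserving_eval (fun _ : Fin N => μ) i).ae h.ae_nonneg
  have h1 : localMissProb μ B N y - missProb μ N y ≤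
      π.real ({x | y ∉ convexHull ℝ (Set.range x ∩ B)} \ {x | y ∉ convexHull ℝ (Set.range x)}) := by
    rw [localMissProb, missProb, sub_le_iff_le_add]
    refine (measureReal_mono ?_).trans (measureReal_union_le _ _)
    rw [Set.sdiff_union_self]
    exact Set.subset_union_left
  have h2 : π.real ({x | y ∉ convexHull ℝ (Set.range x ∩ B)} \
      {x | y ∉ convexHull ℝ (Set.range x)}) ≤ π.real (⋃ i ∈ Finset.univ, W i) := by
    refine ENNReal.toReal_mono (measure_ne_top _ _) (measure_mono_ae ?_)
    filter_upwards [hnn] with x hx hmem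
    have hin : y ∈ convexHull ℝ (Set.range x) := by
      by_contra hcon
      exact hmem.2 hcon
    obtain ⟨i, w, hw⟩ := exists_notMem_of_mem_convexHull (Set.finite_range x)
      (by rintro _ ⟨i, rfl⟩; exact hx i) h.side_pos hy hin hmem.1
    exact Set.mem_biUnion (Finset.mem_coe.2 (Finset.mem_univ i)) ⟨w, hw⟩
  refine h1.trans (h2.trans ((measureReal_biUnion_finset_le _ _).trans ?_))
  rw [Finset.mul_sum]
  refine Finset.sum_le_sum fun i _ => ?_
  have hy0 : 0 ≤ y := hy.1
  have hs := h.side_pos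
  have hu0 : 0 ≤ Function.update ((2 : ℝ)⁻¹ • y) i (s / 2) := by
    intro j
    by_cases hj : j = i
    · subst hj; simp only [Function.update_self, Pi.zero_apply]; positivity
    · rw [Function.update_of_ne hj]; exact mul_nonneg (by norm_num) (hy0 j)
  have hus : ∀ j, Function.update ((2 : ℝ)⁻¹ • y) i (s / 2) j ≤ s / 2 := by
    intro j
    by_cases hj : j = i
    · subst hj; simp
    · rw [Function.update_of_ne hj, Pi.smul_apply, smul_eq_mul]
      have h3 : y j ≤ s / 2 := hy.2 j
      have h4 : 0 ≤ y j := hy0 j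
      linarith
  have hcs := mul_cornerSum_le_update hs (y := fun j => y (i.succAbove j)) i y hy0
    fun j => rfl
  refine (h.real_exists_notMem_le (by omega) ha ha0 hu0 hus N).trans ?_
  push_cast
  have e : ((n : ℝ) + 1 + 1) = n + 2 := by ring
  rw [e]
  gcongr 2 ^ (n + 2) * (n + 2) * Real.exp (-?_)
  -- The power of two collects 2^(n+1) from the region estimate, 2 from s/2 and 2^n from halving
  -- `y`.
  calc a / ((n + 2) * 2 ^ (2 * n + 2)) * N * s * cornerSum (fun j => y (i.succAbove j))
      = a / ((n + 2) * 2 ^ (n + 1)) * N *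
        (s / 2 * ((2 : ℝ)⁻¹ ^ n * cornerSum fun j => y (i.succAbove j))) := by
        rw [inv_pow]
        field_simp
        ring
    _ ≤ _ := by gcongr

end Corner

/-! ### Scaling -/

section Scaling

theorem missProb_map {E F : Type*} [NormedAddCommGroup E] [NormedSpace ℝ E] [MeasurableSpace E]
    [BorelSpace E] [FiniteDimensional ℝ E] [NormedAddCommGroup F] [NormedSpace ℝ F]
    [MeasurableSpace F] [BorelSpace F] [FiniteDimensional ℝ F] (μ : Measure E)
    [IsProbabilityMeasure μ] (Φ : E →ᵃ[ℝ] F) (hΦ : Measurable Φ) (hinj : Function.Injective Φ)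
    (N : ℕ) (y : E) : missProb (μ.map Φ) N (Φ y) = missProb μ N y := by
  have : IsProbabilityMeasure (μ.map Φ) := Measure.isProbabilityMeasure_map hΦ.aemeasurable
  have h := Measure.pi_map_pi (μ := fun _ : Fin N => μ) (f := fun _ => Φ)
    fun _ => hΦ.aemeasurable
  rw [missProb, ← h, map_measureReal_apply (by fun_prop) (measurableSet_notMem_convexHull_range _),
    missProb]
  congr 1
  ext x
  simp only [Set.mem_preimage, Set.mem_ofPred_eq]
  have : Set.range (fun i => Φ (x i)) = Φ '' Set.range x := by
    rw [← Set.range_comp]; rfl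
  rw [this, ← AffineMap.image_convexHull, hinj.mem_set_image]

theorem facetMeasure_cornerBox {n : ℕ} (i : Fin (n + 1)) {s : ℝ} (hs : 0 < s) :
    facetMeasure i (cornerBox (n + 1) s) = ENNReal.ofReal (s ^ n) := by
  have : cornerBox (n + 1) s = Set.univ.pi fun _ => Set.Icc 0 s := by
    rw [cornerBox, ← Set.pi_univ_Icc]; rfl
  rw [this, facetMeasure_pi i _ (fun _ => measurableSet_Icc) ⟨le_rfl, hs.le⟩]
  simp [Real.volume_Icc, ENNReal.ofReal_pow hs.le]

theorem map_smul_facetMeasure {n : ℕ} (i : Fin (n + 1)) {s : ℝ} (hs : 0 < s) :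
    (facetMeasure i).map (s • ·) = ENNReal.ofReal ((s ^ n)⁻¹) • facetMeasure i := by
  have h := Measure.map_addHaar_smul (volume : Measure (Fin n → ℝ)) hs.ne'
  rw [Module.finrank_fin_fun, abs_of_pos (by positivity)] at h
  rw [facetMeasure, Measure.map_map (measurable_const_smul s) (measurable_facetEmbedding i),
    ← Measure.map_smul, ← h, Measure.map_map (measurable_facetEmbedding i) (measurable_const_smul s)]
  congr 1
  funext z j
  rcases Fin.eq_self_or_eq_succAbove i j with rfl | ⟨l, rfl⟩
  · simp [facetEmbedding_self]
  · simp [facetEmbedding_succAbove]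

theorem smul_preimage_cornerBox {n : ℕ} {s t : ℝ} (hs : 0 < s) :
    (s • · : (Fin n → ℝ) → (Fin n → ℝ)) ⁻¹' cornerBox n (s * t) = cornerBox n t := by
  ext y
  simp only [cornerBox, Set.mem_preimage, Set.mem_Icc, Pi.le_def, Pi.zero_apply, Pi.smul_apply,
    smul_eq_mul, mul_le_mul_iff_right₀ hs, mul_nonneg_iff_of_pos_left hs]

/-- The normalised corner measure on the unit cube. -/
noncomputable def stdCorner {n : ℕ} (α : Fin (n + 1) → ℝ) : Measure (Fin (n + 1) → ℝ) :=
  ENNReal.ofReal (∑ i, α i)⁻¹ •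
    ∑ i, ENNReal.ofReal (α i) • (facetMeasure i).restrict (cornerBox (n + 1) 1)

theorem IsCornerMeasure.measure_cornerBox {n : ℕ} {α : Fin (n + 1) → ℝ} {s : ℝ}
    {μ : Measure (Fin (n + 1) → ℝ)} (h : IsCornerMeasure α s μ) :
    μ (cornerBox (n + 1) s) = ENNReal.ofReal ((∑ i, α i) * s ^ n) := by
  have h1 := congrArg (fun ν : Measure (Fin (n + 1) → ℝ) => ν (cornerBox (n + 1) s)) h.restrict_eq
  simp only [Measure.restrict_apply_self, Measure.finsetSum_apply, Measure.smul_apply, smul_eq_mul,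
    facetMeasure_cornerBox _ h.side_pos] at h1
  rw [h1, ENNReal.ofReal_mul (Finset.sum_nonneg fun i _ => (h.pos i).le),
    ENNReal.ofReal_sum_of_nonneg fun i _ => (h.pos i).le, Finset.sum_mul]

theorem sum_alpha_pos {n : ℕ} {α : Fin (n + 1) → ℝ} (h : ∀ i, 0 < α i) : 0 < ∑ i, α i :=
  Finset.sum_pos (fun i _ => h i) Finset.univ_nonempty

theorem isCornerMeasure_stdCorner {n : ℕ} {α : Fin (n + 1) → ℝ} (h : ∀ i, 0 < α i) :
    IsCornerMeasure (fun i => (∑ i, α i)⁻¹ * α i) 1 (stdCorner α) := by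
  have hA := sum_alpha_pos h
  refine ⟨⟨?_⟩, fun i => mul_pos (inv_pos.2 hA) (h i), one_pos, ?_, ?_⟩
  · simp only [stdCorner, Measure.smul_apply, Measure.finsetSum_apply, Measure.restrict_apply_univ,
      facetMeasure_cornerBox _ one_pos, one_pow, ENNReal.ofReal_one, smul_eq_mul, mul_one]
    rw [← ENNReal.ofReal_sum_of_nonneg fun i _ => (h i).le, ← ENNReal.ofReal_mul (by positivity),
      inv_mul_cancel₀ hA.ne', ENNReal.ofReal_one]
  · refine Measure.ae_smul_measure ?_ _
    rw [ae_finsetSum_measure_iff]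
    intro i _
    refine Measure.ae_smul_measure ?_ _
    refine (ae_restrict_iff' (measurableSet_cornerBox _ _)).2 (Eventually.of_forall ?_)
    exact fun x hx => hx.1
  · rw [stdCorner, Measure.restrict_smul, Measure.restrict_finsetSum, Finset.smul_sum]
    refine Finset.sum_congr rfl fun i _ => ?_
    rw [Measure.restrict_smul, Measure.restrict_restrict (measurableSet_cornerBox _ _),
      Set.inter_self, smul_smul, ENNReal.ofReal_mul (by positivity)]

/-- Lebesgue measure on a coordinate hyperplane is invariant under dilations up to a factor, the
same for all hyperplanes. Conditioning on cubes of any size therefore gives dilates of one law; this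
is the self-similarity behind the limit. -/
theorem IsCornerMeasure.cond_eq_map {n : ℕ} {α : Fin (n + 1) → ℝ} {s : ℝ}
    {μ : Measure (Fin (n + 1) → ℝ)} (h : IsCornerMeasure α s μ) :
    ProbabilityTheory.cond μ (cornerBox (n + 1) s) = (stdCorner α).map (s • ·) := by
  have hs := h.side_pos
  have hA := sum_alpha_pos h.pos
  have hm : Measurable (s • · : (Fin (n + 1) → ℝ) → (Fin (n + 1) → ℝ)) := measurable_const_smul s
  have hi : ∀ i : Fin (n + 1), ((facetMeasure i).restrict (cornerBox (n + 1) 1)).map (s • ·) =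
      ENNReal.ofReal ((s ^ n)⁻¹) • (facetMeasure i).restrict (cornerBox (n + 1) s) := by
    intro i
    rw [← Measure.restrict_smul, ← map_smul_facetMeasure i hs,
      Measure.restrict_map hm (measurableSet_cornerBox _ _)]
    congr 2
    have := smul_preimage_cornerBox (n := n + 1) (t := 1) hs
    rw [mul_one] at this
    exact this.symm
  rw [ProbabilityTheory.cond, h.measure_cornerBox, h.restrict_eq, stdCorner, Measure.map_smul,
    ← Measure.mapₗ_apply_of_measurable hm, map_sum]
  simp only [Measure.mapₗ_apply_of_measurable hm, Measure.map_smul, hi]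
  rw [← ENNReal.ofReal_inv_of_pos (by positivity), mul_inv, ENNReal.ofReal_mul (by positivity),
    mul_smul]
  congr 1
  rw [Finset.smul_sum]
  refine Finset.sum_congr rfl fun i _ => ?_
  rw [smul_comm]

/-- The expected volume missed by the hull of `m` points of the normalised corner measure, within
the cube of half side length. -/
noncomputable def cornerMiss {n : ℕ} (α : Fin (n + 1) → ℝ) (m : ℕ) : ℝ :=
  ∫ y in cornerBox (n + 1) (1 / 2), missProb (stdCorner α) m y

open scoped Pointwise in
theorem IsCornerMeasure.setIntegral_missProb_cond {n : ℕ} {α : Fin (n + 1) → ℝ} {s : ℝ}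
    {μ : Measure (Fin (n + 1) → ℝ)} (h : IsCornerMeasure α s μ) (m : ℕ) :
    ∫ y in cornerBox (n + 1) (s / 2),
      missProb (ProbabilityTheory.cond μ (cornerBox (n + 1) s)) m y =
      s ^ (n + 1) * cornerMiss α m := by
  have hs := h.side_pos
  have := (isCornerMeasure_stdCorner h.pos).prob
  have hmiss : ∀ y, missProb (ProbabilityTheory.cond μ (cornerBox (n + 1) s)) m (s • y) =
      missProb (stdCorner α) m y := by
    intro y
    rw [h.cond_eq_map]
    exact missProb_map (stdCorner α) (s • LinearMap.id : (Fin (n + 1) → ℝ) →ₗ[ℝ] _).toAffineMap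
      (measurable_const_smul s) (smul_right_injective _ hs.ne') m y
  have hpre : cornerBox (n + 1) (s / 2) = s • cornerBox (n + 1) (1 / 2) := by
    rw [← Set.preimage_smul_inv₀ hs.ne']
    have := smul_preimage_cornerBox (n := n + 1) (s := s⁻¹) (t := s / 2) (inv_pos.2 hs)
    rw [← this]
    congr 2
    field_simp
  have h1 := Measure.setIntegral_comp_smul_of_pos (volume : Measure (Fin (n + 1) → ℝ))
    (fun y => missProb (ProbabilityTheory.cond μ (cornerBox (n + 1) s)) m y)
    (cornerBox (n + 1) (1 / 2)) hs
  simp only [hmiss, ← hpre, Module.finrank_fin_fun, smul_eq_mul] at h1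
  rw [cornerMiss, h1]
  field_simp

theorem volume_cornerBox_lt_top (n : ℕ) (s : ℝ) : volume (cornerBox n s) < ⊤ :=
  isCompact_Icc.measure_lt_top

theorem integrableOn_missProb {n : ℕ} (μ : Measure (Fin n → ℝ)) [IsProbabilityMeasure μ] (N : ℕ)
    {D : Set (Fin n → ℝ)} (hD : volume D < ⊤) : IntegrableOn (missProb μ N) D :=
  Measure.integrableOn_of_bounded hD.ne (measurable_missProb μ N).aestronglyMeasurable (M := 1)
    (Eventually.of_forall fun y => by
      rw [Real.norm_of_nonneg (missProb_nonneg _ _ _)]; exact missProb_le_one _ _ _)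

theorem integrableOn_localMissProb {n : ℕ} (μ : Measure (Fin n → ℝ)) [IsProbabilityMeasure μ]
    {B : Set (Fin n → ℝ)} (hB : MeasurableSet B) (N : ℕ)
    {D : Set (Fin n → ℝ)} (hD : volume D < ⊤) : IntegrableOn (localMissProb μ B N) D :=
  Measure.integrableOn_of_bounded hD.ne (measurable_localMissProb μ hB N).aestronglyMeasurable (M := 1)
    (Eventually.of_forall fun y => by
      rw [Real.norm_of_nonneg (localMissProb_nonneg _ _ _ _)]; exact localMissProb_le_one _ _ _ _)

/-- The number of points in the cube is binomial with success probability `p`, the mass of the cube;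
given this number, scaling reduces to the normalised corner. -/
theorem IsCornerMeasure.setIntegral_localMissProb {n : ℕ} {α : Fin (n + 1) → ℝ} {s : ℝ}
    {μ : Measure (Fin (n + 1) → ℝ)} (h : IsCornerMeasure α s μ) (N : ℕ) {p : ℝ}
    (hp : p = (∑ i, α i) * s ^ n) :
    ∫ y in cornerBox (n + 1) (s / 2), localMissProb μ (cornerBox (n + 1) s) N y =
      s ^ (n + 1) * ∑ j ∈ Finset.range (N + 1),
        (N.choose j) * p ^ j * (1 - p) ^ (N - j) * cornerMiss α j := by
  have := h.prob
  have hA := sum_alpha_pos h.pos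
  have hs := h.side_pos
  have hp0 : 0 < p := by rw [hp]; positivity
  have hm := h.measure_cornerBox
  rw [← hp] at hm
  have hne : μ (cornerBox (n + 1) s) ≠ 0 := by
    rw [hm]; simpa using hp0
  have hreal : μ.real (cornerBox (n + 1) s) = p := by
    rw [Measure.real, hm, ENNReal.toReal_ofReal hp0.le]
  have : IsProbabilityMeasure (ProbabilityTheory.cond μ (cornerBox (n + 1) s)) :=
    ProbabilityTheory.cond_isProbabilityMeasure hne
  simp only [localMissProb_eq_sum μ (measurableSet_cornerBox _ _) hne N, hreal]
  rw [integral_finsetSum _ fun j _ => ((integrableOn_missProb _ j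
    (volume_cornerBox_lt_top _ _)).const_mul _), Finset.mul_sum]
  refine Finset.sum_congr rfl fun j _ => ?_
  rw [integral_const_mul, h.setIntegral_missProb_cond]
  ring

end Scaling

/-! ### Binomial averages -/

section Binomial

theorem sum_binomial_eq_one (N : ℕ) (p : ℝ) :
    ∑ j ∈ Finset.range (N + 1), (N.choose j : ℝ) * p ^ j * (1 - p) ^ (N - j) = 1 := by
  have h := add_pow p (1 - p) N
  rw [add_sub_cancel, one_pow] at h
  refine Eq.trans ?_ h.symm
  exact Finset.sum_congr rfl fun j _ => by ring

theorem sum_binomial_variance (N : ℕ) (p : ℝ) :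
    ∑ j ∈ Finset.range (N + 1),
      (N.choose j : ℝ) * p ^ j * (1 - p) ^ (N - j) * ((j : ℝ) - N * p) ^ 2 = N * p * (1 - p) := by
  have h := congrArg (Polynomial.eval p) (bernsteinPolynomial.variance ℝ N)
  simp only [Polynomial.eval_finsetSum, Polynomial.eval_mul, Polynomial.eval_pow,
    Polynomial.eval_sub, nsmul_eq_mul, Polynomial.eval_natCast, Polynomial.eval_X,
    Polynomial.eval_one, bernsteinPolynomial] at h
  rw [← h]
  exact Finset.sum_congr rfl fun j _ => by ring

/-- Cauchy–Schwarz with the binomial weights bounds the mean deviation by the standard deviation. -/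
theorem sum_binomial_abs_le (N : ℕ) {p : ℝ} (hp0 : 0 ≤ p) (hp1 : p ≤ 1) :
    ∑ j ∈ Finset.range (N + 1),
      (N.choose j : ℝ) * p ^ j * (1 - p) ^ (N - j) * |(j : ℝ) - N * p| ≤ Real.sqrt (N * p) := by
  have hb : ∀ j, 0 ≤ (N.choose j : ℝ) * p ^ j * (1 - p) ^ (N - j) := fun j => by
    have : 0 ≤ 1 - p := by linarith
    positivity
  refine Real.le_sqrt_of_sq_le ?_
  have h := Finset.sum_mul_sq_le_sq_mul_sq (Finset.range (N + 1))
    (fun j => Real.sqrt ((N.choose j : ℝ) * p ^ j * (1 - p) ^ (N - j)))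
    (fun j => Real.sqrt ((N.choose j : ℝ) * p ^ j * (1 - p) ^ (N - j)) * |(j : ℝ) - N * p|)
  simp only [← mul_assoc, Real.mul_self_sqrt (hb _), mul_pow, Real.sq_sqrt (hb _), sq_abs] at h
  rw [sum_binomial_eq_one, sum_binomial_variance, one_mul] at h
  refine h.trans ?_
  have : 0 ≤ N * p := by positivity
  nlinarith

/-- A Chernoff bound for the lower tail. -/
theorem sum_binomial_lower_tail_le (N : ℕ) {p : ℝ} (hp0 : 0 ≤ p) (hp1 : p ≤ 1) :
    ∑ j ∈ Finset.range (N + 1) with 2 * ((j : ℕ) : ℝ) < N * p,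
      (N.choose j : ℝ) * p ^ j * (1 - p) ^ (N - j) ≤
      Real.exp (-((1 - Real.log 2) / 2 * (N * p))) := by
  have hq : 0 ≤ 1 - p := by linarith
  have hb : ∀ j, 0 ≤ (N.choose j : ℝ) * p ^ j * (1 - p) ^ (N - j) := fun j => by positivity
  -- Insert the weight 2^(Np/2 - j), which is at least one on the tail; the weighted sum over all j
  -- is then evaluated by the binomial theorem.
  calc _ ≤ ∑ j ∈ Finset.range (N + 1) with 2 * ((j : ℕ) : ℝ) < N * p,
        (N.choose j : ℝ) * p ^ j * (1 - p) ^ (N - j) *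
          (Real.exp (Real.log 2 * (N * p) / 2) * 2⁻¹ ^ j) := by
        refine Finset.sum_le_sum fun j hj => ?_
        have hj' := (Finset.mem_filter.1 hj).2
        refine le_mul_of_one_le_right (hb j) ?_
        have e : (2⁻¹ : ℝ) ^ j = Real.exp (-(Real.log 2 * j)) := by
          rw [inv_pow, Real.exp_neg, mul_comm, Real.exp_nat_mul, Real.exp_log two_pos]
        rw [e, ← Real.exp_add]
        refine Real.one_le_exp ?_
        have := Real.log_pos one_lt_two
        nlinarith
    _ ≤ ∑ j ∈ Finset.range (N + 1), (N.choose j : ℝ) * p ^ j * (1 - p) ^ (N - j) *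
          (Real.exp (Real.log 2 * (N * p) / 2) * 2⁻¹ ^ j) :=
        Finset.sum_le_sum_of_subset_of_nonneg (Finset.filter_subset _ _) fun j _ _ =>
          mul_nonneg (hb j) (by positivity)
    _ = Real.exp (Real.log 2 * (N * p) / 2) * (p / 2 + (1 - p)) ^ N := by
        rw [add_pow, Finset.mul_sum]
        refine Finset.sum_congr rfl fun j _ => ?_
        rw [div_eq_mul_inv p 2, mul_pow]
        ring
    _ ≤ Real.exp (Real.log 2 * (N * p) / 2) * (Real.exp (-(p / 2))) ^ N := by
        gcongr
        have := Real.one_sub_le_exp_neg (p / 2)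
        linarith
    _ = _ := by
        rw [← Real.exp_nat_mul, ← Real.exp_add]
        congr 1
        ring

/-- A slowly varying sequence is close to its binomial averages. -/
theorem abs_sum_binomial_sub_le {g : ℕ → ℝ} {G M : ℝ} (hG : 0 ≤ G) {N m : ℕ} (hm : 1 ≤ m)
    (hmN : m ≤ N) {p : ℝ} (hp : N * p = m) (hM : ∀ j, |g j - g m| ≤ M)
    (hg : ∀ j, m ≤ 2 * j → |g j - g m| ≤ G * |(j : ℝ) - m|) :
    |∑ j ∈ Finset.range (N + 1), (N.choose j : ℝ) * p ^ j * (1 - p) ^ (N - j) * g j - g m| ≤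
      G * Real.sqrt m + M * Real.exp (-((1 - Real.log 2) / 2 * m)) := by
  have hN : (0 : ℝ) < N := by exact_mod_cast (by omega : 0 < N)
  have hpm : p = m / N := by field_simp; linarith
  have hp0 : 0 ≤ p := by rw [hpm]; positivity
  have hp1 : p ≤ 1 := by
    rw [hpm, div_le_one hN]; exact_mod_cast hmN
  have hq : 0 ≤ 1 - p := by linarith
  have hM0 : 0 ≤ M := (abs_nonneg _).trans (hM 0)
  set b : ℕ → ℝ := fun j => (N.choose j : ℝ) * p ^ j * (1 - p) ^ (N - j) with hbdef
  have hb : ∀ j, 0 ≤ b j := fun j => by positivity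
  have h1 : ∑ j ∈ Finset.range (N + 1), b j * g j - g m =
      ∑ j ∈ Finset.range (N + 1), b j * (g j - g m) := by
    simp only [mul_sub, Finset.sum_sub_distrib, ← Finset.sum_mul]
    rw [sum_binomial_eq_one, one_mul]
  -- The Lipschitz bound is used for j ≥ m/2 and the trivial bound `M` on the lower tail, whose
  -- weight is exponentially small.
  have h2 : ∀ j ∈ Finset.range (N + 1), |b j * (g j - g m)| ≤
      G * (b j * |(j : ℝ) - m|) + M * (if 2 * (j : ℝ) < m then b j else 0) := by
    intro j _
    rw [abs_mul, abs_of_nonneg (hb j)]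
    split_ifs with h
    · have := mul_le_mul_of_nonneg_left (hM j) (hb j)
      have h3 : 0 ≤ G * (b j * |(j : ℝ) - m|) := mul_nonneg hG (mul_nonneg (hb j) (abs_nonneg _))
      linarith
    · have h4 : m ≤ 2 * j := by
        rw [not_lt] at h
        exact_mod_cast h
      have := mul_le_mul_of_nonneg_left (hg j h4) (hb j)
      linarith
  rw [h1]
  refine (Finset.abs_sum_le_sum_abs _ _).trans ((Finset.sum_le_sum h2).trans ?_)
  rw [Finset.sum_add_distrib, ← Finset.mul_sum, ← Finset.mul_sum, ← Finset.sum_filter]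
  have h5 := sum_binomial_abs_le N hp0 hp1
  have h6 := sum_binomial_lower_tail_le N hp0 hp1
  rw [hp] at h5 h6
  exact add_le_add (mul_le_mul_of_nonneg_left h5 hG) (mul_le_mul_of_nonneg_left h6 hM0)

/-- Exponential decay beats every power. -/
theorem exists_exp_neg_le_rpow {c : ℝ} (hc : 0 < c) (r : ℝ) :
    ∃ C : ℝ, 0 < C ∧ ∀ m : ℕ, 1 ≤ m → Real.exp (-(c * m)) ≤ C * (m : ℝ) ^ (-r) := by
  have h := (isLittleO_exp_neg_mul_rpow_atTop hc (-r)).isBigO.comp_tendsto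
    tendsto_natCast_atTop_atTop
  obtain ⟨C, hC, hev⟩ := h.exists_pos
  rw [IsBigOWith] at hev
  obtain ⟨m₀, hm₀⟩ := eventually_atTop.1 hev
  have hfin : ∀ m : ℕ, 1 ≤ m → 0 < (m : ℝ) ^ (-r) := fun m hm => by
    have : (0 : ℝ) < m := by exact_mod_cast hm
    positivity
  obtain ⟨D, hD⟩ :=
    ((Finset.range m₀).image fun m : ℕ => ((m : ℝ) ^ (-r))⁻¹).bddAbove
  -- `C` comes from the asymptotic comparison beyond `m₀`, while `D` covers the finitely many
  -- smaller m.
  refine ⟨max C (max D 1), by positivity, fun m hm => ?_⟩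
  by_cases hmm : m₀ ≤ m
  · have := hm₀ m hmm
    simp only [Function.comp_apply, Real.norm_of_nonneg (Real.exp_pos _).le,
      Real.norm_of_nonneg (hfin m hm).le, neg_mul] at this
    refine this.trans ?_
    have := hfin m hm
    gcongr
    exact le_max_left _ _
  · have h1 : ((m : ℝ) ^ (-r))⁻¹ ≤ D := hD (by
      simp only [Finset.coe_image, Set.mem_image, Finset.mem_coe, Finset.mem_range]
      exact ⟨m, by omega, rfl⟩)
    have h2 := hfin m hm
    have h3 : 1 ≤ D * (m : ℝ) ^ (-r) := by
      rw [inv_le_iff_one_le_mul₀ h2] at h1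
      exact h1
    have h4 : Real.exp (-(c * m)) ≤ 1 := Real.exp_le_one_iff.2 (by
      have : 0 ≤ c * m := by positivity
      linarith)
    refine h4.trans (h3.trans ?_)
    gcongr
    exact (le_max_left _ _).trans (le_max_right _ _)

end Binomial

/-! ### Asymptotics at a corner -/

section CornerAsymptotics

theorem setIntegral_le_sum_setIntegral {X ι : Type*} [MeasurableSpace X] [Fintype ι]
    {μ : Measure X} {f : X → ℝ} (hf : ∀ x, 0 ≤ f x) {D : Set X} {S : ι → Set X}
    (hD : MeasurableSet D) (hS : ∀ i, MeasurableSet (S i)) (hDS : D ⊆ ⋃ i, S i)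
    (hint : ∀ i, IntegrableOn f (S i) μ) :
    ∫ x in D, f x ∂μ ≤ ∑ i, ∫ x in S i, f x ∂μ := by
  have hU : IntegrableOn f (⋃ i, S i) μ := by
    rw [integrableOn_finite_iUnion]; exact hint
  have hs : Integrable (fun x => ∑ i, (S i).indicator f x) μ :=
    integrable_finsetSum _ fun i _ => (hint i).integrable_indicator (hS i)
  rw [← integral_indicator hD]
  simp only [← integral_indicator (hS _)]
  rw [← integral_finsetSum _ fun i _ => (hint i).integrable_indicator (hS i)]
  refine integral_mono ((hU.mono_set hDS).integrable_indicator hD) hs fun x => ?_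
  have hnn : ∀ i, 0 ≤ (S i).indicator f x := fun i => Set.indicator_nonneg (fun x _ => hf x) x
  by_cases hx : x ∈ D
  · obtain ⟨i, hi⟩ := Set.mem_iUnion.1 (hDS hx)
    rw [Set.indicator_of_mem hx]
    calc f x = (S i).indicator f x := (Set.indicator_of_mem hi f).symm
      _ ≤ _ := Finset.single_le_sum (f := fun i => (S i).indicator f x) (fun i _ => hnn i)
        (Finset.mem_univ i)
  · rw [Set.indicator_of_notMem hx]
    exact Finset.sum_nonneg fun i _ => hnn i

theorem integrableOn_of_continuous_of_subset_cornerBox {n : ℕ} {f : (Fin n → ℝ) → ℝ}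
    (hf : Continuous f) {D : Set (Fin n → ℝ)} {s : ℝ} (hD : D ⊆ cornerBox n s) :
    IntegrableOn f D :=
  (hf.continuousOn.integrableOn_compact isCompact_Icc).mono_set hD

theorem exists_pos_le {n : ℕ} {α : Fin (n + 1) → ℝ} (h : ∀ i, 0 < α i) :
    ∃ a : ℝ, 0 < a ∧ ∀ i, a ≤ α i := by
  obtain ⟨i, -, hi⟩ := Finset.exists_min_image Finset.univ α Finset.univ_nonempty
  exact ⟨α i, h i, fun j => hi j (Finset.mem_univ j)⟩

variable {k : ℕ} {α : Fin (k + 2) → ℝ}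

theorem continuous_exp_cornerSum {n : ℕ} (c : ℝ) :
    Continuous fun y : Fin n → ℝ => Real.exp (-(c * cornerSum y)) := by
  have := continuous_cornerSum (n := n)
  fun_prop

/-- Integrate the pointwise exponential bound over the orthant; the exponent is that of the
homogeneous exponential integral in k+2 variables. -/
theorem IsCornerMeasure.exists_setIntegral_missProb_le (hk : 1 ≤ k) {s : ℝ}
    {μ : Measure (Fin (k + 2) → ℝ)} (h : IsCornerMeasure α s μ) :
    ∃ C : ℝ, 0 < C ∧ ∀ N : ℕ, 1 ≤ N →
      ∫ y in cornerBox (k + 2) (s / 2), missProb μ N y ≤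
        C * (N : ℝ) ^ (-((k + 2 : ℝ) / (k + 1))) := by
  have := h.prob
  obtain ⟨a, ha0, ha⟩ := exists_pos_le h.pos
  obtain ⟨K, hK, hKle⟩ := exists_setIntegral_exp_cornerSum_le (n := k + 1) (by omega)
  set c : ℝ := a / (((k + 1 : ℕ) + 1) * 2 ^ (k + 1)) with hc
  have hc0 : 0 < c := by positivity
  refine ⟨2 ^ (k + 1 + 1) * ((k + 1 : ℕ) + 1) * (K * c ^ (-((k + 2 : ℝ) / (k + 1)))),
    by positivity, fun N hN => ?_⟩
  have hN0 : (0 : ℝ) < N := by exact_mod_cast hN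
  have h1 := (hKle (cornerBox (k + 2) (s / 2)) (c * N) (fun y hy => hy.1)
    (measurableSet_cornerBox _ _) (by positivity)).2
  have e : (-((((k + 1 : ℕ) : ℝ) + 1) / ((k + 1 : ℕ) : ℝ))) = -((k + 2 : ℝ) / (k + 1)) := by
    push_cast; ring
  rw [e, Real.mul_rpow hc0.le hN0.le] at h1
  calc ∫ y in cornerBox (k + 2) (s / 2), missProb μ N y
      ≤ ∫ y in cornerBox (k + 2) (s / 2), 2 ^ (k + 1 + 1) * ((k + 1 : ℕ) + 1) *
        Real.exp (-(c * N * cornerSum y)) := by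
        refine setIntegral_mono_on (integrableOn_missProb μ N (volume_cornerBox_lt_top _ _))
          (integrableOn_of_continuous_of_subset_cornerBox
            ((continuous_exp_cornerSum _).const_mul _) subset_rfl)
          (measurableSet_cornerBox _ _) fun y hy => ?_
        exact (missProb_le_localMissProb μ _ N y).trans
          (h.localMissProb_le (by omega) ha ha0 hy N)
    _ = 2 ^ (k + 1 + 1) * ((k + 1 : ℕ) + 1) *
        ∫ y in cornerBox (k + 2) (s / 2), Real.exp (-(c * N * cornerSum y)) :=
        integral_const_mul _ _
    _ ≤ 2 ^ (k + 1 + 1) * ((k + 1 : ℕ) + 1) *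
        (K * (c ^ (-((k + 2 : ℝ) / (k + 1))) * (N : ℝ) ^ (-((k + 2 : ℝ) / (k + 1))))) := by
        gcongr
    _ = _ := by ring

theorem cornerMiss_nonneg {n : ℕ} (α : Fin (n + 1) → ℝ) (m : ℕ) : 0 ≤ cornerMiss α m :=
  integral_nonneg fun _ => missProb_nonneg _ _ _

theorem volume_real_cornerBox (n : ℕ) {s : ℝ} (hs : 0 ≤ s) :
    volume.real (cornerBox n s) = s ^ n := by
  rw [cornerBox, Measure.real, Real.volume_Icc_pi]
  simp [ENNReal.toReal_ofReal hs]

theorem cornerMiss_le_one {n : ℕ} {α : Fin (n + 1) → ℝ} (h : ∀ i, 0 < α i) (m : ℕ) :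
    cornerMiss α m ≤ 1 := by
  have := (isCornerMeasure_stdCorner h).prob
  calc cornerMiss α m ≤ ∫ y in cornerBox (n + 1) (1 / 2), (1 : ℝ) :=
        setIntegral_mono (integrableOn_missProb _ m (volume_cornerBox_lt_top _ _))
          (integrableOn_const (volume_cornerBox_lt_top _ _).ne) fun y => missProb_le_one _ _ _
    _ = (1 / 2) ^ (n + 1) := by
        rw [setIntegral_const, volume_real_cornerBox _ (by norm_num)]; simp
    _ ≤ 1 := pow_le_one₀ (by norm_num) (by norm_num)

theorem cornerMiss_antitone {n : ℕ} {α : Fin (n + 1) → ℝ} (h : ∀ i, 0 < α i) :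
    Antitone (cornerMiss α) := by
  have := (isCornerMeasure_stdCorner h).prob
  intro a b hab
  exact setIntegral_mono (integrableOn_missProb _ b (volume_cornerBox_lt_top _ _))
    (integrableOn_missProb _ a (volume_cornerBox_lt_top _ _))
    fun y => missProb_antitone (stdCorner α) y hab

/-- One more point changes the missed volume by O(1/m) times the missed volume for half the sample,
which has the same order as that for m points. -/
theorem exists_cornerMiss_sub_succ_le (hk : 1 ≤ k) (h : ∀ i, 0 < α i) :
    ∃ G : ℝ, 0 < G ∧ ∀ m : ℕ, 1 ≤ m → cornerMiss α m - cornerMiss α (m + 1) ≤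
      G * (m : ℝ) ^ (-(1 + (k + 2 : ℝ) / (k + 1))) := by
  have hstd := isCornerMeasure_stdCorner h
  have := hstd.prob
  obtain ⟨C, hC, hCle⟩ := hstd.exists_setIntegral_missProb_le hk
  set r : ℝ := (k + 2 : ℝ) / (k + 1) with hr
  have hr0 : 0 < r := by positivity
  refine ⟨2 * (k + 3) * C * 3 ^ r, by positivity, fun m hm => ?_⟩
  have hm0 : (0 : ℝ) < m := by exact_mod_cast hm
  have h1 : cornerMiss α m - cornerMiss α (m + 1) ≤
      2 * (k + 3) / (m + 1) * cornerMiss α ((m + 1) / 2) := by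
    simp only [cornerMiss]
    rw [← integral_sub (integrableOn_missProb _ m (volume_cornerBox_lt_top _ _))
      (integrableOn_missProb _ (m + 1) (volume_cornerBox_lt_top _ _)), ← integral_const_mul]
    refine setIntegral_mono ((integrableOn_missProb _ m (volume_cornerBox_lt_top _ _)).sub
      (integrableOn_missProb _ (m + 1) (volume_cornerBox_lt_top _ _)))
      ((integrableOn_missProb _ _ (volume_cornerBox_lt_top _ _)).const_mul _) fun y => ?_
    have := missProb_sub_missProb_succ_le (stdCorner α) m y
    rw [Module.finrank_fin_fun] at this
    push_cast at this
    refine this.trans (le_of_eq ?_)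
    ring
  have h2 := hCle ((m + 1) / 2) (by omega)
  have h3 : (m : ℝ) / 3 ≤ (((m + 1) / 2 : ℕ) : ℝ) := by
    rw [div_le_iff₀ (by norm_num)]
    exact_mod_cast (by omega : m ≤ (m + 1) / 2 * 3)
  have h4 : (((m + 1) / 2 : ℕ) : ℝ) ^ (-r) ≤ 3 ^ r * (m : ℝ) ^ (-r) := by
    calc (((m + 1) / 2 : ℕ) : ℝ) ^ (-r) ≤ ((m : ℝ) / 3) ^ (-r) :=
          Real.rpow_le_rpow_of_nonpos (by positivity) h3 (by linarith)
      _ = 3 ^ r * (m : ℝ) ^ (-r) := by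
          rw [Real.div_rpow hm0.le (by norm_num), Real.rpow_neg (by norm_num : (0 : ℝ) ≤ 3)]
          field_simp
  have h5 : cornerMiss α ((m + 1) / 2) ≤ C * (3 ^ r * (m : ℝ) ^ (-r)) :=
    h2.trans (mul_le_mul_of_nonneg_left h4 hC.le)
  calc _ ≤ 2 * (k + 3) / (m + 1) * cornerMiss α ((m + 1) / 2) := h1
    _ ≤ 2 * (k + 3) / m * (C * (3 ^ r * (m : ℝ) ^ (-r))) := by
        have := cornerMiss_nonneg α ((m + 1) / 2)
        gcongr
        linarith
    _ = _ := by
        rw [neg_add, Real.rpow_add hm0, Real.rpow_neg_one]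
        field_simp

/-- Telescope the one-step bound. The condition on `j` keeps all sample sizes involved at least m/2,
so the power is controlled by that of m. -/
theorem exists_abs_cornerMiss_sub_le (hk : 1 ≤ k) (h : ∀ i, 0 < α i) :
    ∃ G : ℝ, 0 < G ∧ ∀ m j : ℕ, 1 ≤ m → m ≤ 2 * j → |cornerMiss α j - cornerMiss α m| ≤
      G * (m : ℝ) ^ (-(1 + (k + 2 : ℝ) / (k + 1))) * |(j : ℝ) - m| := by
  obtain ⟨G, hG, hGle⟩ := exists_cornerMiss_sub_succ_le hk h
  set ρ : ℝ := 1 + (k + 2 : ℝ) / (k + 1) with hρ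
  have hρ0 : 0 < ρ := by positivity
  have step : ∀ a : ℕ, 1 ≤ a → ∀ d : ℕ, cornerMiss α a - cornerMiss α (a + d) ≤
      G * (a : ℝ) ^ (-ρ) * d := by
    intro a ha d
    have ha0 : (0 : ℝ) < a := by exact_mod_cast ha
    induction d with
    | zero => simp
    | succ d ih =>
      have h1 := hGle (a + d) (by omega)
      have h2 : ((a + d : ℕ) : ℝ) ^ (-ρ) ≤ (a : ℝ) ^ (-ρ) :=
        Real.rpow_le_rpow_of_nonpos ha0 (by push_cast; linarith [(Nat.cast_nonneg d : (0:ℝ) ≤ d)])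
          (by linarith)
      have h3 := mul_le_mul_of_nonneg_left h2 hG.le
      rw [← add_assoc]
      push_cast
      linarith
  refine ⟨G * 2 ^ ρ, by positivity, fun m j hm hmj => ?_⟩
  have hm0 : (0 : ℝ) < m := by exact_mod_cast hm
  have h2 : (1 : ℝ) ≤ 2 ^ ρ := Real.one_le_rpow (by norm_num) hρ0.le
  rcases le_total m j with hle | hle
  · obtain ⟨d, rfl⟩ := Nat.exists_eq_add_of_le hle
    have h1 := step m hm d
    rw [abs_sub_comm, abs_of_nonneg (sub_nonneg.2 (cornerMiss_antitone h hle))]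
    push_cast
    rw [add_sub_cancel_left, abs_of_nonneg (Nat.cast_nonneg d)]
    refine h1.trans ?_
    gcongr
    nlinarith
  · obtain ⟨d, rfl⟩ := Nat.exists_eq_add_of_le hle
    have hj : 1 ≤ j := by omega
    have hj0 : (0 : ℝ) < j := by exact_mod_cast hj
    have h1 := step j hj d
    rw [abs_of_nonneg (sub_nonneg.2 (cornerMiss_antitone h hle)), abs_sub_comm]
    have h3 : (j : ℝ) ^ (-ρ) ≤ 2 ^ ρ * ((j + d : ℕ) : ℝ) ^ (-ρ) := by
      calc (j : ℝ) ^ (-ρ) ≤ (((j + d : ℕ) : ℝ) / 2) ^ (-ρ) :=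
            Real.rpow_le_rpow_of_nonpos (by positivity) (by
              rw [div_le_iff₀ (by norm_num)]
              exact_mod_cast (by omega : j + d ≤ j * 2)) (by linarith)
        _ = 2 ^ ρ * ((j + d : ℕ) : ℝ) ^ (-ρ) := by
            rw [Real.div_rpow (by positivity) (by norm_num),
              Real.rpow_neg (by norm_num : (0 : ℝ) ≤ 2)]
            field_simp
    have h4 : |((j + d : ℕ) : ℝ) - j| = d := by
      push_cast
      rw [add_sub_cancel_left, abs_of_nonneg (Nat.cast_nonneg d)]
    rw [h4]
    refine h1.trans ?_
    rw [mul_assoc G (2 ^ ρ)]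
    gcongr

/-- Typical fluctuations of size √m, at a cost of order m^(-1-r) per step with r = (k+2)/(k+1), give
m^(-1/2-r); the lower tail is exponentially small in m because log 2 < 1. -/
theorem exists_abs_binomial_cornerMiss_sub_le (hk : 1 ≤ k) (h : ∀ i, 0 < α i) :
    ∃ C : ℝ, 0 < C ∧ ∀ (N m : ℕ) (p : ℝ), 1 ≤ m → m ≤ N → N * p = m →
      |∑ j ∈ Finset.range (N + 1), (N.choose j : ℝ) * p ^ j * (1 - p) ^ (N - j) * cornerMiss α j -
        cornerMiss α m| ≤ C * (m : ℝ) ^ (-(1 / 2 + (k + 2 : ℝ) / (k + 1))) := by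
  obtain ⟨G, hG, hGle⟩ := exists_abs_cornerMiss_sub_le hk h
  set r : ℝ := (k + 2 : ℝ) / (k + 1) with hr
  have hlog : 0 < (1 - Real.log 2) / 2 := by
    have := Real.log_two_lt_d9
    linarith
  obtain ⟨D, hD, hDle⟩ := exists_exp_neg_le_rpow hlog (1 / 2 + r)
  refine ⟨G + D, by positivity, fun N m p hm hmN hp => ?_⟩
  have hm0 : (0 : ℝ) < m := by exact_mod_cast hm
  have h1 := abs_sum_binomial_sub_le (g := cornerMiss α) (M := 1)
    (G := G * (m : ℝ) ^ (-(1 + r))) (by positivity) hm hmN hp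
    (fun j => abs_sub_le_of_nonneg_of_le (cornerMiss_nonneg α j) (cornerMiss_le_one h j)
      (cornerMiss_nonneg α m) (cornerMiss_le_one h m)) fun j hj => hGle m j hm hj
  refine h1.trans ?_
  have e : (m : ℝ) ^ (-(1 + r)) * Real.sqrt m = (m : ℝ) ^ (-(1 / 2 + r)) := by
    rw [Real.sqrt_eq_rpow, ← Real.rpow_add hm0]
    congr 1
    ring
  have h2 := hDle m hm
  rw [mul_assoc, e, one_mul]
  linarith

end CornerAsymptotics

section CornerAsymptotics

variable {k : ℕ} {α : Fin (k + 2) → ℝ}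

/-- Outside the small cube some coordinate is at least s/2, so the tail integrals apply. The
exponential bound itself comes from the fixed cube of side `s₀`, which keeps the constant
independent of s. -/
theorem IsCornerMeasure.exists_setIntegral_sdiff_le (hk : 1 ≤ k) {s₀ : ℝ}
    {μ : Measure (Fin (k + 2) → ℝ)} (h : IsCornerMeasure α s₀ μ) :
    ∃ C : ℝ, 0 < C ∧ ∀ (N : ℕ) (s : ℝ), 1 ≤ N → 0 < s →
      ∫ y in cornerBox (k + 2) (s₀ / 2) \ cornerBox (k + 2) (s / 2), missProb μ N y ≤
        C * ((N : ℝ) ^ (-((k + 1 : ℝ) / k)) * s ^ (-(1 / (k : ℝ)))) := by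
  have := h.prob
  obtain ⟨a, ha0, ha⟩ := exists_pos_le h.pos
  obtain ⟨K, hK, hKle⟩ := exists_setIntegral_exp_cornerSum_tail_le hk
  set c : ℝ := a / (((k + 1 : ℕ) + 1) * 2 ^ (k + 1)) with hc
  have hc0 : 0 < c := by positivity
  set C₁ : ℝ := 2 ^ (k + 1 + 1) * ((k + 1 : ℕ) + 1) with hC₁
  have hC₁0 : 0 < C₁ := by positivity
  refine ⟨(k + 2) * (C₁ * (K * c ^ (-((k + 1 : ℝ) / k)) * 2 ^ (1 / (k : ℝ)))),
    by positivity, fun N s hN hs => ?_⟩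
  have hN0 : (0 : ℝ) < N := by exact_mod_cast hN
  set D : Fin (k + 2) → Set (Fin (k + 2) → ℝ) := fun i =>
    cornerBox (k + 2) (s₀ / 2) ∩ {y | s / 2 ≤ y i} with hD
  have hDm : ∀ i, MeasurableSet (D i) := fun i =>
    (measurableSet_cornerBox _ _).inter (measurableSet_le measurable_const (measurable_pi_apply i))
  have hDint : ∀ i, IntegrableOn (missProb μ N) (D i) := fun i =>
    (integrableOn_missProb μ N (volume_cornerBox_lt_top _ (s₀ / 2))).mono_set
      Set.inter_subset_left
  have hterm : ∀ i, ∫ y in D i, missProb μ N y ≤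
      C₁ * (K * c ^ (-((k + 1 : ℝ) / k)) * 2 ^ (1 / (k : ℝ))) *
        ((N : ℝ) ^ (-((k + 1 : ℝ) / k)) * s ^ (-(1 / (k : ℝ)))) := by
    intro i
    have h1 := hKle i (D i) (c * N) (s / 2) (fun y hy => ⟨hy.1.1, hy.2⟩) (hDm i) (by positivity)
      (by positivity)
    rw [Real.mul_rpow hc0.le hN0.le, Real.div_rpow hs.le (by norm_num),
      Real.rpow_neg (by norm_num : (0 : ℝ) ≤ 2), div_inv_eq_mul] at h1
    calc ∫ y in D i, missProb μ N y ≤ ∫ y in D i, C₁ * Real.exp (-(c * N * cornerSum y)) := by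
          refine setIntegral_mono_on (hDint i)
            (integrableOn_of_continuous_of_subset_cornerBox
              ((continuous_exp_cornerSum _).const_mul _) Set.inter_subset_left) (hDm i)
            fun y hy => ?_
          exact (missProb_le_localMissProb μ _ N y).trans
            (h.localMissProb_le (by omega) ha ha0 hy.1 N)
      _ = C₁ * ∫ y in D i, Real.exp (-(c * N * cornerSum y)) := integral_const_mul _ _
      _ ≤ _ := (mul_le_mul_of_nonneg_left h1 hC₁0.le).trans (le_of_eq (by ring))
  refine (setIntegral_le_sum_setIntegral (fun y => missProb_nonneg μ N y)
    ((measurableSet_cornerBox _ _).diff (measurableSet_cornerBox _ _)) hDm ?_ hDint).trans ?_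
  · intro y hy
    have : ¬ ∀ i, y i ≤ s / 2 := fun hcon => hy.2 ⟨hy.1.1, hcon⟩
    push Not at this
    obtain ⟨i, hi⟩ := this
    exact Set.mem_iUnion.2 ⟨i, hy.1, hi.le⟩
  · refine (Finset.sum_le_sum fun i _ => hterm i).trans (le_of_eq ?_)
    rw [Finset.sum_const, Finset.card_univ, Fintype.card_fin, nsmul_eq_mul]
    push_cast
    ring

/-- In each term of the locality bound one coordinate is free and contributes a factor of order s;
the others contribute (N s)^(-(k+1)/k). Together this is N^(-(k+1)/k) s^(-1/k), the same order as
the volume missed outside the small cube. -/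
theorem IsCornerMeasure.exists_setIntegral_localMissProb_sub_le (hk : 1 ≤ k) {s₀ : ℝ}
    {μ : Measure (Fin (k + 2) → ℝ)} (h : IsCornerMeasure α s₀ μ) :
    ∃ C : ℝ, 0 < C ∧ ∀ (N : ℕ) (s : ℝ), 1 ≤ N → 0 < s → s ≤ s₀ →
      ∫ y in cornerBox (k + 2) (s / 2),
        (localMissProb μ (cornerBox (k + 2) s) N y - missProb μ N y) ≤
        C * ((N : ℝ) ^ (-((k + 1 : ℝ) / k)) * s ^ (-(1 / (k : ℝ)))) := by
  have := h.prob
  obtain ⟨a, ha0, ha⟩ := exists_pos_le h.pos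
  obtain ⟨K, hK, hKle⟩ := exists_setIntegral_exp_cornerSum_succAbove_le hk
  set c : ℝ := a / ((k + 2) * 2 ^ (2 * k + 2)) with hc
  have hc0 : 0 < c := by positivity
  set C₁ : ℝ := 2 ^ (k + 2) * (k + 2) with hC₁
  have hC₁0 : 0 < C₁ := by positivity
  refine ⟨C₁ * ((k + 2) * (K * c ^ (-((k + 1 : ℝ) / k)))), by positivity, fun N s hN hs hss => ?_⟩
  have hN0 : (0 : ℝ) < N := by exact_mod_cast hN
  have hk0 : (0 : ℝ) < k := by exact_mod_cast hk
  have hs' := h.mono hs hss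
  have hcont : ∀ i : Fin (k + 2), Continuous fun y : Fin (k + 2) → ℝ =>
      Real.exp (-(c * N * s * cornerSum fun j => y (i.succAbove j))) := by
    intro i
    have := continuous_cornerSum (n := k + 1)
    fun_prop
  have hterm : ∀ i : Fin (k + 2), ∫ y in cornerBox (k + 2) (s / 2),
      Real.exp (-(c * N * s * cornerSum fun j => y (i.succAbove j))) ≤
      K * c ^ (-((k + 1 : ℝ) / k)) *
        ((N : ℝ) ^ (-((k + 1 : ℝ) / k)) * s ^ (-(1 / (k : ℝ)))) := by
    intro i
    refine (hKle i (cornerBox (k + 2) (s / 2)) (c * N * s) (s / 2) subset_rfl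
      (measurableSet_cornerBox _ _) (by positivity) (by positivity)).trans ?_
    rw [Real.mul_rpow (by positivity) hs.le, Real.mul_rpow hc0.le hN0.le]
    have e : s * s ^ (-((k + 1 : ℝ) / k)) = s ^ (-(1 / (k : ℝ))) := by
      nth_rewrite 1 [← Real.rpow_one s]
      rw [← Real.rpow_add hs]
      congr 1
      field_simp
      ring
    calc K * (s / 2) * (c ^ (-((k + 1 : ℝ) / k)) * (N : ℝ) ^ (-((k + 1 : ℝ) / k)) *
          s ^ (-((k + 1 : ℝ) / k)))
        = 1 / 2 * (K * c ^ (-((k + 1 : ℝ) / k)) * ((N : ℝ) ^ (-((k + 1 : ℝ) / k)) *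
          (s * s ^ (-((k + 1 : ℝ) / k))))) := by ring
      _ ≤ 1 * (K * c ^ (-((k + 1 : ℝ) / k)) * ((N : ℝ) ^ (-((k + 1 : ℝ) / k)) *
          (s * s ^ (-((k + 1 : ℝ) / k))))) := by gcongr; norm_num
      _ = _ := by rw [e, one_mul]
  calc ∫ y in cornerBox (k + 2) (s / 2),
        (localMissProb μ (cornerBox (k + 2) s) N y - missProb μ N y)
      ≤ ∫ y in cornerBox (k + 2) (s / 2), C₁ * ∑ i : Fin (k + 2),
        Real.exp (-(c * N * s * cornerSum fun j => y (i.succAbove j))) := by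
        refine setIntegral_mono_on
          ((integrableOn_localMissProb μ (measurableSet_cornerBox _ _) N
            (volume_cornerBox_lt_top _ _)).sub
            (integrableOn_missProb μ N (volume_cornerBox_lt_top _ _)))
          (integrableOn_of_continuous_of_subset_cornerBox
            ((continuous_finsetSum _ fun i _ => hcont i).const_mul _) subset_rfl)
          (measurableSet_cornerBox _ _) fun y hy => ?_
        exact hs'.localMissProb_sub_missProb_le hk ha ha0 hy N
    _ = C₁ * ∑ i : Fin (k + 2), ∫ y in cornerBox (k + 2) (s / 2),
        Real.exp (-(c * N * s * cornerSum fun j => y (i.succAbove j))) := by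
        rw [integral_const_mul, integral_finsetSum _ fun i _ =>
          integrableOn_of_continuous_of_subset_cornerBox (hcont i) subset_rfl]
    _ ≤ C₁ * ∑ i : Fin (k + 2), K * c ^ (-((k + 1 : ℝ) / k)) *
        ((N : ℝ) ^ (-((k + 1 : ℝ) / k)) * s ^ (-(1 / (k : ℝ)))) := by
        gcongr with i
        exact hterm i
    _ = _ := by
        rw [Finset.sum_const, Finset.card_univ, Fintype.card_fin, nsmul_eq_mul]
        push_cast
        ring

/-- Comparison of a corner measure with the normalised corner measure. -/
theorem IsCornerMeasure.exists_abs_setIntegral_sub_le (hk : 1 ≤ k) {s₀ : ℝ}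
    {μ : Measure (Fin (k + 2) → ℝ)} (h : IsCornerMeasure α s₀ μ) :
    ∃ C : ℝ, 0 < C ∧ ∀ (N m : ℕ) (s : ℝ), 1 ≤ N → 1 ≤ m → 0 < s → s ≤ s₀ →
      N * ((∑ i, α i) * s ^ (k + 1)) = m →
      |(∫ y in cornerBox (k + 2) (s₀ / 2), missProb μ N y) - s ^ (k + 2) * cornerMiss α m| ≤
        C * ((N : ℝ) ^ (-((k + 2 : ℝ) / (k + 1))) * (m : ℝ) ^ (-(1 / ((k + 1 : ℝ) * k)))) := by
  have := h.prob
  obtain ⟨C₁, hC₁, h₁⟩ := h.exists_setIntegral_sdiff_le hk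
  obtain ⟨C₂, hC₂, h₂⟩ := h.exists_setIntegral_localMissProb_sub_le hk
  obtain ⟨C₃, hC₃, h₃⟩ := exists_abs_binomial_cornerMiss_sub_le hk h.pos
  have hA := sum_alpha_pos h.pos
  set A := ∑ i, α i with hAdef
  set r : ℝ := (k + 2 : ℝ) / (k + 1) with hr
  set γ : ℝ := 1 / ((k + 1 : ℝ) * k) with hγ
  have hk0 : (0 : ℝ) < k := by exact_mod_cast hk
  have hk1 : (1 : ℝ) ≤ k := by exact_mod_cast hk
  refine ⟨(C₁ + C₂) * A ^ γ + C₃ * A ^ (-r), by positivity, fun N m s hN hm hs hss hNm => ?_⟩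
  have hN0 : (0 : ℝ) < N := by exact_mod_cast hN
  have hm0 : (0 : ℝ) < m := by exact_mod_cast hm
  have hs' := h.mono hs hss
  have hspow : s ^ (k + 1) = m / (A * N) := by
    field_simp
    linarith
  have hpow : ∀ t : ℝ, s ^ t = ((m : ℝ) / (A * N)) ^ (t / (k + 1)) := by
    intro t
    rw [← hspow, ← Real.rpow_natCast, ← Real.rpow_mul hs.le]
    congr 1
    push_cast
    field_simp
  -- The quotient m/N is the mass of a cube under a probability measure.
  have hmN : m ≤ N := by
    have h1 : μ (cornerBox (k + 2) s) ≤ 1 := prob_le_one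
    rw [hs'.measure_cornerBox, ENNReal.ofReal_le_one] at h1
    have : (m : ℝ) ≤ N := by
      rw [← hNm]
      exact mul_le_of_le_one_right hN0.le h1
    exact_mod_cast this
  have hsplit : ∫ y in cornerBox (k + 2) (s₀ / 2), missProb μ N y =
      (∫ y in cornerBox (k + 2) (s₀ / 2) \ cornerBox (k + 2) (s / 2), missProb μ N y) +
      ∫ y in cornerBox (k + 2) (s / 2), missProb μ N y := by
    have hsub : cornerBox (k + 2) (s / 2) ⊆ cornerBox (k + 2) (s₀ / 2) :=
      cornerBox_mono (by linarith)
    rw [← setIntegral_union Set.disjoint_sdiff_left (measurableSet_cornerBox _ _)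
      ((integrableOn_missProb μ N (volume_cornerBox_lt_top _ _)).mono_set Set.sdiff_subset)
      (integrableOn_missProb μ N (volume_cornerBox_lt_top _ _)), Set.sdiff_union_of_subset hsub]
  have hloc := hs'.setIntegral_localMissProb N rfl
  rw [← hAdef] at hloc
  have h2 := h₂ N s hN hs hss
  rw [integral_sub (integrableOn_localMissProb μ (measurableSet_cornerBox _ _) N
    (volume_cornerBox_lt_top _ _)) (integrableOn_missProb μ N (volume_cornerBox_lt_top _ _)),
    hloc] at h2
  have h2' : ∫ y in cornerBox (k + 2) (s / 2), missProb μ N y ≤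
      ∫ y in cornerBox (k + 2) (s / 2), localMissProb μ (cornerBox (k + 2) s) N y :=
    setIntegral_mono (integrableOn_missProb μ N (volume_cornerBox_lt_top _ _))
      (integrableOn_localMissProb μ (measurableSet_cornerBox _ _) N
        (volume_cornerBox_lt_top _ _)) fun y => missProb_le_localMissProb μ _ N y
  rw [hloc] at h2'
  have h1 := h₁ N s hN hs
  have h1' : 0 ≤ ∫ y in cornerBox (k + 2) (s₀ / 2) \ cornerBox (k + 2) (s / 2), missProb μ N y :=
    integral_nonneg fun y => missProb_nonneg _ _ _
  have h3 := h₃ N m _ hm hmN hNm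
  -- Substituting s^(k+1) = m/(A N) turns both localisation errors into the target order.
  have e1 : (N : ℝ) ^ (-((k + 1 : ℝ) / k)) * s ^ (-(1 / (k : ℝ))) =
      A ^ γ * ((N : ℝ) ^ (-r) * (m : ℝ) ^ (-γ)) := by
    have e : -(1 / (k : ℝ)) / (k + 1) = -γ := by rw [hγ]; field_simp
    have e' : -((k + 1 : ℝ) / k) = -r - γ := by rw [hr, hγ]; field_simp; ring
    rw [hpow, e, Real.div_rpow hm0.le (by positivity), Real.mul_rpow hA.le hN0.le, e',
      Real.rpow_sub hN0, Real.rpow_neg hA.le, Real.rpow_neg hN0.le γ]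
    field_simp
  have e2 : s ^ (k + 2) * (m : ℝ) ^ (-(1 / 2 + r)) ≤
      A ^ (-r) * ((N : ℝ) ^ (-r) * (m : ℝ) ^ (-γ)) := by
    have e : ((k + 2 : ℕ) : ℝ) / (k + 1) = r := by push_cast; rfl
    rw [← Real.rpow_natCast, hpow, e, Real.div_rpow hm0.le (by positivity),
      Real.mul_rpow hA.le hN0.le, Real.rpow_neg hA.le, Real.rpow_neg hN0.le, neg_add,
      Real.rpow_add hm0, Real.rpow_neg hm0.le r]
    -- The binomial error is no worse than the localisation error, since γ ≤ 1/2 for k ≥ 1.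
    have hle : (m : ℝ) ^ (-(1 / 2 : ℝ)) ≤ (m : ℝ) ^ (-γ) := by
      refine Real.rpow_le_rpow_of_exponent_le (by exact_mod_cast hm) ?_
      rw [neg_le_neg_iff, hγ]
      refine one_div_le_one_div_of_le (by norm_num) ?_
      nlinarith
    have hne : (m : ℝ) ^ r ≠ 0 := by positivity
    calc (m : ℝ) ^ r / (A ^ r * (N : ℝ) ^ r) * ((m : ℝ) ^ (-(1 / 2 : ℝ)) * ((m : ℝ) ^ r)⁻¹)
        = (A ^ r)⁻¹ * (((N : ℝ) ^ r)⁻¹ * (m : ℝ) ^ (-(1 / 2 : ℝ))) := by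
          field_simp
      _ ≤ _ := by gcongr
  rw [e1] at h1 h2
  have h3' : |s ^ (k + 2) * (∑ j ∈ Finset.range (N + 1), (N.choose j : ℝ) *
      (A * s ^ (k + 1)) ^ j * (1 - A * s ^ (k + 1)) ^ (N - j) * cornerMiss α j) -
      s ^ (k + 2) * cornerMiss α m| ≤
      C₃ * (A ^ (-r) * ((N : ℝ) ^ (-r) * (m : ℝ) ^ (-γ))) := by
    rw [← mul_sub, abs_mul, abs_of_nonneg (by positivity)]
    calc _ ≤ s ^ (k + 2) * (C₃ * (m : ℝ) ^ (-(1 / 2 + r))) := by gcongr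
      _ = C₃ * (s ^ (k + 2) * (m : ℝ) ^ (-(1 / 2 + r))) := by ring
      _ ≤ _ := by gcongr
  rw [hsplit]
  rw [abs_le] at h3' ⊢
  have hpos : 0 ≤ A ^ γ * ((N : ℝ) ^ (-r) * (m : ℝ) ^ (-γ)) := by positivity
  have hp1 : 0 ≤ C₁ * (A ^ γ * ((N : ℝ) ^ (-r) * (m : ℝ) ^ (-γ))) := by positivity
  have hp2 : 0 ≤ C₂ * (A ^ γ * ((N : ℝ) ^ (-r) * (m : ℝ) ^ (-γ))) := by positivity
  have eexp : ((C₁ + C₂) * A ^ γ + C₃ * A ^ (-r)) * ((N : ℝ) ^ (-r) * (m : ℝ) ^ (-γ)) =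
      C₁ * (A ^ γ * ((N : ℝ) ^ (-r) * (m : ℝ) ^ (-γ))) +
      C₂ * (A ^ γ * ((N : ℝ) ^ (-r) * (m : ℝ) ^ (-γ))) +
      C₃ * (A ^ (-r) * ((N : ℝ) ^ (-r) * (m : ℝ) ^ (-γ))) := by ring
  rw [eexp]
  constructor <;> linarith [h3'.1, h3'.2]

end CornerAsymptotics

/-! ### Existence and positivity of the limit at a corner -/

section CornerAsymptotics

theorem stdCorner_normalize {n : ℕ} {α : Fin (n + 1) → ℝ} (h : ∀ i, 0 < α i) :
    stdCorner (fun i => (∑ i, α i)⁻¹ * α i) = stdCorner α := by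
  have hA := sum_alpha_pos h
  rw [stdCorner, stdCorner, ← Finset.mul_sum, inv_mul_cancel₀ hA.ne', inv_one, ENNReal.ofReal_one,
    one_smul, Finset.smul_sum]
  refine Finset.sum_congr rfl fun i _ => ?_
  rw [ENNReal.ofReal_mul (inv_pos.2 hA).le, mul_smul]

/-- If no sample point falls into the cube of side t = (n+1)ρ, every sample point has coordinate sum
above t, while the sum for `y` is at most t; so `y` is missed. -/
theorem half_pow_le_missProb {n : ℕ} {α : Fin (n + 1) → ℝ} (h : ∀ i, 0 < α i) {ρ : ℝ}
    (hρ : 0 < ρ) (hρ1 : (n + 1) * ρ ≤ 1) (m : ℕ) {y : Fin (n + 1) → ℝ}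
    (hy : y ∈ cornerBox (n + 1) ρ) :
    (1 - ((n + 1) * ρ) ^ n) ^ m ≤ missProb (stdCorner α) m y := by
  have hstd := isCornerMeasure_stdCorner h
  have := hstd.prob
  have hA := sum_alpha_pos h
  set t : ℝ := (n + 1) * ρ with ht
  have ht0 : 0 < t := by positivity
  have hbox := (hstd.mono ht0 hρ1).measure_cornerBox
  rw [← Finset.mul_sum, inv_mul_cancel₀ hA.ne', one_mul] at hbox
  have hreal : (stdCorner α).real (cornerBox (n + 1) t) = t ^ n := by
    rw [Measure.real, hbox, ENNReal.toReal_ofReal (by positivity)]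
  have hpi : (Measure.pi fun _ : Fin m => stdCorner α).real
      (Set.univ.pi fun _ => (cornerBox (n + 1) t)ᶜ) = (1 - t ^ n) ^ m := by
    rw [Measure.real, Measure.pi_pi, Finset.prod_const, Finset.card_univ, Fintype.card_fin,
      ENNReal.toReal_pow, ← Measure.real, probReal_compl_eq_one_sub (measurableSet_cornerBox _ _),
      hreal]
  rw [← hpi, missProb]
  refine ENNReal.toReal_mono (measure_ne_top _ _) (measure_mono_ae ?_)
  have hnn : ∀ᵐ x ∂(Measure.pi fun _ : Fin m => stdCorner α), ∀ i, 0 ≤ x i := by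
    rw [eventually_all]
    exact fun i =>
      (Measure.quasiMeasurePreserving_eval (fun _ : Fin m => stdCorner α) i).ae hstd.ae_nonneg
  filter_upwards [hnn] with x hx hmem hconv
  set g : (Fin (n + 1) → ℝ) →ₗ[ℝ] ℝ := ∑ j, LinearMap.proj j with hg
  have hgx : ∀ z, g z = ∑ j, z j := fun z => by simp [hg]
  have hsub : convexHull ℝ (Set.range x) ⊆ {z | t < g z} := by
    refine convexHull_min ?_ (convex_halfSpace_gt g.isLinear _)
    rintro _ ⟨i, rfl⟩
    have hi : x i ∉ cornerBox (n + 1) t := hmem i trivial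
    have : ¬ ∀ j, x i j ≤ t := fun hcon => hi ⟨hx i, hcon⟩
    push Not at this
    obtain ⟨j, hj⟩ := this
    change t < g (x i)
    rw [hgx]
    exact hj.trans_le (Finset.single_le_sum (f := fun j => x i j) (fun j _ => hx i j)
      (Finset.mem_univ j))
  have h1 : t < g y := hsub hconv
  rw [hgx] at h1
  have h2 : ∑ j, y j ≤ ∑ _j : Fin (n + 1), ρ := Finset.sum_le_sum fun j _ => hy.2 j
  rw [Finset.sum_const, Finset.card_univ, Fintype.card_fin, nsmul_eq_mul] at h2
  push_cast at h2
  linarith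

variable {k : ℕ} {α : Fin (k + 2) → ℝ}

theorem exists_le_cornerMiss (h : ∀ i, 0 < α i) :
    ∃ c : ℝ, 0 < c ∧ ∀ m : ℕ, 1 ≤ m → c * (m : ℝ) ^ (-((k + 2 : ℝ) / (k + 1))) ≤
      cornerMiss α m := by
  have hstd := isCornerMeasure_stdCorner h
  have := hstd.prob
  refine ⟨1 / 2 * ((1 / (k + 2)) ^ (k + 2) * (1 / 2 : ℝ) ^ ((k + 2 : ℝ) / (k + 1))),
    by positivity, fun m hm => ?_⟩
  have hm0 : (0 : ℝ) < m := by exact_mod_cast hm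
  have hm1 : (1 : ℝ) ≤ m := by exact_mod_cast hm
  -- The cube of side t has mass 1/(2m), so by Bernoulli's inequality it stays empty with
  -- probability at least 1/2.
  set t : ℝ := (1 / 2 * (m : ℝ)⁻¹) ^ (1 / (k + 1 : ℝ)) with ht
  have ht0 : 0 < t := by positivity
  have hinv : (m : ℝ)⁻¹ ≤ 1 := inv_le_one_of_one_le₀ hm1
  have ht1 : t ≤ 1 := Real.rpow_le_one (by positivity) (by linarith) (by positivity)
  have htk : t ^ (k + 1) = 1 / 2 * (m : ℝ)⁻¹ := by
    rw [ht, ← Real.rpow_natCast, ← Real.rpow_mul (by positivity)]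
    push_cast
    rw [one_div_mul_cancel (by positivity), Real.rpow_one]
  have htk2 : t ^ (k + 2) = (1 / 2 : ℝ) ^ ((k + 2 : ℝ) / (k + 1)) *
      (m : ℝ) ^ (-((k + 2 : ℝ) / (k + 1))) := by
    rw [ht, ← Real.rpow_natCast, ← Real.rpow_mul (by positivity),
      Real.mul_rpow (by norm_num) (by positivity), Real.inv_rpow hm0.le, ← Real.rpow_neg hm0.le]
    push_cast
    congr 2 <;> ring
  set ρ : ℝ := 1 / (k + 2) * t with hρ
  have hρ0 : 0 < ρ := by positivity
  have hρt : (((k + 1 : ℕ) : ℝ) + 1) * ρ = t := by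
    rw [hρ]; push_cast; field_simp; ring
  have hρ2 : ρ ≤ 1 / 2 := by
    have h1 : (1 : ℝ) / (k + 2) ≤ 1 / 2 :=
      one_div_le_one_div_of_le (by norm_num) (by linarith [(Nat.cast_nonneg k : (0:ℝ) ≤ k)])
    calc ρ ≤ 1 / 2 * 1 := mul_le_mul h1 ht1 ht0.le (by norm_num)
      _ = 1 / 2 := by norm_num
  have hmiss : ∀ y ∈ cornerBox (k + 2) ρ, 1 / 2 ≤ missProb (stdCorner α) m y := by
    intro y hy
    refine le_trans ?_ (half_pow_le_missProb h hρ0 (hρt.le.trans ht1) m hy)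
    rw [hρt, htk]
    have hb := one_add_mul_le_pow (a := -(1 / 2 * (m : ℝ)⁻¹)) (by linarith) m
    rw [← sub_eq_add_neg] at hb
    refine le_trans (le_of_eq ?_) hb
    field_simp
    norm_num
  calc _ = volume.real (cornerBox (k + 2) ρ) * (1 / 2) := by
        rw [volume_real_cornerBox _ hρ0.le, hρ, mul_pow, htk2]
        ring
    _ = ∫ y in cornerBox (k + 2) ρ, (1 / 2 : ℝ) := by rw [setIntegral_const, smul_eq_mul]
    _ ≤ ∫ y in cornerBox (k + 2) ρ, missProb (stdCorner α) m y :=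
        setIntegral_mono_on (integrableOn_const (volume_cornerBox_lt_top _ _).ne)
          (integrableOn_missProb _ m (volume_cornerBox_lt_top _ _)) (measurableSet_cornerBox _ _)
          hmiss
    _ ≤ cornerMiss α m :=
        setIntegral_mono_set (integrableOn_missProb _ m (volume_cornerBox_lt_top _ _))
          (Eventually.of_forall fun y => missProb_nonneg _ _ _)
          (cornerBox_mono hρ2).eventuallyLE

/-- The rescaled missed volume of the normalised corner measure converges, with a rate. -/
theorem exists_limit_cornerMiss (hk : 1 ≤ k) (h : ∀ i, 0 < α i) :
    ∃ c C : ℝ, 0 < c ∧ 0 < C ∧ ∀ m : ℕ, 1 ≤ m →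
      |(m : ℝ) ^ ((k + 2 : ℝ) / (k + 1)) * cornerMiss α m - c| ≤
        C * (m : ℝ) ^ (-(1 / ((k + 1 : ℝ) * k))) := by
  have hstd := isCornerMeasure_stdCorner h
  have hA := sum_alpha_pos h
  obtain ⟨C, hC, hCle⟩ := hstd.exists_abs_setIntegral_sub_le hk
  obtain ⟨c₀, hc₀, hc₀le⟩ := exists_le_cornerMiss h
  have hJ : ∀ m, cornerMiss (fun i => (∑ i, α i)⁻¹ * α i) m = cornerMiss α m := fun m => by
    rw [cornerMiss, cornerMiss, stdCorner_normalize h]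
  set r : ℝ := (k + 2 : ℝ) / (k + 1) with hr
  set γ : ℝ := 1 / ((k + 1 : ℝ) * k) with hγ
  have hk0 : (0 : ℝ) < k := by exact_mod_cast hk
  have hγ0 : 0 < γ := by positivity
  set a : ℕ → ℝ := fun m => (m : ℝ) ^ r * cornerMiss α m with ha
  -- The normalised corner is compared with itself: the cube with s^(k+1) = m/N contains m of the N
  -- points on average, and multiplication by N^r turns s^(k+2) into m^r.
  have key : ∀ m N : ℕ, 1 ≤ m → m ≤ N → |a N - a m| ≤ C * (m : ℝ) ^ (-γ) := by
    intro m N hm hmN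
    have hm0 : (0 : ℝ) < m := by exact_mod_cast hm
    have hN0 : (0 : ℝ) < N := by exact_mod_cast hm.trans hmN
    set s : ℝ := ((m : ℝ) / N) ^ (1 / (k + 1 : ℝ)) with hs
    have hs0 : 0 < s := by positivity
    have hs1 : s ≤ 1 := Real.rpow_le_one (by positivity)
      (by rw [div_le_one hN0]; exact_mod_cast hmN) (by positivity)
    have hsk : s ^ (k + 1) = m / N := by
      rw [hs, ← Real.rpow_natCast, ← Real.rpow_mul (by positivity)]
      push_cast
      rw [one_div_mul_cancel (by positivity), Real.rpow_one]
    have hsk2 : s ^ (k + 2) = (m : ℝ) ^ r * (N : ℝ) ^ (-r) := by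
      rw [hs, ← Real.rpow_natCast, ← Real.rpow_mul (by positivity), Real.div_rpow hm0.le hN0.le,
        Real.rpow_neg hN0.le, ← div_eq_mul_inv]
      push_cast
      congr 2 <;> rw [hr] <;> ring
    have h1 := hCle N m s (hm.trans hmN) hm hs0 hs1 (by
      rw [← Finset.mul_sum, inv_mul_cancel₀ hA.ne', one_mul, hsk]
      field_simp)
    rw [hJ, hsk2] at h1
    have e : a N - a m = (N : ℝ) ^ r * ((∫ y in cornerBox (k + 2) (1 / 2),
        missProb (stdCorner α) N y) - (m : ℝ) ^ r * (N : ℝ) ^ (-r) * cornerMiss α m) := by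
      simp only [ha, cornerMiss]
      rw [Real.rpow_neg hN0.le]
      field_simp
    rw [e, abs_mul, abs_of_nonneg (by positivity)]
    calc _ ≤ (N : ℝ) ^ r * (C * ((N : ℝ) ^ (-r) * (m : ℝ) ^ (-γ))) := by gcongr
      _ = C * (m : ℝ) ^ (-γ) := by
        rw [Real.rpow_neg hN0.le]
        field_simp
  have hb : Tendsto (fun m : ℕ => C * (((m + 1 : ℕ) : ℝ)) ^ (-γ)) atTop (nhds 0) := by
    have := (((tendsto_rpow_neg_atTop hγ0).comp tendsto_natCast_atTop_atTop).comp
      (tendsto_add_atTop_nat 1)).const_mul C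
    rw [mul_zero] at this
    exact this
  -- The shift by one avoids m = 0, where the estimate is not available.
  have hcauchy : CauchySeq fun m => a (m + 1) :=
    cauchySeq_of_le_tendsto_0' _ (fun m N hmN => by
      rw [dist_comm, Real.dist_eq]
      exact key (m + 1) (N + 1) (by omega) (by omega)) hb
  obtain ⟨c, hc'⟩ := cauchySeq_tendsto_of_complete hcauchy
  have hc : Tendsto a atTop (nhds c) := (tendsto_add_atTop_iff_nat 1).1 hc'
  refine ⟨c, C, ?_, hC, fun m hm => ?_⟩
  · refine lt_of_lt_of_le hc₀ (ge_of_tendsto hc ?_)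
    filter_upwards [eventually_ge_atTop 1] with m hm
    have hm0 : (0 : ℝ) < m := by exact_mod_cast hm
    have h1 := mul_le_mul_of_nonneg_left (hc₀le m hm) (by positivity : 0 ≤ (m : ℝ) ^ r)
    refine le_trans (le_of_eq ?_) h1
    rw [Real.rpow_neg hm0.le]
    field_simp
  · have h1 : Tendsto (fun N => |a N - a m|) atTop (nhds |c - a m|) := (hc.sub_const _).abs
    rw [abs_sub_comm]
    refine le_of_tendsto h1 ?_
    filter_upwards [eventually_ge_atTop m] with N hN
    exact key m N hm hN

/-- The missed volume near the corner of a corner measure. -/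
theorem IsCornerMeasure.exists_limit (hk : 1 ≤ k) {s₀ : ℝ}
    {μ : Measure (Fin (k + 2) → ℝ)} (h : IsCornerMeasure α s₀ μ) :
    ∃ c : ℝ, 0 < c ∧
      (fun N : ℕ => (N : ℝ) ^ ((k + 2 : ℝ) / (k + 1)) *
        (∫ y in cornerBox (k + 2) (s₀ / 2), missProb μ N y) - c) =O[atTop]
        fun N : ℕ => (N : ℝ) ^ (-(1 / ((k + 1 : ℝ) * k))) := by
  have hA := sum_alpha_pos h.pos
  have hs₀ := h.side_pos
  obtain ⟨C, hC, hCle⟩ := h.exists_abs_setIntegral_sub_le hk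
  obtain ⟨c, C', hc, hC', hcle⟩ := exists_limit_cornerMiss hk h.pos
  set A := ∑ i, α i with hAdef
  set r : ℝ := (k + 2 : ℝ) / (k + 1) with hr
  set γ : ℝ := 1 / ((k + 1 : ℝ) * k) with hγ
  have hk0 : (0 : ℝ) < k := by exact_mod_cast hk
  have hγ0 : 0 < γ := by positivity
  set q : ℝ := A * s₀ ^ (k + 1) with hq
  have hq0 : 0 < q := by positivity
  refine ⟨A ^ (-r) * c, by positivity, IsBigO.of_bound ((C + A ^ (-r) * C') * (q / 2) ^ (-γ)) ?_⟩
  have hlarge : ∀ᶠ N : ℕ in atTop, 2 / q ≤ (N : ℝ) :=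
    tendsto_natCast_atTop_atTop.eventually_ge_atTop _
  filter_upwards [hlarge, eventually_ge_atTop 1] with N hNq hN
  have hN0 : (0 : ℝ) < N := by exact_mod_cast hN
  have hqN : 2 ≤ q * N := by
    rw [div_le_iff₀ hq0] at hNq; linarith
  -- q N is the expected number of points in the full cube. Rounding it down and shrinking the cube
  -- from `s₀` to `s` makes the expected number an exact integer, at least half of q N once q N ≥ 2.
  set m := ⌊q * N⌋₊ with hm
  have hmle : (m : ℝ) ≤ q * N := Nat.floor_le (by positivity)
  have hmlt : q * N < m + 1 := Nat.lt_floor_add_one _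
  have hm1 : 1 ≤ m := Nat.le_floor (by push_cast; linarith)
  have hm0 : (0 : ℝ) < m := by exact_mod_cast hm1
  have hmhalf : q / 2 * N ≤ m := by linarith
  set s : ℝ := ((m : ℝ) / (A * N)) ^ (1 / (k + 1 : ℝ)) with hs
  have hs0 : 0 < s := by positivity
  have hsk : s ^ (k + 1) = m / (A * N) := by
    rw [hs, ← Real.rpow_natCast, ← Real.rpow_mul (by positivity)]
    push_cast
    rw [one_div_mul_cancel (by positivity), Real.rpow_one]
  have hsk2 : s ^ (k + 2) = A ^ (-r) * ((m : ℝ) ^ r * (N : ℝ) ^ (-r)) := by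
    have e : 1 / (k + 1 : ℝ) * ((k + 2 : ℕ) : ℝ) = r := by rw [hr]; push_cast; ring
    rw [hs, ← Real.rpow_natCast, ← Real.rpow_mul (by positivity), e,
      Real.div_rpow hm0.le (by positivity), Real.mul_rpow hA.le hN0.le,
      Real.rpow_neg hN0.le, Real.rpow_neg hA.le]
    field_simp
  have hss : s ≤ s₀ := by
    refine le_of_pow_le_pow_left₀ (n := k + 1) (by omega) hs₀.le ?_
    rw [hsk, div_le_iff₀ (by positivity)]
    calc (m : ℝ) ≤ q * N := hmle
      _ = _ := by rw [hq]; ring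
  have h1 := hCle N m s hN hm1 hs0 hss (by rw [hsk]; field_simp)
  have h2 := hcle m hm1
  have hNr : (N : ℝ) ^ r * (N : ℝ) ^ (-r) = 1 := by
    rw [← Real.rpow_add hN0, add_neg_cancel, Real.rpow_zero]
  set I := ∫ y in cornerBox (k + 2) (s₀ / 2), missProb μ N y with hI
  have e : (N : ℝ) ^ r * I - A ^ (-r) * c = (N : ℝ) ^ r * (I - s ^ (k + 2) * cornerMiss α m) +
      A ^ (-r) * ((m : ℝ) ^ r * cornerMiss α m - c) := by
    rw [hsk2]
    linear_combination (A ^ (-r) * (m : ℝ) ^ r * cornerMiss α m) * hNr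
  have hmγ : (m : ℝ) ^ (-γ) ≤ (q / 2) ^ (-γ) * (N : ℝ) ^ (-γ) := by
    rw [← Real.mul_rpow (by positivity) hN0.le]
    exact Real.rpow_le_rpow_of_nonpos (by positivity) hmhalf (by linarith)
  rw [Real.norm_eq_abs, Real.norm_of_nonneg (by positivity), e]
  calc _ ≤ |(N : ℝ) ^ r * (I - s ^ (k + 2) * cornerMiss α m)| +
        |A ^ (-r) * ((m : ℝ) ^ r * cornerMiss α m - c)| := abs_add_le _ _
    _ ≤ (N : ℝ) ^ r * (C * ((N : ℝ) ^ (-r) * (m : ℝ) ^ (-γ))) +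
        A ^ (-r) * (C' * (m : ℝ) ^ (-γ)) := by
        rw [abs_mul, abs_mul, abs_of_nonneg (by positivity : 0 ≤ (N : ℝ) ^ r),
          abs_of_nonneg (by positivity : 0 ≤ A ^ (-r))]
        gcongr
    _ = (C + A ^ (-r) * C') * (m : ℝ) ^ (-γ) := by
        linear_combination (C * (m : ℝ) ^ (-γ)) * hNr
    _ ≤ (C + A ^ (-r) * C') * ((q / 2) ^ (-γ) * (N : ℝ) ^ (-γ)) := by gcongr
    _ = _ := by ring

end CornerAsymptotics

/-! ### Simple polytopes and their vertex charts -/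

section Polytope

set_option linter.unusedSectionVars false

open scoped RealInnerProductSpace Topology

variable {E : Type*} [NormedAddCommGroup E] [InnerProductSpace ℝ E] [FiniteDimensional ℝ E]

theorem eq_of_inner_eq_of_span_eq_top {S : Set E} (hS : Submodule.span ℝ S = ⊤) {u w : E}
    (h : ∀ a ∈ S, ⟪a, u⟫ = ⟪a, w⟫) : u = w := by
  rw [← sub_eq_zero]
  have h1 : u - w ∈ (Submodule.span ℝ S)ᗮ := by
    rw [Submodule.mem_orthogonal]
    intro a ha
    induction ha using Submodule.span_induction with
    | mem a ha => rw [inner_sub_right, h a ha, sub_self]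
    | zero => simp
    | add a b _ _ ha hb => rw [inner_add_left, ha, hb, add_zero]
    | smul c a _ ha => rw [inner_smul_left, ha, mul_zero]
  simpa [hS] using h1

/-- At an extreme point of a polyhedron, the active constraints span. -/
theorem span_active_eq_top {ι : Type*} {t : Set ι} (ht : t.Finite) (a : ι → E) (b : ι → ℝ) {u : E}
    (hu : u ∈ ({u | ∀ i ∈ t, ⟪a i, u⟫ ≤ b i} : Set E).extremePoints ℝ) :
    Submodule.span ℝ (a '' {i | i ∈ t ∧ ⟪a i, u⟫ = b i}) = ⊤ := by
  by_contra hne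
  set K := Submodule.span ℝ (a '' {i | i ∈ t ∧ ⟪a i, u⟫ = b i}) with hK
  have hKo : Kᗮ ≠ ⊥ := fun h => hne (Submodule.orthogonal_eq_bot_iff.1 h)
  obtain ⟨w, hwK, hw0⟩ := Submodule.exists_mem_ne_zero_of_ne_bot hKo
  have hact : ∀ i ∈ t, ⟪a i, u⟫ = b i → ⟪a i, w⟫ = 0 := fun i hi hb =>
    (Submodule.mem_orthogonal K w).1 hwK _ (Submodule.subset_span ⟨i, ⟨hi, hb⟩, rfl⟩)
  -- Along a direction orthogonal to all active constraints one can move both ways inside the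
  -- polyhedron, which contradicts extremality.
  have hev : ∀ᶠ ε : ℝ in 𝓝 0, ∀ i ∈ t, ⟪a i, u + ε • w⟫ ≤ b i := by
    rw [Set.Finite.eventually_all ht]
    intro i hi
    rcases (hu.1 i hi).eq_or_lt with h | h
    · refine Eventually.of_forall fun ε => ?_
      rw [inner_add_right, inner_smul_right, hact i hi h, mul_zero, add_zero]
      exact h.le
    · have hc : Continuous fun ε : ℝ => ⟪a i, u + ε • w⟫ := by fun_prop
      have := (hc.tendsto 0).eventually_lt_const (by simpa using h : ⟪a i, u + (0 : ℝ) • w⟫ < b i)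
      exact this.mono fun ε hε => hε.le
  have hev2 : ∀ᶠ ε : ℝ in 𝓝 0, ∀ i ∈ t, ⟪a i, u + (-ε) • w⟫ ≤ b i := by
    have : Tendsto (fun ε : ℝ => -ε) (𝓝 0) (𝓝 0) := by simpa using tendsto_neg (0 : ℝ)
    exact this.eventually hev
  obtain ⟨ε, ⟨h1, h2⟩, hε⟩ := ((hev.and hev2).filter_mono nhdsWithin_le_nhds |>.and
    (self_mem_nhdsWithin : Set.Ioi (0 : ℝ) ∈ 𝓝[>] 0)).exists
  have hseg : u ∈ openSegment ℝ (u + ε • w) (u + (-ε) • w) :=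
    ⟨1 / 2, 1 / 2, by norm_num, by norm_num, by norm_num, by module⟩
  have := hu.2 h1 h2 hseg
  rw [add_eq_left, smul_eq_zero] at this
  rcases this with h | h
  · exact (ne_of_gt hε) h
  · exact hw0 h

/-- As the active constraints span, an extreme point is determined by its active set, and there are
only finitely many such sets. -/
theorem finite_extremePoints_polyhedron {ι : Type*} {t : Set ι} (ht : t.Finite) (a : ι → E)
    (b : ι → ℝ) : (({u | ∀ i ∈ t, ⟪a i, u⟫ ≤ b i} : Set E).extremePoints ℝ).Finite := by
  refine Set.Finite.of_finite_image (f := fun u => {i | i ∈ t ∧ ⟪a i, u⟫ = b i})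
    (ht.finite_subsets.subset ?_) ?_
  · rintro _ ⟨u, -, rfl⟩ i hi
    exact hi.1
  · intro u hu w hw huw
    refine eq_of_inner_eq_of_span_eq_top (span_active_eq_top ht a b hu) ?_
    rintro _ ⟨i, hi, rfl⟩
    have hi' : i ∈ {i | i ∈ t ∧ ⟪a i, w⟫ = b i} := by
      have huw : {i | i ∈ t ∧ ⟪a i, u⟫ = b i} = {i | i ∈ t ∧ ⟪a i, w⟫ = b i} := huw
      rw [← huw]; exact hi
    rw [hi.2, hi'.2]

/-- The polar of a set of points with respect to `o`. -/
def polarSet (S : Set E) (o : E) : Set E := {u | ∀ x ∈ S, ⟪x - o, u⟫ ≤ 1}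

variable {S : Set E} {o : E}

theorem inner_le_one_of_mem_convexHull {u : E} (hu : u ∈ polarSet S o) {x : E}
    (hx : x ∈ convexHull ℝ S) : ⟪x - o, u⟫ ≤ 1 := by
  have hconv : Convex ℝ {x : E | ⟪x, u⟫ ≤ 1 + ⟪o, u⟫} := by
    have : {x : E | ⟪x, u⟫ ≤ 1 + ⟪o, u⟫} = {x : E | innerₗ E u x ≤ 1 + ⟪o, u⟫} := by
      ext x; simp [real_inner_comm]
    rw [this]
    exact convex_halfSpace_le (innerₗ E u).isLinear _
  have h := convexHull_min (fun x hx => ?_) hconv hx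
  · rw [inner_sub_left]
    have h : ⟪x, u⟫ ≤ 1 + ⟪o, u⟫ := h
    linarith
  · have := hu x hx
    rw [inner_sub_left] at this
    change ⟪x, u⟫ ≤ 1 + ⟪o, u⟫
    linarith

/-- A ball of radius ρ about `o` inside the hull forces the polar into the ball of radius 2/ρ. -/
theorem isCompact_polarSet (ho : o ∈ interior (convexHull ℝ S)) : IsCompact (polarSet S o) := by
  obtain ⟨ρ, hρ, hball⟩ := Metric.isOpen_iff.1 isOpen_interior o ho
  refine Metric.isCompact_of_isClosed_isBounded ?_ ?_
  · have : polarSet S o = ⋂ x ∈ S, {u | ⟪x - o, u⟫ ≤ 1} := by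
      ext u; simp [polarSet]
    rw [this]
    exact isClosed_biInter fun x _ => isClosed_le (by fun_prop) continuous_const
  · refine (Metric.isBounded_closedBall (x := (0 : E)) (r := 2 / ρ)).subset fun u hu => ?_
    rw [mem_closedBall_zero_iff]
    by_cases hu0 : u = 0
    · rw [hu0, norm_zero]; positivity
    have hn : 0 < ‖u‖ := norm_pos_iff.2 hu0
    have hmem : o + (ρ / 2 / ‖u‖) • u ∈ convexHull ℝ S := by
      refine interior_subset (hball ?_)
      rw [Metric.mem_ball, dist_eq_norm, add_sub_cancel_left, norm_smul,
        Real.norm_of_nonneg (by positivity), div_mul_cancel₀ _ hn.ne']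
      linarith
    have h := inner_le_one_of_mem_convexHull hu hmem
    rw [add_sub_cancel_left, real_inner_smul_left, real_inner_self_eq_norm_sq] at h
    rw [le_div_iff₀ hρ]
    have : ρ / 2 / ‖u‖ * ‖u‖ ^ 2 = ρ / 2 * ‖u‖ := by field_simp
    linarith

theorem convex_polarSet : Convex ℝ (polarSet S o) := by
  have : polarSet S o = ⋂ x ∈ S, {u | innerₗ E (x - o) u ≤ 1} := by
    ext u
    simp only [polarSet, Set.mem_iInter, Set.mem_ofPred_eq, innerₗ_apply_apply]
  rw [this]
  exact convex_iInter₂ fun x _ => convex_halfSpace_le (innerₗ E (x - o)).isLinear _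

/-- The halfspace description of a polytope by the extreme points of its polar. -/
theorem mem_convexHull_of_forall_extremePoints (hS : S.Finite)
    (ho : o ∈ interior (convexHull ℝ S)) {x : E}
    (hx : ∀ u ∈ (polarSet S o).extremePoints ℝ, ⟪x - o, u⟫ ≤ 1) : x ∈ convexHull ℝ S := by
  by_contra hout
  obtain ⟨f, β, h1, h2⟩ := geometric_hahn_banach_closed_point (convex_convexHull ℝ S)
    (hS.isCompact_convexHull ℝ).isClosed hout
  set w : E := (InnerProductSpace.toDual ℝ E).symm f with hw
  have hf : ∀ z, f z = ⟪z, w⟫ := fun z => by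
    rw [real_inner_comm, hw, InnerProductSpace.toDual_symm_apply]
  have hδ : 0 < β - f o := by
    have := h1 o (interior_subset ho)
    linarith
  -- The separating functional, normalised at `o`, belongs to the polar. By Krein–Milman its
  -- inequality at `x` follows from those of the extreme points, a contradiction.
  have hu : (β - f o)⁻¹ • w ∈ polarSet S o := by
    intro z hz
    have := h1 z (subset_convexHull ℝ S hz)
    rw [real_inner_smul_right, inner_sub_left, ← hf, ← hf, inv_mul_le_iff₀ hδ]
    linarith
  have hmem : (β - f o)⁻¹ • w ∈ {u : E | innerₗ E (x - o) u ≤ 1} := by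
    have hcl : closure (convexHull ℝ ((polarSet S o).extremePoints ℝ)) ⊆
        {u : E | innerₗ E (x - o) u ≤ 1} := by
      refine closure_minimal (convexHull_min (fun u hu => ?_)
        (convex_halfSpace_le (innerₗ E (x - o)).isLinear _)) ?_
      · exact hx u hu
      · exact isClosed_le (LinearMap.continuous_of_finiteDimensional _) continuous_const
    rw [closure_convexHull_extremePoints (isCompact_polarSet ho) convex_polarSet] at hcl
    exact hcl hu
  simp only [Set.mem_ofPred_eq, innerₗ_apply_apply] at hmem
  rw [real_inner_smul_right, inner_sub_left, ← hf, ← hf, inv_mul_le_iff₀ hδ] at hmem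
  linarith

/-- The face of the polytope where a polar functional attains the value one. -/
def polarFace (S : Set E) (o u : E) : Set E := {x | x ∈ convexHull ℝ S ∧ ⟪x - o, u⟫ = 1}

theorem polarSet_span (hS : S.Finite) {u : E} (hu : u ∈ (polarSet S o).extremePoints ℝ) :
    Submodule.span ℝ ((fun x => x - o) '' {x | x ∈ S ∧ ⟪x - o, u⟫ = 1}) = ⊤ :=
  span_active_eq_top hS (fun x => x - o) (fun _ => 1) hu

theorem finite_extremePoints_polarSet (hS : S.Finite) :
    ((polarSet S o).extremePoints ℝ).Finite :=
  finite_extremePoints_polyhedron hS (fun x => x - o) fun _ => 1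

theorem polarFace_nonempty [Nontrivial E] (hS : S.Finite) {u : E}
    (hu : u ∈ (polarSet S o).extremePoints ℝ) :
    ∃ x ∈ S, x ∈ polarFace S o u := by
  by_contra! hcon
  have h := polarSet_span hS hu
  have hempty : {x | x ∈ S ∧ ⟪x - o, u⟫ = 1} = ∅ := by
    ext x
    simp only [Set.mem_ofPred_eq, Set.mem_empty_iff_false, iff_false]
    exact fun hx => hcon x hx.1 ⟨subset_convexHull ℝ S hx.1, hx.2⟩
  rw [hempty, Set.image_empty, Submodule.span_empty] at h
  exact bot_ne_top h

theorem isExposed_polarFace {u : E} (hu : u ∈ polarSet S o) :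
    IsExposed ℝ (convexHull ℝ S) (polarFace S o u) := by
  rintro ⟨x₀, hx₀⟩
  refine ⟨InnerProductSpace.toDual ℝ E u, ?_⟩
  ext x
  simp only [polarFace, Set.mem_ofPred_eq, InnerProductSpace.toDual_apply_apply]
  constructor
  · rintro ⟨hx, h1⟩
    refine ⟨hx, fun y hy => ?_⟩
    have := inner_le_one_of_mem_convexHull hu hy
    rw [inner_sub_left] at this h1
    rw [real_inner_comm y u, real_inner_comm x u]
    linarith
  · rintro ⟨hx, h1⟩
    refine ⟨hx, le_antisymm (inner_le_one_of_mem_convexHull hu hx) ?_⟩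
    have h2 := h1 x₀ hx₀.1
    have h3 := hx₀.2
    rw [inner_sub_left] at h3 ⊢
    rw [real_inner_comm x₀ u, real_inner_comm x u] at h2
    linarith

theorem polarFace_injOn (hS : S.Finite) :
    Set.InjOn (polarFace S o) ((polarSet S o).extremePoints ℝ) := by
  intro u hu w hw huw
  refine eq_of_inner_eq_of_span_eq_top (polarSet_span hS hu) ?_
  rintro _ ⟨x, hx, rfl⟩
  have hxu : x ∈ polarFace S o u := ⟨subset_convexHull ℝ S hx.1, hx.2⟩
  rw [huw] at hxu
  change ⟪x - o, u⟫ = ⟪x - o, w⟫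
  rw [hx.2, hxu.2]

/-- The direction space of the face is orthogonal to `u` and so does not contain x₀ - o. Adding this
one vector yields all active vectors, which span: the codimension is one. -/
theorem finrank_vectorSpan_polarFace [Nontrivial E] (hS : S.Finite) {u : E}
    (hu : u ∈ (polarSet S o).extremePoints ℝ) :
    Module.finrank ℝ (vectorSpan ℝ (polarFace S o u)) + 1 = Module.finrank ℝ E := by
  obtain ⟨x₀, hx₀S, hx₀⟩ := polarFace_nonempty hS hu
  set V := vectorSpan ℝ (polarFace S o u) with hV
  have hperp : ∀ v ∈ V, ⟪v, u⟫ = 0 := by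
    intro v hv
    rw [hV, vectorSpan_def] at hv
    induction hv using Submodule.span_induction with
    | mem v hv =>
      obtain ⟨x, hx, y, hy, rfl⟩ := hv
      have h1 := hx.2
      have h2 := hy.2
      rw [inner_sub_left] at h1 h2
      change ⟪x - y, u⟫ = 0
      rw [inner_sub_left]
      linarith
    | zero => simp
    | add a b _ _ ha hb => rw [inner_add_left, ha, hb, add_zero]
    | smul c a _ ha => rw [inner_smul_left, ha, mul_zero]
  have hnot : x₀ - o ∉ V := fun h => by
    have := hperp _ h
    rw [hx₀.2] at this
    exact one_ne_zero this
  have hsup : V ⊔ Submodule.span ℝ {x₀ - o} = ⊤ := by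
    rw [eq_top_iff, ← polarSet_span hS hu, Submodule.span_le]
    rintro _ ⟨x, hx, rfl⟩
    have hxf : x ∈ polarFace S o u := ⟨subset_convexHull ℝ S hx.1, hx.2⟩
    have e : x - o = (x -ᵥ x₀) + (x₀ - o) := by rw [vsub_eq_sub]; abel
    change x - o ∈ _
    rw [e]
    exact Submodule.add_mem_sup (vsub_mem_vectorSpan ℝ hxf hx₀)
      (Submodule.mem_span_singleton_self _)
  have hne : x₀ - o ≠ 0 := fun h => hnot (h ▸ V.zero_mem)
  have hinf : V ⊓ Submodule.span ℝ {x₀ - o} = ⊥ := by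
    rw [← disjoint_iff, Submodule.disjoint_span_singleton' hne]
    exact hnot
  have := Submodule.finrank_sup_add_finrank_inf_eq V (Submodule.span ℝ {x₀ - o})
  rw [hsup, hinf, finrank_top, finrank_bot, finrank_span_singleton hne] at this
  omega

/-- The constraints of the polytope that are active at a point. -/
def activeSet (S : Set E) (o v : E) : Set E :=
  {u | u ∈ (polarSet S o).extremePoints ℝ ∧ ⟪v - o, u⟫ = 1}

theorem convexHull_eq_polyhedron (hS : S.Finite) (ho : o ∈ interior (convexHull ℝ S)) :
    convexHull ℝ S = {x | ∀ u ∈ (polarSet S o).extremePoints ℝ, ⟪u, x⟫ ≤ 1 + ⟪u, o⟫} := by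
  ext x
  constructor
  · intro hx u hu
    have := inner_le_one_of_mem_convexHull hu.1 hx
    rw [inner_sub_left, real_inner_comm, real_inner_comm u o] at this
    linarith
  · intro hx
    refine mem_convexHull_of_forall_extremePoints hS ho fun u hu => ?_
    have := hx u hu
    rw [inner_sub_left, real_inner_comm, real_inner_comm u o]
    linarith

theorem span_activeSet (hS : S.Finite) (ho : o ∈ interior (convexHull ℝ S)) {v : E}
    (hv : v ∈ (convexHull ℝ S).extremePoints ℝ) :
    Submodule.span ℝ (activeSet S o v) = ⊤ := by
  rw [convexHull_eq_polyhedron hS ho] at hv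
  have h := span_active_eq_top (finite_extremePoints_polarSet hS) id (fun u => 1 + ⟪u, o⟫) hv
  rw [Set.image_id] at h
  have e : activeSet S o v =
      {u | u ∈ (polarSet S o).extremePoints ℝ ∧ ⟪id u, v⟫ = 1 + ⟪u, o⟫} := by
    ext u
    simp only [activeSet, Set.mem_ofPred_eq, id]
    rw [inner_sub_left, real_inner_comm, real_inner_comm u o, sub_eq_iff_eq_add]
  rw [e]
  exact h

/-- A linear isomorphism is a vertex chart if it maps the polytope, seen from the vertex, into the
orthant, and onto it near the vertex. -/
structure IsVertexChart {n : ℕ} (P : Set E) (v : E) (L : E ≃L[ℝ] (Fin n → ℝ)) : Prop where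
  nonneg : ∀ x ∈ P, 0 ≤ L (x - v)
  mem : ∀ᶠ x in 𝓝 v, 0 ≤ L (x - v) → x ∈ P

/-- The active normals at a vertex span, so at most n of them means exactly n, a basis. Their
negatives serve as coordinates; the inactive constraints are strict at `v` and hold in a
neighbourhood. -/
theorem exists_isVertexChart {n : ℕ} (hn : Module.finrank ℝ E = n) (hS : S.Finite)
    (ho : o ∈ interior (convexHull ℝ S)) {v : E} (hv : v ∈ (convexHull ℝ S).extremePoints ℝ)
    (hcard : (activeSet S o v).encard ≤ n) :
    ∃ L : E ≃L[ℝ] (Fin n → ℝ), IsVertexChart (convexHull ℝ S) v L ∧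
      ∀ u ∈ activeSet S o v, ∃ j, ∀ w, L w j = -⟪w, u⟫ := by
  have hfin : (activeSet S o v).Finite :=
    (finite_extremePoints_polarSet hS).subset fun u hu => hu.1
  have hspan := span_activeSet hS ho hv
  have : Fintype (activeSet S o v) := hfin.fintype
  have hge : n ≤ Fintype.card (activeSet S o v) := by
    have h1 := finrank_range_le_card (R := ℝ) ((↑) : activeSet S o v → E)
    rw [Set.finrank, Subtype.range_coe, hspan, finrank_top, hn] at h1
    exact h1
  have hle : Fintype.card (activeSet S o v) ≤ n := by
    rw [← Set.toFinset_card]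
    rw [Set.encard_eq_coe_toFinset_card] at hcard
    exact_mod_cast hcard
  have e : activeSet S o v ≃ Fin n := Fintype.equivFinOfCardEq (le_antisymm hle hge)
  set f : E →ₗ[ℝ] (Fin n → ℝ) := LinearMap.pi fun j => -(innerₗ E (e.symm j : E)) with hf
  have hfa : ∀ w j, f w j = -⟪w, (e.symm j : E)⟫ := fun w j => by
    simp [hf, real_inner_comm]
  have hinj : Function.Injective f := by
    intro w w' hww
    refine eq_of_inner_eq_of_span_eq_top hspan fun u hu => ?_
    have := congrFun hww (e ⟨u, hu⟩)
    rw [hfa, hfa, Equiv.symm_apply_apply] at this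
    rw [real_inner_comm, real_inner_comm w' u]
    linarith
  set L := (LinearEquiv.ofInjectiveOfFinrankEq f hinj
    (by rw [hn, Module.finrank_fin_fun])).toContinuousLinearEquiv with hL
  have hLa : ∀ w j, L w j = -⟪w, (e.symm j : E)⟫ := fun w j => hfa w j
  refine ⟨L, ⟨fun x hx j => ?_, ?_⟩, fun u hu => ⟨e ⟨u, hu⟩, fun w => ?_⟩⟩
  · have h1 := inner_le_one_of_mem_convexHull (e.symm j).2.1.1 hx
    have h2 := (e.symm j).2.2
    rw [hLa, Pi.zero_apply]
    rw [inner_sub_left] at h1 h2 ⊢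
    linarith
  · have hev : ∀ᶠ x in 𝓝 v, ∀ u ∈ (polarSet S o).extremePoints ℝ, ⟪v - o, u⟫ ≠ 1 →
        ⟪x - o, u⟫ ≤ 1 := by
      rw [Set.Finite.eventually_all (finite_extremePoints_polarSet hS)]
      intro u hu
      by_cases h1 : ⟪v - o, u⟫ = 1
      · exact Eventually.of_forall fun x hx => absurd h1 hx
      · have hlt : ⟪v - o, u⟫ < 1 :=
          lt_of_le_of_ne (inner_le_one_of_mem_convexHull hu.1 hv.1) h1
        have hc : Continuous fun x : E => ⟪x - o, u⟫ := by fun_prop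
        filter_upwards [(hc.tendsto v).eventually_lt_const hlt] with x hx _
        exact hx.le
    filter_upwards [hev] with x hx h0
    refine mem_convexHull_of_forall_extremePoints hS ho fun u hu => ?_
    by_cases h1 : ⟪v - o, u⟫ = 1
    · have hmem : u ∈ activeSet S o v := ⟨hu, h1⟩
      have h2 : 0 ≤ -⟪x - v, u⟫ := by
        have := h0 (e ⟨u, hmem⟩)
        rwa [hLa, Equiv.symm_apply_apply] at this
      rw [inner_sub_left] at h1 h2 ⊢
      linarith
    · exact hx u hu h1
  · rw [hLa, Equiv.symm_apply_apply]

/-- At a boundary point some constraint is tight, for otherwise all would hold nearby. The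
corresponding face is compact and has an extreme point, which is a vertex of the polytope. -/
theorem exists_vertex_of_mem_frontier [Nontrivial E] (hS : S.Finite)
    (ho : o ∈ interior (convexHull ℝ S)) {x : E} (hx : x ∈ frontier (convexHull ℝ S)) :
    ∃ v ∈ (convexHull ℝ S).extremePoints ℝ, ∃ u ∈ activeSet S o v, ⟪x - v, u⟫ = 0 := by
  have hcomp := hS.isCompact_convexHull ℝ
  have hxP : x ∈ convexHull ℝ S := hcomp.isClosed.frontier_subset hx
  have hex : ∃ u ∈ (polarSet S o).extremePoints ℝ, ⟪x - o, u⟫ = 1 := by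
    by_contra! hcon
    have hev : ∀ᶠ z in 𝓝 x, ∀ u ∈ (polarSet S o).extremePoints ℝ, ⟪z - o, u⟫ ≤ 1 := by
      rw [Set.Finite.eventually_all (finite_extremePoints_polarSet hS)]
      intro u hu
      have hlt : ⟪x - o, u⟫ < 1 :=
        lt_of_le_of_ne (inner_le_one_of_mem_convexHull hu.1 hxP) (hcon u hu)
      have hc : Continuous fun x : E => ⟪x - o, u⟫ := by fun_prop
      filter_upwards [(hc.tendsto x).eventually_lt_const hlt] with z hz
      exact hz.le
    have : x ∈ interior (convexHull ℝ S) := by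
      rw [mem_interior_iff_mem_nhds]
      filter_upwards [hev] with z hz
      exact mem_convexHull_of_forall_extremePoints hS ho hz
    exact hx.2 this
  obtain ⟨u, hu, hxu⟩ := hex
  have hexp := isExposed_polarFace (S := S) (o := o) hu.1
  obtain ⟨v, hv⟩ := (hexp.isCompact hcomp).extremePoints_nonempty ⟨x, hxP, hxu⟩
  refine ⟨v, hexp.isExtreme.extremePoints_subset_extremePoints hv, u, ⟨hu, hv.1.2⟩, ?_⟩
  have h1 := hv.1.2
  rw [inner_sub_left] at hxu h1 ⊢
  linarith

/-- Simplicity enters only as an upper bound: distinct active extreme points of the polar cut out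
distinct facets through the vertex, so at most n are active. -/
theorem IsSimplePolytope.exists_charts {n : ℕ} (hn : 1 ≤ n) {P : Set (EuclideanSpace ℝ (Fin n))}
    (hP : IsSimplePolytope P) :
    ∃ L : EuclideanSpace ℝ (Fin n) → (EuclideanSpace ℝ (Fin n) ≃L[ℝ] (Fin n → ℝ)),
      (∀ v ∈ P.extremePoints ℝ, IsVertexChart P v (L v)) ∧
      ∀ x ∈ frontier P, ∃ v ∈ P.extremePoints ℝ, ∃ j, L v (x - v) j = 0 := by
  obtain ⟨s, rfl⟩ := hP.exists_finset
  obtain ⟨o, ho⟩ := hP.interior_nonempty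
  have hS : (s : Set (EuclideanSpace ℝ (Fin n))).Finite := s.finite_toSet
  have hfr : Module.finrank ℝ (EuclideanSpace ℝ (Fin n)) = n := finrank_euclideanSpace_fin
  have : Nontrivial (EuclideanSpace ℝ (Fin n)) :=
    Module.nontrivial_of_finrank_pos (R := ℝ) (by rw [hfr]; omega)
  have hcard : ∀ v ∈ (convexHull ℝ (s : Set (EuclideanSpace ℝ (Fin n)))).extremePoints ℝ,
      (activeSet (s : Set (EuclideanSpace ℝ (Fin n))) o v).encard ≤ n := by
    intro v hv
    rw [← hP.encard_facets v hv]
    refine Set.encard_le_encard_of_injOn (f := polarFace (s : Set _) o) ?_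
      ((polarFace_injOn hS).mono fun u hu => hu.1)
    intro u hu
    obtain ⟨x, -, hx⟩ := polarFace_nonempty hS hu.1
    exact ⟨⟨isExposed_polarFace hu.1.1, ⟨x, hx⟩,
      (finrank_vectorSpan_polarFace hS hu.1).trans hfr⟩, hv.1, hu.2⟩
  have hex : ∀ v, ∃ L : EuclideanSpace ℝ (Fin n) ≃L[ℝ] (Fin n → ℝ),
      v ∈ (convexHull ℝ (s : Set (EuclideanSpace ℝ (Fin n)))).extremePoints ℝ →
      IsVertexChart (convexHull ℝ (s : Set _)) v L ∧
        ∀ u ∈ activeSet (s : Set _) o v, ∃ j, ∀ w, L w j = -⟪w, u⟫ := by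
    intro v
    by_cases hv : v ∈ (convexHull ℝ (s : Set (EuclideanSpace ℝ (Fin n)))).extremePoints ℝ
    · obtain ⟨L, hL⟩ := exists_isVertexChart hfr hS ho hv (hcard v hv)
      exact ⟨L, fun _ => hL⟩
    -- A dummy value at points that are not vertices.
    · exact ⟨EuclideanSpace.equiv (Fin n) ℝ, fun h => absurd h hv⟩
  choose L hL using hex
  refine ⟨L, fun v hv => (hL v hv).1, fun x hx => ?_⟩
  obtain ⟨v, hv, u, hu, h0⟩ := exists_vertex_of_mem_frontier hS ho hx
  obtain ⟨j, hj⟩ := (hL v hv).2 u hu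
  exact ⟨v, hv, j, by rw [hj, h0, neg_zero]⟩

end Polytope

/-! ### The boundary measure of a polytope near a vertex -/

section Boundary

open scoped Topology ENNReal NNReal

variable {E : Type*} [NormedAddCommGroup E] [NormedSpace ℝ E] [FiniteDimensional ℝ E]
  [MeasurableSpace E] [BorelSpace E]

set_option linter.unusedSectionVars false

/-- The image of Lebesgue measure under an injective linear map is a multiple of Hausdorff
measure. -/
theorem exists_hausdorffMeasure_image_eq {m : ℕ} (g : (Fin m → ℝ) →L[ℝ] E)
    (hg : Function.Injective g) :
    ∃ c : ℝ, 0 < c ∧ ∀ A : Set (Fin m → ℝ),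
      μH[(m : ℝ)] (g '' A) = ENNReal.ofReal c * volume A := by
  obtain ⟨K, hK, hanti⟩ := LinearMap.exists_antilipschitzWith g.toLinearMap
    (LinearMap.ker_eq_bot.2 hg)
  have hanti : AntilipschitzWith K g := hanti
  have hemb : MeasurableEmbedding g :=
    (hanti.isClosedEmbedding g.uniformContinuous).measurableEmbedding
  set ν : Measure (Fin m → ℝ) := Measure.comap g μH[(m : ℝ)] with hν
  have hνA : ∀ A, ν A = μH[(m : ℝ)] (g '' A) := fun A => hemb.comap_apply _ _
  have hvol : (μH[(m : ℝ)] : Measure (Fin m → ℝ)) = volume := by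
    simpa using hausdorffMeasure_pi_real (ι := Fin m)
  have hupper : ∀ A, ν A ≤ (‖g‖₊ : ℝ≥0∞) ^ (m : ℝ) * volume A := fun A => by
    rw [hνA, ← hvol]
    exact g.lipschitz.hausdorffMeasure_image_le m.cast_nonneg A
  have hlower : ∀ A, volume A ≤ (K : ℝ≥0∞) ^ (m : ℝ) * ν A := fun A => by
    rw [hνA, ← hvol]
    exact hanti.le_hausdorffMeasure_image m.cast_nonneg A
  -- The pulled back Hausdorff measure is translation invariant, and the two Lipschitz bounds make
  -- it locally finite and positive on open sets. Uniqueness of Haar measure then gives the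
  -- constant.
  have hinv : ν.IsAddLeftInvariant := by
    refine ⟨fun z => ?_⟩
    ext A hA
    rw [Measure.map_apply (measurable_const_add z) hA, hνA, hνA]
    have e : g '' ((fun x => z + x) ⁻¹' A) = (fun x => g z + x) ⁻¹' (g '' A) := by
      ext x
      constructor
      · rintro ⟨w, hw, rfl⟩
        exact ⟨z + w, hw, map_add g z w⟩
      · rintro ⟨w, hw, hx⟩
        refine ⟨w - z, by simpa using hw, ?_⟩
        rw [map_sub, hx, add_sub_cancel_left]
    rw [e]
    exact measure_preimage_add _ _ _
  have hfin : IsFiniteMeasureOnCompacts ν := ⟨fun C hC =>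
    (hupper C).trans_lt (ENNReal.mul_lt_top
      (ENNReal.rpow_lt_top_of_nonneg m.cast_nonneg ENNReal.coe_ne_top) hC.measure_lt_top)⟩
  have hpos : ν.IsOpenPosMeasure := ⟨fun U hU hne h0 => by
    have := hlower U
    rw [h0, mul_zero] at this
    exact (hU.measure_pos volume hne).ne' (le_antisymm this zero_le)⟩
  have hhaar : ν.IsAddHaarMeasure := ⟨⟩
  refine ⟨(Measure.addHaarScalarFactor ν volume : ℝ),
    Measure.addHaarScalarFactor_pos_of_isAddHaarMeasure ν volume, fun A => ?_⟩
  have h := congrArg (fun ρ : Measure (Fin m → ℝ) => ρ A)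
    (Measure.isAddLeftInvariant_eq_smul ν volume)
  rw [← hνA, ENNReal.ofReal_coe_nnreal]
  exact h

theorem facetEmbedding_add {m : ℕ} (i : Fin (m + 1)) (z w : Fin m → ℝ) :
    facetEmbedding i (z + w) = facetEmbedding i z + facetEmbedding i w := by
  ext j
  refine i.succAboveCases ?_ (fun j => ?_) j
  · simp [facetEmbedding_self]
  · simp [facetEmbedding_succAbove]

theorem facetEmbedding_smul {m : ℕ} (i : Fin (m + 1)) (c : ℝ) (z : Fin m → ℝ) :
    facetEmbedding i (c • z) = c • facetEmbedding i z := by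
  ext j
  refine i.succAboveCases ?_ (fun j => ?_) j
  · simp [facetEmbedding_self]
  · simp [facetEmbedding_succAbove]

theorem facetEmbedding_removeNth {m : ℕ} {i : Fin (m + 1)} {t : Fin (m + 1) → ℝ} (ht : t i = 0) :
    facetEmbedding i (fun j => t (i.succAbove j)) = t := by
  ext j
  refine i.succAboveCases ?_ (fun j => ?_) j
  · rw [facetEmbedding_self, ht]
  · rw [facetEmbedding_succAbove]

theorem exists_hausdorffMeasure_facet {m : ℕ} (L : E ≃L[ℝ] (Fin (m + 1) → ℝ)) (v : E)
    (i : Fin (m + 1)) :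
    ∃ c : ℝ, 0 < c ∧ ∀ A : Set (Fin (m + 1) → ℝ), MeasurableSet A →
      μH[(m : ℝ)] {x | L (x - v) ∈ A ∧ L (x - v) i = 0} =
        ENNReal.ofReal c * facetMeasure i A := by
  set f : (Fin m → ℝ) →ₗ[ℝ] (Fin (m + 1) → ℝ) :=
    { toFun := facetEmbedding i
      map_add' := facetEmbedding_add i
      map_smul' := facetEmbedding_smul i } with hf
  set g : (Fin m → ℝ) →L[ℝ] E :=
    (L.symm : (Fin (m + 1) → ℝ) →L[ℝ] E).comp f.toContinuousLinearMap with hg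
  have hga : ∀ z, g z = L.symm (facetEmbedding i z) := fun z => rfl
  have hinj : Function.Injective g := by
    intro z w h
    rw [hga, hga, L.symm.injective.eq_iff] at h
    ext j
    have := congrFun h (i.succAbove j)
    rwa [facetEmbedding_succAbove, facetEmbedding_succAbove] at this
  obtain ⟨c, hc, h⟩ := exists_hausdorffMeasure_image_eq g hinj
  refine ⟨c, hc, fun A hA => ?_⟩
  rw [facetMeasure, Measure.map_apply (measurable_facetEmbedding i) hA, ← h,
    ← measure_preimage_add μH[(m : ℝ)] (-v) (g '' _)]
  congr 1
  ext x
  constructor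
  · rintro ⟨h1, h2⟩
    refine ⟨fun j => L (x - v) (i.succAbove j), ?_, ?_⟩
    · change facetEmbedding i _ ∈ A
      rwa [facetEmbedding_removeNth h2]
    · rw [hga, facetEmbedding_removeNth h2, L.symm_apply_apply, sub_eq_neg_add]
  · rintro ⟨z, hz, hx⟩
    have e : L (x - v) = facetEmbedding i z := by
      have : x - v = g z := by rw [hx, sub_eq_neg_add]
      rw [this, hga, L.apply_symm_apply]
    rw [Set.mem_ofPred_eq, e]
    exact ⟨hz, facetEmbedding_self i z⟩

theorem facetMeasure_coord_eq_zero {m : ℕ} {i j : Fin (m + 1)} (hij : j ≠ i) :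
    facetMeasure i {t | t j = 0} = 0 := by
  obtain ⟨j', rfl⟩ := Fin.exists_succAbove_eq hij
  rw [facetMeasure, Measure.map_apply (measurable_facetEmbedding i)
    (measurableSet_eq_fun (measurable_pi_apply _) measurable_const)]
  have : facetEmbedding i ⁻¹' {t | t (i.succAbove j') = 0} = {z | z j' = 0} := by
    ext z
    simp only [Set.mem_preimage, Set.mem_ofPred_eq, facetEmbedding_succAbove]
  rw [this]
  exact Measure.pi_hyperplane _ _ _

end Boundary

/-! ### The boundary law in a vertex chart -/

section VertexMeasure

open scoped Topology ENNReal

variable {n : ℕ} {P : Set (EuclideanSpace ℝ (Fin n))} {v : EuclideanSpace ℝ (Fin n)}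
  {L : EuclideanSpace ℝ (Fin n) ≃L[ℝ] (Fin n → ℝ)}

/-- Near the vertex, positive coordinates characterise interior points: they persist in a
neighbourhood, whereas from a point with a vanishing coordinate one leaves `P` by decreasing that
coordinate. -/
theorem IsVertexChart.exists_side (h : IsVertexChart P v L) :
    ∃ s : ℝ, 0 < s ∧ ∀ x, L (x - v) ∈ cornerBox n s →
      x ∈ P ∧ (x ∈ frontier P ↔ ∃ i, L (x - v) i = 0) := by
  have hc : Tendsto (fun t : Fin n → ℝ => v + L.symm t) (𝓝 0) (𝓝 v) := by
    have : Continuous fun t : Fin n → ℝ => v + L.symm t := by fun_prop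
    simpa using this.tendsto 0
  obtain ⟨ε, hε, hball⟩ := Metric.eventually_nhds_iff.1
    (hc.eventually (eventually_eventually_nhds.2 h.mem))
  refine ⟨ε / 2, half_pos hε, fun x hx => ?_⟩
  have hev : ∀ᶠ y in 𝓝 x, 0 ≤ L (y - v) → y ∈ P := by
    have h1 := @hball (L (x - v)) (by
      rw [dist_zero_right]
      refine lt_of_le_of_lt ((pi_norm_le_iff_of_nonneg (half_pos hε).le).2 fun j => ?_)
        (half_lt_self hε)
      rw [Real.norm_of_nonneg (hx.1 j)]
      exact hx.2 j)
    rwa [L.symm_apply_apply, add_sub_cancel] at h1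
  have hxP : x ∈ P := hev.self_of_nhds hx.1
  refine ⟨hxP, ?_⟩
  constructor
  · intro hfr
    by_contra! hne
    refine hfr.2 (mem_interior_iff_mem_nhds.2 ?_)
    have hpos : ∀ᶠ y in 𝓝 x, ∀ j, 0 < L (y - v) j := by
      refine eventually_all.2 fun j => ?_
      have hcj : Continuous fun y => L (y - v) j :=
        (continuous_apply j).comp (L.continuous.comp (continuous_id.sub continuous_const))
      exact (hcj.tendsto x).eventually_const_lt (lt_of_le_of_ne (hx.1 j) (hne j).symm)
    filter_upwards [hev, hpos] with y h1 h2
    exact h1 fun j => (h2 j).le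
  · rintro ⟨i, hi⟩
    refine ⟨subset_closure hxP, fun hint => ?_⟩
    have hcu : Continuous fun δ : ℝ => x - δ • L.symm (Pi.single i 1) := by fun_prop
    have hmem : ∀ᶠ δ : ℝ in 𝓝 0, x - δ • L.symm (Pi.single i 1) ∈ P := by
      have := hcu.tendsto 0
      rw [zero_smul, sub_zero] at this
      exact this.eventually (mem_interior_iff_mem_nhds.1 hint)
    obtain ⟨δ, hδ, hδ0⟩ := ((hmem.filter_mono nhdsWithin_le_nhds).and
      (self_mem_nhdsWithin : Set.Ioi (0 : ℝ) ∈ 𝓝[>] 0)).exists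
    have h2 := h.nonneg _ hδ i
    have e : x - δ • L.symm (Pi.single i 1) - v = (x - v) - δ • L.symm (Pi.single i 1) :=
      sub_right_comm _ _ _
    rw [e, map_sub, map_smul, L.apply_symm_apply, Pi.sub_apply, hi, Pi.smul_apply,
      Pi.single_eq_same, Pi.zero_apply, smul_eq_mul] at h2
    have : (0 : ℝ) < δ := hδ0
    linarith

theorem uniformBoundary_apply {m : ℕ} (P A : Set (EuclideanSpace ℝ (Fin (m + 1)))) :
    uniformBoundary P A = (μH[(m : ℝ)] (frontier P))⁻¹ * μH[(m : ℝ)] (frontier P ∩ A) := by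
  have : (((m + 1 : ℕ) : ℝ) - 1) = m := by push_cast; ring
  rw [uniformBoundary, ProbabilityTheory.cond_apply isClosed_frontier.measurableSet, this]

theorem IsVertexChart.exists_isCornerMeasure {m : ℕ} {P : Set (EuclideanSpace ℝ (Fin (m + 1)))}
    {v : EuclideanSpace ℝ (Fin (m + 1))}
    {L : EuclideanSpace ℝ (Fin (m + 1)) ≃L[ℝ] (Fin (m + 1) → ℝ)}
    (h : IsVertexChart P v L) (hcl : IsClosed P) (hprob : IsProbabilityMeasure (uniformBoundary P))
    (h0 : μH[(m : ℝ)] (frontier P) ≠ 0) (htop : μH[(m : ℝ)] (frontier P) ≠ ⊤) :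
    ∃ s : ℝ, 0 < s ∧ (∀ x, L (x - v) ∈ cornerBox (m + 1) s → x ∈ P) ∧
      ∃ α, IsCornerMeasure α s ((uniformBoundary P).map fun x => L (x - v)) := by
  obtain ⟨s, hs, hside⟩ := h.exists_side
  choose c hc hcA using exists_hausdorffMeasure_facet L v
  have hΦ : Measurable fun x => L (x - v) :=
    (L.continuous.comp (continuous_id.sub continuous_const)).measurable
  have hH : 0 < (μH[(m : ℝ)] (frontier P)).toReal := ENNReal.toReal_pos h0 htop
  refine ⟨s, hs, fun x hx => (hside x hx).1,
    fun i => (μH[(m : ℝ)] (frontier P)).toReal⁻¹ * c i, ?_, ?_, hs, ?_, ?_⟩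
  · exact Measure.isProbabilityMeasure_map hΦ.aemeasurable
  · exact fun i => mul_pos (inv_pos.2 hH) (hc i)
  · rw [ae_map_iff hΦ.aemeasurable measurableSet_Ici]
    rw [ae_iff, uniformBoundary_apply]
    have : frontier P ∩ {x | ¬ 0 ≤ L (x - v)} = ∅ := by
      ext x
      simp only [Set.mem_inter_iff, Set.mem_ofPred_eq, Set.mem_empty_iff_false, iff_false, not_and,
        not_not]
      exact fun hx => h.nonneg x (hcl.frontier_subset hx)
    rw [this, measure_empty, mul_zero]
  · ext A hA
    have hAB : MeasurableSet (A ∩ cornerBox (m + 1) s) :=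
      hA.inter (measurableSet_cornerBox _ _)
    rw [Measure.restrict_apply hA, Measure.map_apply hΦ hAB, uniformBoundary_apply,
      Measure.finsetSum_apply]
    have hset : frontier P ∩ (fun x => L (x - v)) ⁻¹' (A ∩ cornerBox (m + 1) s) =
        ⋃ i, {x | L (x - v) ∈ A ∩ cornerBox (m + 1) s ∧ L (x - v) i = 0} := by
      ext x
      simp only [Set.mem_inter_iff, Set.mem_preimage, Set.mem_iUnion, Set.mem_ofPred_eq]
      constructor
      · rintro ⟨hx, hxA, hxB⟩
        obtain ⟨i, hi⟩ := (hside x hxB).2.1 hx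
        exact ⟨i, ⟨hxA, hxB⟩, hi⟩
      · rintro ⟨i, ⟨hxA, hxB⟩, hi⟩
        exact ⟨(hside x hxB).2.2 ⟨i, hi⟩, hxA, hxB⟩
    have hmeas : ∀ i, MeasurableSet {x | L (x - v) ∈ A ∩ cornerBox (m + 1) s ∧ L (x - v) i = 0} :=
      fun i => (hΦ hAB).inter (measurableSet_eq_fun ((measurable_pi_apply i).comp hΦ)
        measurable_const)
    rw [hset, measure_iUnion₀ ?_ fun i => (hmeas i).nullMeasurableSet, tsum_fintype,
      Finset.mul_sum]
    · refine Finset.sum_congr rfl fun i _ => ?_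
      rw [hcA i _ hAB, Measure.smul_apply, Measure.restrict_apply hA, smul_eq_mul,
        ENNReal.ofReal_mul (inv_nonneg.2 hH.le), ENNReal.ofReal_inv_of_pos hH,
        ENNReal.ofReal_toReal htop, mul_assoc]
    -- Two different facet pieces meet only where a second coordinate vanishes, a null set of the
    -- hyperplane.
    · intro i j hij
      refine measure_mono_null (t := {x | L (x - v) ∈ {t : Fin (m + 1) → ℝ | t j = 0} ∧ L (x - v) i = 0})
        (fun x hx => ⟨hx.2.2, hx.1.2⟩) ?_
      rw [hcA i _ (measurableSet_eq_fun (measurable_pi_apply _) measurable_const),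
        facetMeasure_coord_eq_zero hij.symm, mul_zero]

theorem hausdorffMeasure_frontier_ne_zero {m : ℕ} {P : Set (EuclideanSpace ℝ (Fin (m + 1)))}
    {v : EuclideanSpace ℝ (Fin (m + 1))}
    {L : EuclideanSpace ℝ (Fin (m + 1)) ≃L[ℝ] (Fin (m + 1) → ℝ)}
    (h : IsVertexChart P v L) : μH[(m : ℝ)] (frontier P) ≠ 0 := by
  obtain ⟨s, hs, hside⟩ := h.exists_side
  obtain ⟨c, hc, hcA⟩ := exists_hausdorffMeasure_facet L v 0
  intro h0
  have h1 := hcA _ (measurableSet_cornerBox (m + 1) s)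
  rw [measure_mono_null (fun x hx => (hside x hx.1).2.2 ⟨0, hx.2⟩) h0,
    facetMeasure_cornerBox _ hs] at h1
  have : 0 < ENNReal.ofReal c * ENNReal.ofReal (s ^ m) :=
    ENNReal.mul_pos (by simpa using hc) (by simpa using pow_pos hs m)
  exact this.ne h1

/-- The boundary is covered by finitely many hyperplane pieces, each of which lies in a bounded cube
of some vertex chart. -/
theorem hausdorffMeasure_frontier_ne_top {m : ℕ} {P : Set (EuclideanSpace ℝ (Fin (m + 1)))}
    (hP : IsCompact P) {V : Set (EuclideanSpace ℝ (Fin (m + 1)))} (hV : V.Finite)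
    (L : EuclideanSpace ℝ (Fin (m + 1)) →
      (EuclideanSpace ℝ (Fin (m + 1)) ≃L[ℝ] (Fin (m + 1) → ℝ)))
    (hL : ∀ v ∈ V, IsVertexChart P v (L v))
    (hfr : ∀ x ∈ frontier P, ∃ v ∈ V, ∃ j, L v (x - v) j = 0) :
    μH[(m : ℝ)] (frontier P) ≠ ⊤ := by
  have hsub : frontier P ⊆ ⋃ v ∈ V, ⋃ j, {x ∈ P | L v (x - v) j = 0} := by
    intro x hx
    obtain ⟨v, hv, j, hj⟩ := hfr x hx
    simp only [Set.mem_iUnion]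
    exact ⟨v, hv, j, hP.isClosed.frontier_subset hx, hj⟩
  refine ((measure_mono hsub).trans_lt ?_).ne
  refine measure_biUnion_lt_top hV fun v hv => ?_
  refine (measure_iUnion_le _).trans_lt ?_
  rw [tsum_fintype]
  refine ENNReal.sum_lt_top.2 fun j _ => ?_
  obtain ⟨c, hc, hcA⟩ := exists_hausdorffMeasure_facet (L v) v j
  have hcont : Continuous fun x => L v (x - v) :=
    (L v).continuous.comp (continuous_id.sub continuous_const)
  obtain ⟨R, hR⟩ := (hP.image hcont).isBounded.subset_closedBall 0
  have hbox : ∀ x ∈ P, L v (x - v) ∈ cornerBox (m + 1) (max R 1) := by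
    intro x hx
    refine ⟨(hL v hv).nonneg x hx, fun i => ?_⟩
    have h1 := hR ⟨x, hx, rfl⟩
    rw [mem_closedBall_zero_iff] at h1
    exact ((Real.le_norm_self _).trans (norm_le_pi_norm _ i)).trans (h1.trans (le_max_left _ _))
  refine (measure_mono (t := {x | L v (x - v) ∈ cornerBox (m + 1) (max R 1) ∧ L v (x - v) j = 0})
    fun x hx => ⟨hbox x hx.1, hx.2⟩).trans_lt ?_
  rw [hcA _ (measurableSet_cornerBox _ _), facetMeasure_cornerBox _ (zero_lt_one.trans_le (le_max_right _ _))]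
  exact ENNReal.mul_lt_top ENNReal.ofReal_lt_top ENNReal.ofReal_lt_top

end VertexMeasure

/-! ### Expected volume and integrals in vertex charts -/

section ExpectedVolume

open scoped Topology ENNReal

variable {n : ℕ} {P : Set (EuclideanSpace ℝ (Fin n))}

theorem ae_convexHull_range_subset (hconv : Convex ℝ P) [IsProbabilityMeasure (uniformBoundary P)]
    (hmem : ∀ᵐ x ∂(uniformBoundary P), x ∈ P) (N : ℕ) :
    ∀ᵐ x ∂(boundarySample P N), convexHull ℝ (Set.range x) ⊆ P := by
  have h : ∀ᵐ x ∂(boundarySample P N), ∀ i, x i ∈ P := by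
    rw [ae_all_iff]
    intro i
    exact (measurePreserving_eval (fun _ : Fin N => uniformBoundary P) i).quasiMeasurePreserving.ae
      hmem
  filter_upwards [h] with x hx
  exact convexHull_min (Set.range_subset_iff.2 hx) hconv

theorem measurable_volumeDifference (P : Set (EuclideanSpace ℝ (Fin n))) (N : ℕ) :
    Measurable (volumeDifference P (N := N)) := by
  have h := measurable_measure_prodMk_left (ν := (volume : Measure (EuclideanSpace ℝ (Fin n))))
    (measurableSet_mem_convexHull_range (E := EuclideanSpace ℝ (Fin n)) (ι := Fin N))
  exact measurable_const.sub h.ennreal_toReal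

theorem integrable_volumeDifference (hcomp : IsCompact P) (hconv : Convex ℝ P)
    [IsProbabilityMeasure (uniformBoundary P)]
    (hmem : ∀ᵐ x ∂(uniformBoundary P), x ∈ P) (N : ℕ) :
    Integrable (volumeDifference P) (boundarySample P N) := by
  have : IsProbabilityMeasure (boundarySample P N) := by unfold boundarySample; infer_instance
  refine Integrable.of_bound (measurable_volumeDifference P N).aestronglyMeasurable
    (volume.real P) ?_
  filter_upwards [ae_convexHull_range_subset hconv hmem N] with x hx
  have h1 : volume.real (convexHull ℝ (Set.range x)) ≤ volume.real P :=
    measureReal_mono hx hcomp.measure_lt_top.ne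
  have h2 : 0 ≤ volume.real (convexHull ℝ (Set.range x)) := measureReal_nonneg
  rw [Real.norm_eq_abs, abs_le, volumeDifference]
  constructor <;> linarith

theorem integral_volumeDifference (hcomp : IsCompact P) (hconv : Convex ℝ P)
    [IsProbabilityMeasure (uniformBoundary P)]
    (hmem : ∀ᵐ x ∂(uniformBoundary P), x ∈ P) (N : ℕ) :
    ∫ x, volumeDifference P x ∂(boundarySample P N) =
      ∫ y in P, missProb (uniformBoundary P) N y := by
  have : IsProbabilityMeasure (boundarySample P N) := by unfold boundarySample; infer_instance
  have : IsFiniteMeasure (volume.restrict P) := isFiniteMeasure_restrict.2 hcomp.measure_lt_top.ne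
  set T : Set ((Fin N → EuclideanSpace ℝ (Fin n)) × EuclideanSpace ℝ (Fin n)) :=
    {p | p.2 ∈ convexHull ℝ (Set.range p.1)}ᶜ with hT
  have hTm : MeasurableSet T := measurableSet_mem_convexHull_range.compl
  set F : (Fin N → EuclideanSpace ℝ (Fin n)) → EuclideanSpace ℝ (Fin n) → ℝ :=
    fun x y => T.indicator 1 (x, y) with hF
  have hint : Integrable (Function.uncurry F)
      ((boundarySample P N).prod (volume.restrict P)) :=
    (integrable_const (1 : ℝ)).indicator hTm
  have hswap := integral_integral_swap hint
  have hleft : ∫ x, volumeDifference P x ∂(boundarySample P N) =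
      ∫ x, (∫ y in P, F x y) ∂(boundarySample P N) := by
    refine integral_congr_ae ?_
    filter_upwards [ae_convexHull_range_subset hconv hmem N] with x hx
    have hm : MeasurableSet {y | (x, y) ∈ T} := measurable_prodMk_left hTm
    have hc : MeasurableSet (convexHull ℝ (Set.range x)) :=
      ((Set.finite_range x).isCompact_convexHull ℝ).measurableSet
    have e1 : F x = {y | (x, y) ∈ T}.indicator 1 := rfl
    change _ = ∫ y in P, F x y
    rw [e1, integral_indicator_one hm, measureReal_restrict_apply hm, volumeDifference,
      ← measureReal_sdiff hx hc (hcomp.measure_lt_top.ne)]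
    congr 1
    ext y
    exact and_comm
  rw [hleft, hswap]
  refine integral_congr_ae (ae_of_all _ fun y => ?_)
  have hm : MeasurableSet {x | (x, y) ∈ T} := measurable_prodMk_right hTm
  have e1 : (fun x => F x y) = {x | (x, y) ∈ T}.indicator 1 := rfl
  change ∫ x, F x y ∂(boundarySample P N) = _
  rw [e1, integral_indicator_one hm]
  rfl

theorem integrableOn_missProb_of_isFinite {E : Type*} [NormedAddCommGroup E] [NormedSpace ℝ E]
    [MeasurableSpace E] [BorelSpace E] [FiniteDimensional ℝ E] (μ ρ : Measure E)
    [IsProbabilityMeasure μ] (N : ℕ) {f : E → E} (hf : Measurable f) {D : Set E} (hD : ρ D ≠ ⊤) :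
    IntegrableOn (fun x => missProb μ N (f x)) D ρ := by
  have : IsFiniteMeasure (ρ.restrict D) := isFiniteMeasure_restrict.2 hD
  refine Integrable.of_bound ((measurable_missProb μ N).comp hf).aestronglyMeasurable 1
    (ae_of_all _ fun x => ?_)
  rw [Real.norm_of_nonneg (missProb_nonneg μ N _)]
  exact missProb_le_one μ N _

/-- The homothety with centre `y` and ratio 1 - ε fixes `y` and sends a vertex `v` to the
contraction v + ε(y - v) of `y` towards `v`. So `y` lies in the hull of its contractions, and if `y`
is missed, one of them is. -/
theorem missProb_le_sum_homothety {E : Type*} [NormedAddCommGroup E] [NormedSpace ℝ E]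
    [MeasurableSpace E] [BorelSpace E] [FiniteDimensional ℝ E] (μ : Measure E)
    [IsProbabilityMeasure μ] (N : ℕ) (V : Finset E) {y : E} (hy : y ∈ convexHull ℝ (V : Set E))
    (ε : ℝ) : missProb μ N y ≤ ∑ v ∈ V, missProb μ N (v + ε • (y - v)) := by
  have hsub : {x : Fin N → E | y ∉ convexHull ℝ (Set.range x)} ⊆
      ⋃ v ∈ V, {x | v + ε • (y - v) ∉ convexHull ℝ (Set.range x)} := by
    intro x hx
    by_contra hcon
    simp only [Set.mem_iUnion, Set.mem_ofPred_eq, not_exists, not_not] at hcon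
    refine hx ?_
    have h1 : AffineMap.homothety y (1 - ε) y ∈
        AffineMap.homothety y (1 - ε) '' convexHull ℝ (V : Set E) := ⟨y, hy, rfl⟩
    rw [AffineMap.image_convexHull, AffineMap.homothety_apply_same] at h1
    refine convexHull_min ?_ (convex_convexHull ℝ _) h1
    rintro _ ⟨v, hv, rfl⟩
    have e : AffineMap.homothety y (1 - ε) v = v + ε • (y - v) := by
      rw [AffineMap.homothety_apply, vsub_eq_sub, vadd_eq_add]
      module
    rw [e]
    exact hcon v hv
  exact (measureReal_mono hsub (measure_ne_top _ _)).trans (measureReal_biUnion_finset_le V _)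

variable {L : EuclideanSpace ℝ (Fin n) ≃L[ℝ] (Fin n → ℝ)} {v : EuclideanSpace ℝ (Fin n)}

/-- The chart of the space which sends `v` to the origin, as an affine map. -/
def chartMap (L : EuclideanSpace ℝ (Fin n) ≃L[ℝ] (Fin n → ℝ)) (v : EuclideanSpace ℝ (Fin n)) :
    EuclideanSpace ℝ (Fin n) →ᵃ[ℝ] (Fin n → ℝ) where
  toFun x := L (x - v)
  linear := L.toLinearEquiv.toLinearMap
  map_vadd' x w := by
    change L (w + x - v) = L w + L (x - v)
    rw [add_sub_assoc, map_add]

theorem measurableEmbedding_chart (L : EuclideanSpace ℝ (Fin n) ≃L[ℝ] (Fin n → ℝ))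
    (v : EuclideanSpace ℝ (Fin n)) : MeasurableEmbedding fun x => L (x - v) :=
  ((Homeomorph.subRight v).trans L.toHomeomorph).measurableEmbedding

theorem missProb_chart (μ : Measure (EuclideanSpace ℝ (Fin n))) [IsProbabilityMeasure μ]
    (L : EuclideanSpace ℝ (Fin n) ≃L[ℝ] (Fin n → ℝ)) (v : EuclideanSpace ℝ (Fin n)) (N : ℕ)
    (y : EuclideanSpace ℝ (Fin n)) :
    missProb (μ.map fun x => L (x - v)) N (L (y - v)) = missProb μ N y :=
  missProb_map μ (chartMap L v) (measurableEmbedding_chart L v).measurable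
    (measurableEmbedding_chart L v).injective N y

theorem exists_setIntegral_chart (L : EuclideanSpace ℝ (Fin n) ≃L[ℝ] (Fin n → ℝ))
    (v : EuclideanSpace ℝ (Fin n)) :
    ∃ κ : ℝ, 0 < κ ∧ ∀ (D : Set (Fin n → ℝ)) (f : (Fin n → ℝ) → ℝ),
      ∫ x in (fun x => L (x - v)) ⁻¹' D, f (L (x - v)) = κ * ∫ t in D, f t := by
  have hhaar : (Measure.map L (volume : Measure (EuclideanSpace ℝ (Fin n)))).IsAddHaarMeasure :=
    L.isAddHaarMeasure_map volume
  set κ := Measure.addHaarScalarFactor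
    (Measure.map L (volume : Measure (EuclideanSpace ℝ (Fin n)))) volume with hκ
  have hmap : Measure.map (fun x => L (x - v)) (volume : Measure (EuclideanSpace ℝ (Fin n))) =
      κ • volume := by
    have h1 : (fun x => L (x - v)) = L ∘ fun x => x - v := rfl
    rw [h1, ← Measure.map_map L.continuous.measurable (measurable_sub_const v),
      (measurePreserving_sub_right volume v).map_eq]
    exact Measure.isAddLeftInvariant_eq_smul _ _
  refine ⟨κ, Measure.addHaarScalarFactor_pos_of_isAddHaarMeasure _ _, fun D f => ?_⟩
  rw [← (measurableEmbedding_chart L v).setIntegral_map, hmap, Measure.restrict_smul,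
    integral_smul_nnreal_measure]
  rfl

theorem exists_setIntegral_exp_cornerSum_off_box_le {k : ℕ} (hk : 1 ≤ k) :
    ∃ K : ℝ, 0 < K ∧ ∀ (D : Set (Fin (k + 2) → ℝ)) (κ s R : ℝ), D ⊆ cornerBox (k + 2) R →
      (∀ y ∈ D, y ∉ cornerBox (k + 2) s) → MeasurableSet D → 0 < κ → 0 < s →
      ∫ y in D, Real.exp (-(κ * cornerSum y)) ≤
        K * κ ^ (-((k + 1 : ℝ) / k)) * s ^ (-(1 / (k : ℝ))) := by
  obtain ⟨K, hK, hb⟩ := exists_setIntegral_exp_cornerSum_tail_le hk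
  refine ⟨(k + 2) * K, by positivity, fun D κ s R hDR hDs hD hκ hs => ?_⟩
  have hSm : ∀ i : Fin (k + 2), MeasurableSet (D ∩ {y | s ≤ y i}) := fun i =>
    hD.inter (measurableSet_le measurable_const (measurable_pi_apply i))
  have h1 := setIntegral_le_sum_setIntegral (μ := volume)
    (f := fun y : Fin (k + 2) → ℝ => Real.exp (-(κ * cornerSum y))) (fun y => (Real.exp_pos _).le)
    hD hSm (fun y hy => by
      by_contra hcon
      simp only [Set.mem_iUnion, Set.mem_inter_iff, not_exists, not_and, Set.mem_ofPred_eq,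
        not_le] at hcon
      exact hDs y hy ⟨(hDR hy).1, fun i => (hcon i hy).le⟩)
    (fun i => integrableOn_of_continuous_of_subset_cornerBox (continuous_exp_cornerSum κ)
      (Set.inter_subset_left.trans hDR))
  refine h1.trans ((Finset.sum_le_card_nsmul _ _ _ fun i _ => hb i _ κ s
    (fun y hy => ⟨(hDR hy.1).1, hy.2⟩) (hSm i) hκ hs).trans_eq ?_)
  rw [Finset.card_univ, Fintype.card_fin, nsmul_eq_mul]
  push_cast
  ring

/-- Contraction by ε brings all of `P` into the cube where the exponential bound is valid, and
homogeneity of `cornerSum` puts ε^(k+1) into the rate. The uncontracted points avoid a cube at the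
corner, so the faster tail decay applies. -/
theorem exists_setIntegral_missProb_off_box_le {k : ℕ} (hk : 1 ≤ k)
    {P : Set (EuclideanSpace ℝ (Fin (k + 2)))} (hcomp : IsCompact P)
    (μ : Measure (EuclideanSpace ℝ (Fin (k + 2)))) [IsProbabilityMeasure μ]
    (L : EuclideanSpace ℝ (Fin (k + 2)) ≃L[ℝ] (Fin (k + 2) → ℝ))
    (v : EuclideanSpace ℝ (Fin (k + 2))) {α : Fin (k + 2) → ℝ} {s : ℝ}
    (h : IsCornerMeasure α s (μ.map fun x => L (x - v))) {ε : ℝ} (hε : 0 < ε)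
    (hεP : ∀ x ∈ P, ε • L (x - v) ∈ cornerBox (k + 2) (s / 2)) :
    ∃ C : ℝ, ∀ W ⊆ P, MeasurableSet W → (∀ x ∈ W, L (x - v) ∉ cornerBox (k + 2) (s / 2)) →
      ∀ N : ℕ, 1 ≤ N →
        ∫ x in W, missProb μ N (v + ε • (x - v)) ≤ C * (N : ℝ) ^ (-((k + 1 : ℝ) / k)) := by
  obtain ⟨K, hK, hb⟩ := exists_setIntegral_exp_cornerSum_off_box_le hk
  obtain ⟨κ, hκ, hchart⟩ := exists_setIntegral_chart L v
  obtain ⟨a, ha, haα⟩ := exists_pos_le h.pos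
  have := h.prob
  have hs := h.side_pos
  set A : ℝ := 2 ^ (k + 1 + 1) * (((k + 1 : ℕ) : ℝ) + 1) with hA
  set b : ℝ := a / ((((k + 1 : ℕ) : ℝ) + 1) * 2 ^ (k + 1)) * ε ^ (k + 1) with hbdef
  have hApos : 0 < A := by positivity
  have hbpos : 0 < b := by positivity
  refine ⟨A * (κ * (K * b ^ (-((k + 1 : ℝ) / k)) * (s / 2) ^ (-(1 / (k : ℝ))))),
    fun W hWP hW hoff N hN => ?_⟩
  have hN0 : (0 : ℝ) < N := by exact_mod_cast hN
  have hpt : ∀ x ∈ W, missProb μ N (v + ε • (x - v)) ≤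
      A * Real.exp (-(b * N * cornerSum (L (x - v)))) := by
    intro x hx
    rw [← missProb_chart μ L v, add_sub_cancel_left, map_smul]
    refine (missProb_le_localMissProb _ (cornerBox (k + 2) s) N _).trans ?_
    refine (h.localMissProb_le (by omega) haα ha (hεP x (hWP hx)) N).trans_eq ?_
    rw [cornerSum_smul, hA, hbdef]
    congr 3
    ring
  have hcont : Continuous fun x => A * Real.exp (-(b * N * cornerSum (L (x - v)))) :=
    continuous_const.mul ((continuous_exp_cornerSum (b * N)).comp
      (L.continuous.comp (continuous_id.sub continuous_const)))
  have hWtop : volume W ≠ ⊤ := ((measure_mono hWP).trans_lt hcomp.measure_lt_top).ne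
  have hWpre : (fun x => L (x - v)) ⁻¹' ((fun x => L (x - v)) '' W) = W :=
    (measurableEmbedding_chart L v).injective.preimage_image W
  calc ∫ x in W, missProb μ N (v + ε • (x - v))
      ≤ ∫ x in W, A * Real.exp (-(b * N * cornerSum (L (x - v)))) := by
        refine setIntegral_mono_on ?_ ?_ hW hpt
        · exact integrableOn_missProb_of_isFinite μ volume N (f := fun x => v + ε • (x - v))
            (by fun_prop) hWtop
        · exact (hcont.continuousOn.integrableOn_compact hcomp).mono_set hWP
    _ = A * (κ * ∫ t in (fun x => L (x - v)) '' W, Real.exp (-(b * N * cornerSum t))) := by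
        rw [integral_const_mul, ← hchart, hWpre]
    _ ≤ A * (κ * (K * (b * N) ^ (-((k + 1 : ℝ) / k)) * (s / 2) ^ (-(1 / (k : ℝ))))) := by
        refine mul_le_mul_of_nonneg_left (mul_le_mul_of_nonneg_left ?_ hκ.le) hApos.le
        -- The outer side s/(2ε) contains the chart image of `P` by the choice of ε; it does not
        -- enter the bound.
        refine hb _ (b * N) (s / 2) (s / 2 / ε) ?_ ?_
          ((measurableEmbedding_chart L v).measurableSet_image.2 hW) (by positivity) (by positivity)
        · rintro _ ⟨x, hx, rfl⟩
          have hx' := hεP x (hWP hx)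
          refine ⟨fun i => ?_, fun i => ?_⟩
          · have := hx'.1 i
            rw [Pi.smul_apply, smul_eq_mul] at this
            exact nonneg_of_mul_nonneg_right this hε
          · have := hx'.2 i
            rw [Pi.smul_apply, smul_eq_mul] at this
            exact (le_div_iff₀' hε).2 this
        · rintro _ ⟨x, hx, rfl⟩
          exact hoff x hx
    _ = _ := by
        rw [Real.mul_rpow hbpos.le hN0.le]
        ring

end ExpectedVolume

/-! ### Asymptotics for simple polytopes -/

section Asymptotics

open scoped Topology ENNReal

theorem IsSimplePolytope.isCompact {n : ℕ} {P : Set (EuclideanSpace ℝ (Fin n))}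
    (hP : IsSimplePolytope P) : IsCompact P := by
  obtain ⟨t, rfl⟩ := hP.exists_finset
  exact t.finite_toSet.isCompact_convexHull ℝ

theorem IsSimplePolytope.convex {n : ℕ} {P : Set (EuclideanSpace ℝ (Fin n))}
    (hP : IsSimplePolytope P) : Convex ℝ P := by
  obtain ⟨t, rfl⟩ := hP.exists_finset
  exact convex_convexHull ℝ _

theorem IsSimplePolytope.finite_extremePoints {n : ℕ} {P : Set (EuclideanSpace ℝ (Fin n))}
    (hP : IsSimplePolytope P) : (P.extremePoints ℝ).Finite := by
  obtain ⟨t, rfl⟩ := hP.exists_finset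
  exact t.finite_toSet.subset extremePoints_convexHull_subset

theorem IsSimplePolytope.convexHull_extremePoints {n : ℕ} {P : Set (EuclideanSpace ℝ (Fin n))}
    (hP : IsSimplePolytope P) : convexHull ℝ (P.extremePoints ℝ) = P := by
  rw [← (hP.finite_extremePoints.isCompact_convexHull ℝ).isClosed.closure_eq]
  exact closure_convexHull_extremePoints hP.isCompact hP.convex

theorem IsSimplePolytope.extremePoints_nonempty {n : ℕ} {P : Set (EuclideanSpace ℝ (Fin n))}
    (hP : IsSimplePolytope P) : (P.extremePoints ℝ).Nonempty :=
  hP.isCompact.extremePoints_nonempty (hP.interior_nonempty.mono interior_subset)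

theorem IsSimplePolytope.hausdorffMeasure_frontier {m : ℕ}
    {P : Set (EuclideanSpace ℝ (Fin (m + 1)))} (hP : IsSimplePolytope P) :
    μH[(m : ℝ)] (frontier P) ≠ 0 ∧ μH[(m : ℝ)] (frontier P) ≠ ⊤ := by
  obtain ⟨L, hL, hfr⟩ := hP.exists_charts (by omega)
  obtain ⟨v, hv⟩ := hP.extremePoints_nonempty
  exact ⟨hausdorffMeasure_frontier_ne_zero (hL v hv),
    hausdorffMeasure_frontier_ne_top hP.isCompact hP.finite_extremePoints L hL hfr⟩

theorem IsSimplePolytope.isProbabilityMeasure {m : ℕ}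
    {P : Set (EuclideanSpace ℝ (Fin (m + 1)))} (hP : IsSimplePolytope P) :
    IsProbabilityMeasure (uniformBoundary P) := by
  have e : (((m + 1 : ℕ) : ℝ) - 1) = m := by push_cast; ring
  rw [uniformBoundary, e]
  exact ProbabilityTheory.cond_isProbabilityMeasure_of_finite hP.hausdorffMeasure_frontier.1
    hP.hausdorffMeasure_frontier.2

theorem ae_uniformBoundary_mem {m : ℕ} {P : Set (EuclideanSpace ℝ (Fin (m + 1)))}
    (hP : IsClosed P) : ∀ᵐ x ∂(uniformBoundary P), x ∈ P := by
  have e : frontier P ∩ {x | x ∉ P} = ∅ := by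
    ext x
    simp only [Set.mem_inter_iff, Set.mem_ofPred_eq, Set.mem_empty_iff_false, iff_false, not_and,
      not_not]
    exact fun hx => hP.frontier_subset hx
  rw [ae_iff, uniformBoundary_apply, e, measure_empty, mul_zero]

theorem eventually_disjoint_chart_boxes {n : ℕ}
    (L L' : EuclideanSpace ℝ (Fin n) ≃L[ℝ] (Fin n → ℝ)) {v w : EuclideanSpace ℝ (Fin n)}
    (hvw : v ≠ w) :
    ∀ᶠ s : ℝ in 𝓝[>] 0, Disjoint ((fun x => L (x - v)) ⁻¹' cornerBox n (s / 2))
      ((fun x => L' (x - w)) ⁻¹' cornerBox n (s / 2)) := by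
  have hlim : Tendsto (fun s : ℝ => (‖(L.symm : (Fin n → ℝ) →L[ℝ] EuclideanSpace ℝ (Fin n))‖ +
      ‖(L'.symm : (Fin n → ℝ) →L[ℝ] EuclideanSpace ℝ (Fin n))‖) * (s / 2)) (𝓝[>] 0) (𝓝 0) := by
    have : Continuous fun s : ℝ =>
        (‖(L.symm : (Fin n → ℝ) →L[ℝ] EuclideanSpace ℝ (Fin n))‖ +
        ‖(L'.symm : (Fin n → ℝ) →L[ℝ] EuclideanSpace ℝ (Fin n))‖) * (s / 2) := by fun_prop
    have h := this.tendsto 0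
    rw [zero_div, mul_zero] at h
    exact h.mono_left nhdsWithin_le_nhds
  have key : ∀ (M : EuclideanSpace ℝ (Fin n) ≃L[ℝ] (Fin n → ℝ)) (x u : EuclideanSpace ℝ (Fin n))
      (s : ℝ), 0 < s → M (x - u) ∈ cornerBox n (s / 2) →
      ‖x - u‖ ≤ ‖(M.symm : (Fin n → ℝ) →L[ℝ] EuclideanSpace ℝ (Fin n))‖ * (s / 2) := by
    intro M x u s hs hx
    have h1 := (M.symm : (Fin n → ℝ) →L[ℝ] EuclideanSpace ℝ (Fin n)).le_opNorm (M (x - u))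
    rw [ContinuousLinearEquiv.coe_coe, M.symm_apply_apply] at h1
    refine h1.trans (mul_le_mul_of_nonneg_left ?_ (norm_nonneg _))
    refine (pi_norm_le_iff_of_nonneg (half_pos hs).le).2 fun j => ?_
    rw [Real.norm_of_nonneg (hx.1 j)]
    exact hx.2 j
  filter_upwards [hlim.eventually_lt_const (norm_pos_iff.2 (sub_ne_zero.2 hvw)),
    self_mem_nhdsWithin] with s hs hs0
  rw [Set.disjoint_left]
  intro x hx hx'
  have h1 := key L x v s hs0 hx
  have h2 := key L' x w s hs0 hx'
  have h3 : ‖v - w‖ ≤ ‖x - w‖ + ‖x - v‖ := by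
    have : v - w = (x - w) - (x - v) := by abel
    rw [this]
    exact norm_sub_le _ _
  linarith

theorem IsVertexChart.eventually_smul_mem {n : ℕ} {P : Set (EuclideanSpace ℝ (Fin n))}
    {v : EuclideanSpace ℝ (Fin n)} {L : EuclideanSpace ℝ (Fin n) ≃L[ℝ] (Fin n → ℝ)}
    (h : IsVertexChart P v L) (hP : IsCompact P) {s : ℝ} (hs : 0 < s) :
    ∀ᶠ ε : ℝ in 𝓝[>] 0, ∀ x ∈ P, ε • L (x - v) ∈ cornerBox n s := by
  have hcont : Continuous fun x => L (x - v) :=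
    L.continuous.comp (continuous_id.sub continuous_const)
  obtain ⟨R, hR⟩ := (hP.image hcont).isBounded.subset_closedBall 0
  have hlim : Tendsto (fun ε : ℝ => ε * R) (𝓝[>] 0) (𝓝 0) := by
    have h := (continuous_mul_const R).tendsto (0 : ℝ)
    rw [zero_mul] at h
    exact h.mono_left nhdsWithin_le_nhds
  filter_upwards [hlim.eventually_lt_const hs, self_mem_nhdsWithin] with ε hε hε0 x hx
  have hε0 : 0 < ε := hε0
  refine ⟨fun j => ?_, fun j => ?_⟩
  · exact mul_nonneg hε0.le (h.nonneg x hx j)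
  · have h1 := hR ⟨x, hx, rfl⟩
    rw [mem_closedBall_zero_iff] at h1
    have h2 : L (x - v) j ≤ R := ((Real.le_norm_self _).trans (norm_le_pi_norm _ j)).trans h1
    exact (mul_le_mul_of_nonneg_left h2 hε0.le).trans hε.le

theorem IsSimplePolytope.isBigO_setIntegral_missProb {k : ℕ} (hk : 1 ≤ k)
    {P : Set (EuclideanSpace ℝ (Fin (k + 2)))} (hP : IsSimplePolytope P) :
    ∃ c : ℝ, 0 < c ∧
      (fun N : ℕ => (N : ℝ) ^ ((k + 2 : ℝ) / (k + 1)) *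
        (∫ y in P, missProb (uniformBoundary P) N y) - c) =O[atTop]
      fun N : ℕ => (N : ℝ) ^ (-(1 / ((k + 1 : ℝ) * k))) := by
  have hprob : IsProbabilityMeasure (uniformBoundary P) := hP.isProbabilityMeasure
  have hcomp := hP.isCompact
  obtain ⟨L, hL, -⟩ := hP.exists_charts (by omega)
  set V := hP.finite_extremePoints.toFinset with hVdef
  have hV : ∀ v, v ∈ V ↔ v ∈ P.extremePoints ℝ := fun v => by rw [hVdef, Set.Finite.mem_toFinset]
  have hVhull : convexHull ℝ (V : Set (EuclideanSpace ℝ (Fin (k + 2)))) = P := by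
    rw [hVdef, Set.Finite.coe_toFinset, hP.convexHull_extremePoints]
  -- One side length serves all vertices: small enough for every chart to yield a corner measure,
  -- and for the cubes at different vertices to be disjoint.
  have hev : ∀ᶠ s : ℝ in 𝓝[>] 0, ∀ v ∈ V,
      ((∀ x, L v (x - v) ∈ cornerBox (k + 2) s → x ∈ P) ∧
      ∃ α, IsCornerMeasure (n := k + 1) α s ((uniformBoundary P).map fun x => L v (x - v))) ∧
      ∀ w ∈ V, v ≠ w → Disjoint ((fun x => L v (x - v)) ⁻¹' cornerBox (k + 2) (s / 2))
        ((fun x => L w (x - w)) ⁻¹' cornerBox (k + 2) (s / 2)) := by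
    rw [Finset.eventually_all]
    intro v hv
    refine Eventually.and ?_ ?_
    · obtain ⟨s₁, hs₁, h1, α, h2⟩ := (hL v ((hV v).1 hv)).exists_isCornerMeasure hcomp.isClosed
        hprob hP.hausdorffMeasure_frontier.1 hP.hausdorffMeasure_frontier.2
      filter_upwards [Ioo_mem_nhdsGT hs₁] with s hs
      exact ⟨fun x hx => h1 x (cornerBox_mono hs.2.le hx), α, h2.mono hs.1 hs.2.le⟩
    · rw [Finset.eventually_all]
      intro w hw
      by_cases hvw : v = w
      · exact Eventually.of_forall fun s h => absurd hvw h
      · exact (eventually_disjoint_chart_boxes (L v) (L w) hvw).mono fun s hs _ => hs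
  obtain ⟨s, hs, hs0⟩ := (hev.and self_mem_nhdsWithin).exists
  have hs0 : 0 < s := hs0
  obtain ⟨ε, hε, hε0⟩ := ((Finset.eventually_all V).2 (fun v hv =>
    (hL v ((hV v).1 hv)).eventually_smul_mem hcomp (half_pos hs0)) |>.and
      self_mem_nhdsWithin).exists
  have hε0 : 0 < ε := hε0
  set box : EuclideanSpace ℝ (Fin (k + 2)) → Set (EuclideanSpace ℝ (Fin (k + 2))) :=
    fun v => (fun x => L v (x - v)) ⁻¹' cornerBox (k + 2) (s / 2) with hbox
  have hboxm : ∀ v, MeasurableSet (box v) := fun v =>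
    (measurableEmbedding_chart (L v) v).measurable (measurableSet_cornerBox _ _)
  have hboxP : ∀ v ∈ V, box v ⊆ P := fun v hv x hx =>
    (hs v hv).1.1 x (cornerBox_mono (by linarith) hx)
  set U := ⋃ v ∈ V, box v with hU
  have hUm : MeasurableSet U := Finset.measurableSet_biUnion V fun v _ => hboxm v
  have hUP : U ⊆ P := Set.iUnion₂_subset hboxP
  choose κ hκ hchart using fun v => exists_setIntegral_chart (L v) v
  have hlim : ∀ v, ∃ c : ℝ, v ∈ V → 0 < c ∧
      (fun N : ℕ => (N : ℝ) ^ ((k + 2 : ℝ) / (k + 1)) *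
        (∫ t in cornerBox (k + 2) (s / 2),
          missProb ((uniformBoundary P).map fun x => L v (x - v)) N t) - c) =O[atTop]
      fun N : ℕ => (N : ℝ) ^ (-(1 / ((k + 1 : ℝ) * k))) := by
    intro v
    by_cases hv : v ∈ V
    · obtain ⟨α, hα⟩ := (hs v hv).1.2
      obtain ⟨c, hc⟩ := IsCornerMeasure.exists_limit hk hα
      exact ⟨c, fun _ => hc⟩
    · exact ⟨0, fun h => absurd h hv⟩
  choose c hc using hlim
  have hoff : ∀ v, ∃ C : ℝ, v ∈ V → ∀ N : ℕ, 1 ≤ N →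
      ∫ x in P \ U, missProb (uniformBoundary P) N (v + ε • (x - v)) ≤
        C * (N : ℝ) ^ (-((k + 1 : ℝ) / k)) := by
    intro v
    by_cases hv : v ∈ V
    · obtain ⟨α, hα⟩ := (hs v hv).1.2
      obtain ⟨C, hC⟩ := exists_setIntegral_missProb_off_box_le hk hcomp (uniformBoundary P) (L v) v
        hα hε0 (hε v hv)
      exact ⟨C, fun _ => hC _ Set.sdiff_subset (hcomp.measurableSet.diff hUm)
        fun x hx hxb => hx.2 (Set.mem_biUnion hv hxb)⟩
    · exact ⟨0, fun h => absurd h hv⟩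
  choose C hC using hoff
  have hPint : ∀ N, IntegrableOn (missProb (uniformBoundary P) N) P := fun N =>
    integrableOn_missProb_of_isFinite (uniformBoundary P) volume N measurable_id
      hcomp.measure_lt_top.ne
  -- Vertex cubes carry the main term, each with the volume factor κ of its chart; the remainder of
  -- `P` goes into the error.
  have hsplit : ∀ N, ∫ y in P, missProb (uniformBoundary P) N y =
      ∑ v ∈ V, κ v * (∫ t in cornerBox (k + 2) (s / 2),
        missProb ((uniformBoundary P).map fun x => L v (x - v)) N t) +
      ∫ y in P \ U, missProb (uniformBoundary P) N y := by
    intro N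
    have h1 : ∫ y in U, missProb (uniformBoundary P) N y = ∑ v ∈ V, κ v *
        (∫ t in cornerBox (k + 2) (s / 2),
          missProb ((uniformBoundary P).map fun x => L v (x - v)) N t) := by
      rw [hU, integral_biUnion_finset V (fun v _ => hboxm v)
        (fun v hv w hw hvw => (hs v hv).2 w hw hvw)
        fun v hv => (hPint N).mono_set (hboxP v hv)]
      refine Finset.sum_congr rfl fun v _ => ?_
      rw [← hchart]
      refine setIntegral_congr_fun (hboxm v) fun x _ => ?_
      exact (missProb_chart (uniformBoundary P) (L v) v N x).symm
    rw [setIntegral_sdiff hUm (hPint N) hUP, h1]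
    ring
  have hrest : ∀ N : ℕ, 1 ≤ N → ∫ y in P \ U, missProb (uniformBoundary P) N y ≤
      (∑ v ∈ V, C v) * (N : ℝ) ^ (-((k + 1 : ℝ) / k)) := by
    intro N hN
    have hfin : volume (P \ U) ≠ ⊤ :=
      ((measure_mono Set.sdiff_subset).trans_lt hcomp.measure_lt_top).ne
    have hint : ∀ v ∈ V, IntegrableOn
        (fun x => missProb (uniformBoundary P) N (v + ε • (x - v))) (P \ U) := fun v _ =>
      integrableOn_missProb_of_isFinite (uniformBoundary P) volume N
        (f := fun x => v + ε • (x - v)) (by fun_prop) hfin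
    calc ∫ y in P \ U, missProb (uniformBoundary P) N y
        ≤ ∫ y in P \ U, ∑ v ∈ V, missProb (uniformBoundary P) N (v + ε • (y - v)) := by
          refine setIntegral_mono_on ((hPint N).mono_set Set.sdiff_subset)
            (integrable_finsetSum _ hint) (hcomp.measurableSet.diff hUm) fun y hy => ?_
          exact missProb_le_sum_homothety _ N V (by rw [hVhull]; exact hy.1) ε
      _ = ∑ v ∈ V, ∫ y in P \ U, missProb (uniformBoundary P) N (v + ε • (y - v)) :=
          integral_finsetSum _ hint
      _ ≤ ∑ v ∈ V, C v * (N : ℝ) ^ (-((k + 1 : ℝ) / k)) :=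
          Finset.sum_le_sum fun v hv => hC v hv N hN
      _ = _ := by rw [Finset.sum_mul]
  have hk0 : (0 : ℝ) < k := by exact_mod_cast hk
  refine ⟨∑ v ∈ V, κ v * c v, ?_, ?_⟩
  · obtain ⟨v₀, hv₀⟩ := hP.extremePoints_nonempty
    exact Finset.sum_pos (fun v hv => mul_pos (hκ v) (hc v hv).1) ⟨v₀, (hV v₀).2 hv₀⟩
  have hsum : (fun N : ℕ => ∑ v ∈ V, κ v * ((N : ℝ) ^ ((k + 2 : ℝ) / (k + 1)) *
        (∫ t in cornerBox (k + 2) (s / 2),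
          missProb ((uniformBoundary P).map fun x => L v (x - v)) N t) - c v)) =O[atTop]
      fun N : ℕ => (N : ℝ) ^ (-(1 / ((k + 1 : ℝ) * k))) :=
    IsBigO.fun_sum fun v hv => (hc v hv).2.const_mul_left (κ v)
  have htail : (fun N : ℕ => (N : ℝ) ^ ((k + 2 : ℝ) / (k + 1)) *
        ∫ y in P \ U, missProb (uniformBoundary P) N y) =O[atTop]
      fun N : ℕ => (N : ℝ) ^ (-(1 / ((k + 1 : ℝ) * k))) := by
    refine IsBigO.of_bound (∑ v ∈ V, C v) ?_
    filter_upwards [eventually_ge_atTop 1] with N hN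
    have hN0 : (0 : ℝ) < N := by exact_mod_cast hN
    -- The exponent identity (k+1)/k - (k+2)/(k+1) = 1/((k+1)k) makes the contribution away from the
    -- vertices exactly of the error order.
    have e : (N : ℝ) ^ (-(1 / ((k + 1 : ℝ) * k))) =
        (N : ℝ) ^ ((k + 2 : ℝ) / (k + 1)) * (N : ℝ) ^ (-((k + 1 : ℝ) / k)) := by
      rw [← Real.rpow_add hN0]
      congr 1
      field_simp
      ring
    rw [Real.norm_of_nonneg (Real.rpow_nonneg hN0.le _), Real.norm_of_nonneg
      (mul_nonneg (Real.rpow_nonneg hN0.le _)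
        (integral_nonneg fun y => missProb_nonneg _ N y)), e]
    have := mul_le_mul_of_nonneg_left (hrest N hN)
      (Real.rpow_nonneg hN0.le ((k + 2 : ℝ) / (k + 1)))
    refine this.trans_eq ?_
    ring
  refine (hsum.add htail).congr_left fun N => ?_
  rw [hsplit N, mul_add, Finset.mul_sum, add_sub_right_comm, ← Finset.sum_sub_distrib]
  congr 1
  exact Finset.sum_congr rfl fun v _ => by ring

end Asymptotics

/-! ### The asymptotic formula for the expected volume difference -/

theorem theorem2 {n : ℕ} (hn : 3 ≤ n) (P : Set (EuclideanSpace ℝ (Fin n)))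
    (hP : IsSimplePolytope P) :
    (∀ N : ℕ, Integrable (volumeDifference P) (boundarySample P N)) ∧
    ∃ c : ℝ, 0 < c ∧ ∃ ε : ℕ → ℝ,
      (ε =O[atTop] fun N : ℕ => (N : ℝ) ^ (-(1 / (((n : ℝ) - 1) * ((n : ℝ) - 2))))) ∧
      ∀ N : ℕ, 1 ≤ N →
        ∫ x, volumeDifference P x ∂(boundarySample P N) =
          c * (N : ℝ) ^ (-((n : ℝ) / ((n : ℝ) - 1))) * (1 + ε N) := by
  obtain ⟨k, rfl⟩ : ∃ k, n = k + 2 := ⟨n - 2, by omega⟩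
  have hprob : IsProbabilityMeasure (uniformBoundary P) := hP.isProbabilityMeasure
  have hmem := ae_uniformBoundary_mem hP.isCompact.isClosed
  refine ⟨integrable_volumeDifference hP.isCompact hP.convex hmem, ?_⟩
  obtain ⟨c, hc, hO⟩ := hP.isBigO_setIntegral_missProb (by omega)
  have e1 : ((k + 2 : ℕ) : ℝ) - 1 = k + 1 := by push_cast; ring
  have e2 : ((k + 2 : ℕ) : ℝ) - 2 = k := by push_cast; ring
  have e3 : ((k + 2 : ℕ) : ℝ) = k + 2 := by push_cast; ring
  -- The error is defined as the relative deviation from the limit, so the formula is an identity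
  -- for every N ≥ 1 and only its order needs the asymptotics.
  refine ⟨c, hc, fun N => c⁻¹ * ((N : ℝ) ^ ((k + 2 : ℝ) / (k + 1)) *
    (∫ y in P, missProb (uniformBoundary P) N y) - c), ?_, fun N hN => ?_⟩
  · rw [e1, e2]
    exact hO.const_mul_left c⁻¹
  · have hN0 : (0 : ℝ) < N := by exact_mod_cast hN
    rw [integral_volumeDifference hP.isCompact hP.convex hmem, e1, e3, Real.rpow_neg hN0.le]
    have := (Real.rpow_pos_of_pos hN0 ((k + 2 : ℝ) / (k + 1))).ne'
    field_simp
    ring
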